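/- For $-\frac12\le\mu<-\frac38$ let $\bar U^{\mu}=(\bar U^\mu_\theta,0)$ with $\bar U^{\mu}_\theta(x)=(1+\sqrt{1+2\mu})(1-x)$ (this is the no-swirl solution $U^{\mu,-1-\sqrt{1+2\mu}}$), let $b_\mu(x)=\int_0^x\frac{\bar U^\mu_\theta(s)}{1-s^2}\,ds$ and $V^2_\mu=\big(0,\int_x^1e^{-b_\mu(t)}\,dt\big)$. For a function $U_\phi$ on $(-1,1]$ put $$\psi[U_\phi](x)=\int_x^1\int_l^1\int_t^1\frac{2U_\phi(s)U_\phi'(s)}{1-s^2}\,ds\,dt\,dl .$$ A pair $U=(U_\theta,U_\phi)$, with $U_\theta\in C^1(-1,1)$, $U_\phi\in C^2(-1,1)$ and $\frac{U_\phi U_\phi'}{1-s^2}$ integrable on $(t,1)$ for each $t\in(-1,1)$, is said to satisfy $(\ast)$ with the constant $\hat\mu\in\mathbb R$ if on $(-1,1)$ $$(1-x^2)U_\theta'+2xU_\theta+\tfrac12U_\theta^2-\psi[U_\phi](x)=\hat\mu(1-x)^2,\qquad (1-x^2)U_\phi''+U_\theta U_\phi'=0 .$$ Let $K$ be a compact subset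 of $(-\frac12,-\frac38)$ or $K=\{-\frac12\}$, and let $0<\epsilon<\frac12$ satisfy $\sqrt{1+2\mu}<\epsilon$ for all $\mu\in K$. Let $\mathbf M_1$ be the space of $f\in C([-1,1])\cap C^1((-1,1])\cap C^2((0,1))$ with $f(\pm1)=0$ and finite norm $$\|f\|_{\mathbf M_1}=\|(1+x)^{-1+2\epsilon}f\|_{L^\infty(-1,1)}+\|(1+x)^{2\epsilon}f'\|_{L^\infty(-1,1)}+\|f''\|_{L^\infty(0,1)},$$ and $\mathbf M_2$ the space of $f\in C^1((-1,1])\cap C^2((-1,1))$ with $f(1)=0$ and finite norm $$\|f\|_{\mathbf M_2}=\|(1+x)^{\epsilon}f\|_{L^\infty(-1,1)}+\|(1+x)^{1+\epsilon}f'\|_{L^\infty(-1,1)}+\|(1+x)^{2+\epsilon}f''\|_{L^\infty(-1,1)}.$$ Let $\mathbf X=\mathbf M_1\times\mathbf M_2$ with $\|(U_\theta,U_\phi)\|_{\mathbf X}=\|U_\theta\|_{\mathbf M_1}+\|U_\phi\|_{\mathbf M_2}$, and $\mathbf X_1=\{V\in\mathbf X: V_\phi(0)=0\}$. Then there exist $\delta>0$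 and $V\in C^\infty(K\times(-\delta,\delta),\mathbf X_1)$ (that is, $V$ extends to a $C^\infty$ map $O\times(-\delta,\delta)\to\mathbf X_1$ for some open set $O\supseteq K$) such that, for all $\mu\in K$, $V(\mu,0)=0$, $\frac{\partial V}{\partial\beta}(\mu,0)=0$, and for all $|\beta|<\delta$ $$U=\bar U^{\mu}+\beta V^2_{\mu}+V(\mu,\beta)\tag{1}$$ satisfies $(\ast)$ with $\hat\mu=\mu-\frac14\psi[U_\phi](-1)$, where the integral $\psi[U_\phi](-1)$ converges; moreover the swirl $U_\phi$ is not identically zero on $(-1,1)$ if $\beta\neq0$. Furthermore there exists $\delta'>0$ such that if $\mu\in K$, $U-\bar U^{\mu}\in\mathbf X$, $\|U-\bar U^{\mu}\|_{\mathbf X}<\delta'$, and $U$ satisfies $(\ast)$ with some constant $\hat\mu$, then $(1)$ holds for some $|\beta|<\delta$. -/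

import Mathlib

open Set MeasureTheory
open scoped ContDiff

namespace ConicalNS

/-! ### Weighted sup norms -/

/-- The weighted norm `‖w f‖_{L^∞(s)}`. It is only used for functions that are continuous on the
open interval `s`, where the essential supremum is the supremum. -/
noncomputable def wSup (s : Set ℝ) (w f : ℝ → ℝ) : ℝ := ⨆ x : s, |w x * f x|

/-- Finiteness of the weighted norm `‖w f‖_{L^∞(s)}`. -/
def WBdd (s : Set ℝ) (w f : ℝ → ℝ) : Prop := BddAbove (range fun x : s => |w x * f x|)

section WeightedSup

variable {s : Set ℝ} {w f g h : ℝ → ℝ}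

theorem wSup_nonneg : 0 ≤ wSup s w f := Real.iSup_nonneg fun _ => abs_nonneg _

theorem le_wSup (hf : WBdd s w f) {x : ℝ} (hx : x ∈ s) : |w x * f x| ≤ wSup s w f :=
  le_ciSup hf (⟨x, hx⟩ : s)

theorem wbdd_of_le {C : ℝ} (hC : ∀ x ∈ s, |w x * f x| ≤ C) : WBdd s w f :=
  ⟨C, by rintro _ ⟨x, rfl⟩; exact hC x x.2⟩

theorem wSup_le {C : ℝ} (h0 : 0 ≤ C) (hC : ∀ x ∈ s, |w x * f x| ≤ C) : wSup s w f ≤ C :=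
  Real.iSup_le (fun x => hC x x.2) h0

theorem abs_add_le_wSup (hf : WBdd s w f) (hg : WBdd s w g) (hh : ∀ x ∈ s, h x = f x + g x) :
    ∀ x ∈ s, |w x * h x| ≤ wSup s w f + wSup s w g := fun x hx => by
  rw [hh x hx, mul_add]
  exact (abs_add_le _ _).trans (add_le_add (le_wSup hf hx) (le_wSup hg hx))

theorem abs_smul_le_wSup (c : ℝ) (hf : WBdd s w f) (hh : ∀ x ∈ s, h x = c * f x) :
    ∀ x ∈ s, |w x * h x| ≤ |c| * wSup s w f := fun x hx => by
  rw [hh x hx, mul_left_comm, abs_mul]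
  exact mul_le_mul_of_nonneg_left (le_wSup hf hx) (abs_nonneg _)

theorem WBdd.add (hf : WBdd s w f) (hg : WBdd s w g) (hh : ∀ x ∈ s, h x = f x + g x) :
    WBdd s w h := wbdd_of_le (abs_add_le_wSup hf hg hh)

theorem WBdd.smul (c : ℝ) (hf : WBdd s w f) (hh : ∀ x ∈ s, h x = c * f x) :
    WBdd s w h := wbdd_of_le (abs_smul_le_wSup c hf hh)

theorem wSup_add (hf : WBdd s w f) (hg : WBdd s w g) (hh : ∀ x ∈ s, h x = f x + g x) :
    wSup s w h ≤ wSup s w f + wSup s w g :=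
  wSup_le (add_nonneg wSup_nonneg wSup_nonneg) (abs_add_le_wSup hf hg hh)

theorem wSup_smul (c : ℝ) (hf : WBdd s w f) (hh : ∀ x ∈ s, h x = c * f x) :
    wSup s w h ≤ |c| * wSup s w f :=
  wSup_le (mul_nonneg (abs_nonneg _) wSup_nonneg) (abs_smul_le_wSup c hf hh)

theorem wbdd_zero (hh : ∀ x ∈ s, h x = 0) : WBdd s w h :=
  wbdd_of_le (C := 0) fun x hx => by simp [hh x hx]

theorem wSup_zero (hh : ∀ x ∈ s, h x = 0) : wSup s w h = 0 :=
  le_antisymm (wSup_le le_rfl fun x hx => by simp [hh x hx]) wSup_nonneg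

theorem eq_zero_of_wSup (hf : WBdd s w f) (hw : ∀ x ∈ s, 0 < w x) (h0 : wSup s w f ≤ 0) :
    ∀ x ∈ s, f x = 0 := fun x hx => by
  have h1 : |w x * f x| ≤ 0 := (le_wSup hf hx).trans h0
  rcases mul_eq_zero.1 (abs_nonpos_iff.1 h1) with h2 | h2
  · exact absurd h2 (hw x hx).ne'
  · exact h2

theorem deriv_add_on (hs : IsOpen s) (hf : DifferentiableOn ℝ f s)
    (hg : DifferentiableOn ℝ g s) : ∀ x ∈ s, deriv (f + g) x = deriv f x + deriv g x :=
  fun _ hx => deriv_add (hf.differentiableAt (hs.mem_nhds hx)) (hg.differentiableAt (hs.mem_nhds hx))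

theorem deriv_smul_on (c : ℝ) : ∀ x ∈ s, deriv (c • f) x = c * deriv f x := fun _ _ => by
  simp [deriv_const_smul_field]

theorem deriv2_add_on (hs : IsOpen s) (hf : ContDiffOn ℝ 2 f s) (hg : ContDiffOn ℝ 2 g s) :
    ∀ x ∈ s, deriv (deriv (f + g)) x = deriv (deriv f) x + deriv (deriv g) x := fun x hx => by
  have h1 : deriv (f + g) =ᶠ[nhds x] deriv f + deriv g := by
    filter_upwards [hs.mem_nhds hx] with y hy
    exact deriv_add_on hs (hf.differentiableOn (by norm_num)) (hg.differentiableOn (by norm_num)) y hy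
  have hd : ∀ {k : ℝ → ℝ}, ContDiffOn ℝ 2 k s → DifferentiableOn ℝ (deriv k) s := fun hk =>
    (((contDiffOn_succ_iff_deriv_of_isOpen (n := 1) hs).1
      (by simpa [one_add_one_eq_two] using hk)).2.2).differentiableOn (by norm_num)
  rw [h1.deriv_eq]
  exact deriv_add_on hs (hd hf) (hd hg) x hx

theorem deriv2_smul_on (c : ℝ) :
    ∀ x ∈ s, deriv (deriv (c • f)) x = c * deriv (deriv f) x := fun x _ => by
  have : deriv (c • f) = c • deriv f := by ext y; simp [deriv_const_smul_field]
  rw [this]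
  simp [deriv_const_smul_field]

end WeightedSup

/-! ### The spaces `M₁(ε)`, `M₂(ε)`, `X(ε)` and `X₁(ε)`

All functions in `M₁` and `M₂` vanish at `x = 1` (and those in `M₁` also at `x = -1`), so they are
represented by functions on `ℝ` that vanish off `(-1, 1)`. Only their values on `[-1, 1]`,
respectively `(-1, 1]`, matter; regularity is required there, one-sided at the end points. -/

/-- The vector space underlying `M₁(ε)`. -/
noncomputable def M1Sub (ε : ℝ) : Submodule ℝ (ℝ → ℝ) where
  carrier := {f | (∀ x ∉ Ioo (-1 : ℝ) 1, f x = 0) ∧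
    ContinuousOn f (Icc (-1) 1) ∧ ContDiffOn ℝ 1 f (Ioc (-1) 1) ∧ ContDiffOn ℝ 2 f (Ioo 0 1) ∧
    WBdd (Ioo (-1) 1) (fun x => (1 + x) ^ (-1 + 2 * ε)) f ∧
    WBdd (Ioo (-1) 1) (fun x => (1 + x) ^ (2 * ε)) (deriv f) ∧
    WBdd (Ioo 0 1) (fun _ => 1) (deriv (deriv f))}
  zero_mem' := ⟨fun _ _ => rfl, continuousOn_const, contDiffOn_const, contDiffOn_const,
    wbdd_zero fun _ _ => rfl, wbdd_zero fun _ _ => by simp, wbdd_zero fun _ _ => by simp⟩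
  add_mem' := by
    rintro f g ⟨f0, f1, f2, f3, f4, f5, f6⟩ ⟨g0, g1, g2, g3, g4, g5, g6⟩
    refine ⟨fun x hx => by simp [f0 x hx, g0 x hx], f1.add g1, f2.add g2, f3.add g3,
      f4.add g4 fun _ _ => rfl, f5.add g5 (deriv_add_on isOpen_Ioo ?_ ?_),
      f6.add g6 (deriv2_add_on isOpen_Ioo f3 g3)⟩
    · exact (f2.differentiableOn (by norm_num)).mono Ioo_subset_Ioc_self
    · exact (g2.differentiableOn (by norm_num)).mono Ioo_subset_Ioc_self
  smul_mem' := by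
    rintro c f ⟨f0, f1, f2, f3, f4, f5, f6⟩
    exact ⟨fun x hx => by simp [f0 x hx], f1.const_smul c, f2.const_smul c, f3.const_smul c,
      f4.smul c fun _ _ => rfl, f5.smul c (deriv_smul_on c), f6.smul c (deriv2_smul_on c)⟩

/-- The vector space underlying `M₂(ε)`. -/
noncomputable def M2Sub (ε : ℝ) : Submodule ℝ (ℝ → ℝ) where
  carrier := {f | (∀ x ∉ Ioo (-1 : ℝ) 1, f x = 0) ∧
    ContDiffOn ℝ 1 f (Ioc (-1) 1) ∧ ContDiffOn ℝ 2 f (Ioo (-1) 1) ∧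
    WBdd (Ioo (-1) 1) (fun x => (1 + x) ^ ε) f ∧
    WBdd (Ioo (-1) 1) (fun x => (1 + x) ^ (1 + ε)) (deriv f) ∧
    WBdd (Ioo (-1) 1) (fun x => (1 + x) ^ (2 + ε)) (deriv (deriv f))}
  zero_mem' := ⟨fun _ _ => rfl, contDiffOn_const, contDiffOn_const,
    wbdd_zero fun _ _ => rfl, wbdd_zero fun _ _ => by simp, wbdd_zero fun _ _ => by simp⟩
  add_mem' := by
    rintro f g ⟨f0, f2, f3, f4, f5, f6⟩ ⟨g0, g2, g3, g4, g5, g6⟩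
    refine ⟨fun x hx => by simp [f0 x hx, g0 x hx], f2.add g2, f3.add g3,
      f4.add g4 fun _ _ => rfl, f5.add g5 (deriv_add_on isOpen_Ioo ?_ ?_),
      f6.add g6 (deriv2_add_on isOpen_Ioo f3 g3)⟩
    · exact f3.differentiableOn (by norm_num)
    · exact g3.differentiableOn (by norm_num)
  smul_mem' := by
    rintro c f ⟨f0, f2, f3, f4, f5, f6⟩
    exact ⟨fun x hx => by simp [f0 x hx], f2.const_smul c, f3.const_smul c,
      f4.smul c fun _ _ => rfl, f5.smul c (deriv_smul_on c), f6.smul c (deriv2_smul_on c)⟩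

/-- The space `M₁(ε)`. It is a type of its own, so that its topology is the one of the norm below
and not that of pointwise convergence. -/
def M1 (ε : ℝ) : Type := ↥(M1Sub ε)

/-- The space `M₂(ε)`. -/
def M2 (ε : ℝ) : Type := ↥(M2Sub ε)

section Instances

variable {ε : ℝ}

noncomputable instance : AddCommGroup (M1 ε) := inferInstanceAs (AddCommGroup (M1Sub ε))

noncomputable instance : Module ℝ (M1 ε) := inferInstanceAs (Module ℝ (M1Sub ε))

noncomputable instance : AddCommGroup (M2 ε) := inferInstanceAs (AddCommGroup (M2Sub ε))

noncomputable instance : Module ℝ (M2 ε) := inferInstanceAs (Module ℝ (M2Sub ε))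

instance : CoeFun (M1 ε) (fun _ => ℝ → ℝ) := ⟨fun f => f.1⟩

instance : CoeFun (M2 ε) (fun _ => ℝ → ℝ) := ⟨fun f => f.1⟩

/-- `‖f‖_{M₁} = ‖(1+x)^{-1+2ε} f‖_{L^∞(-1,1)} + ‖(1+x)^{2ε} f'‖_{L^∞(-1,1)} + ‖f''‖_{L^∞(0,1)}`. -/
noncomputable def normM1 (ε : ℝ) (f : ℝ → ℝ) : ℝ :=
  wSup (Ioo (-1) 1) (fun x => (1 + x) ^ (-1 + 2 * ε)) f +
  wSup (Ioo (-1) 1) (fun x => (1 + x) ^ (2 * ε)) (deriv f) +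
  wSup (Ioo 0 1) (fun _ => 1) (deriv (deriv f))

/-- `‖f‖_{M₂} = ‖(1+x)^ε f‖ + ‖(1+x)^{1+ε} f'‖ + ‖(1+x)^{2+ε} f''‖`, all in `L^∞(-1,1)`. -/
noncomputable def normM2 (ε : ℝ) (f : ℝ → ℝ) : ℝ :=
  wSup (Ioo (-1) 1) (fun x => (1 + x) ^ ε) f +
  wSup (Ioo (-1) 1) (fun x => (1 + x) ^ (1 + ε)) (deriv f) +
  wSup (Ioo (-1) 1) (fun x => (1 + x) ^ (2 + ε)) (deriv (deriv f))

theorem weight_pos (a : ℝ) : ∀ x ∈ Ioo (-1 : ℝ) 1, 0 < (1 + x) ^ a := fun x hx =>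
  Real.rpow_pos_of_pos (by linarith [hx.1]) a

theorem normM1_smul_le (c : ℝ) (f : M1 ε) : normM1 ε (c • f.1) ≤ |c| * normM1 ε f.1 := by
  obtain ⟨f, f0, f1, f2, f3, f4, f5, f6⟩ := f
  have h4 := wSup_smul c f4 (h := c • f) fun _ _ => rfl
  have h5 := wSup_smul c f5 (h := deriv (c • f)) (deriv_smul_on c)
  have h6 := wSup_smul c f6 (h := deriv (deriv (c • f))) (deriv2_smul_on c)
  simp only [normM1]
  linarith

theorem normM2_smul_le (c : ℝ) (f : M2 ε) : normM2 ε (c • f.1) ≤ |c| * normM2 ε f.1 := by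
  obtain ⟨f, f0, f2, f3, f4, f5, f6⟩ := f
  have h4 := wSup_smul c f4 (h := c • f) fun _ _ => rfl
  have h5 := wSup_smul c f5 (h := deriv (c • f)) (deriv_smul_on c)
  have h6 := wSup_smul c f6 (h := deriv (deriv (c • f))) (deriv2_smul_on c)
  simp only [normM2]
  linarith

noncomputable instance : NormedAddCommGroup (M1 ε) := AddGroupNorm.toNormedAddCommGroup
  { toFun := fun f => normM1 ε f.1
    map_zero' := by
      change normM1 ε (0 : ℝ → ℝ) = 0
      have d : deriv (0 : ℝ → ℝ) = 0 := by ext; simp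
      have z : ∀ (s : Set ℝ) (w : ℝ → ℝ), wSup s w 0 = 0 := fun _ _ => wSup_zero fun _ _ => rfl
      simp only [normM1, d, z, add_zero]
    add_le' := by
      rintro ⟨f, f0, f1, f2, f3, f4, f5, f6⟩ ⟨g, g0, g1, g2, g3, g4, g5, g6⟩
      change normM1 ε (f + g) ≤ normM1 ε f + normM1 ε g
      have h4 := wSup_add f4 g4 (h := f + g) fun _ _ => rfl
      have h5 := wSup_add f5 g5 (h := deriv (f + g)) (deriv_add_on isOpen_Ioo
        ((f2.differentiableOn (by norm_num)).mono Ioo_subset_Ioc_self)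
        ((g2.differentiableOn (by norm_num)).mono Ioo_subset_Ioc_self))
      have h6 := wSup_add f6 g6 (h := deriv (deriv (f + g))) (deriv2_add_on isOpen_Ioo f3 g3)
      simp only [normM1]
      linarith
    neg' := fun f => by
      have h1 := normM1_smul_le (-1) f
      have h2 := normM1_smul_le (-1) (-f)
      have e1 : (-1 : ℝ) • f.1 = (-f).1 := by rw [neg_one_smul]; rfl
      have e2 : (-1 : ℝ) • (-f).1 = f.1 := by rw [← e1, smul_smul]; simp
      rw [e1] at h1
      rw [e2] at h2
      simp only [abs_neg, abs_one, one_mul] at h1 h2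
      exact le_antisymm h1 h2
    eq_zero_of_map_eq_zero' := by
      rintro ⟨f, f0, f1, f2, f3, f4, f5, f6⟩ h
      have h' : normM1 ε f = 0 := h
      have h1 : wSup (Ioo (-1) 1) (fun x => (1 + x) ^ (-1 + 2 * ε)) f ≤ 0 := by
        have h5 : 0 ≤ wSup (Ioo (-1) 1) (fun x => (1 + x) ^ (2 * ε)) (deriv f) := wSup_nonneg
        have h6 : 0 ≤ wSup (Ioo 0 1) (fun _ => 1) (deriv (deriv f)) := wSup_nonneg
        simp only [normM1] at h'
        linarith
      apply Subtype.ext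
      funext x
      by_cases hx : x ∈ Ioo (-1 : ℝ) 1
      · exact eq_zero_of_wSup f4 (weight_pos _) h1 x hx
      · exact f0 x hx }

noncomputable instance : NormedAddCommGroup (M2 ε) := AddGroupNorm.toNormedAddCommGroup
  { toFun := fun f => normM2 ε f.1
    map_zero' := by
      change normM2 ε (0 : ℝ → ℝ) = 0
      have d : deriv (0 : ℝ → ℝ) = 0 := by ext; simp
      have z : ∀ (s : Set ℝ) (w : ℝ → ℝ), wSup s w 0 = 0 := fun _ _ => wSup_zero fun _ _ => rfl
      simp only [normM2, d, z, add_zero]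
    add_le' := by
      rintro ⟨f, f0, f2, f3, f4, f5, f6⟩ ⟨g, g0, g2, g3, g4, g5, g6⟩
      change normM2 ε (f + g) ≤ normM2 ε f + normM2 ε g
      have h4 := wSup_add f4 g4 (h := f + g) fun _ _ => rfl
      have h5 := wSup_add f5 g5 (h := deriv (f + g)) (deriv_add_on isOpen_Ioo
        (f3.differentiableOn (by norm_num)) (g3.differentiableOn (by norm_num)))
      have h6 := wSup_add f6 g6 (h := deriv (deriv (f + g))) (deriv2_add_on isOpen_Ioo f3 g3)
      simp only [normM2]
      linarith
    neg' := fun f => by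
      have h1 := normM2_smul_le (-1) f
      have h2 := normM2_smul_le (-1) (-f)
      have e1 : (-1 : ℝ) • f.1 = (-f).1 := by rw [neg_one_smul]; rfl
      have e2 : (-1 : ℝ) • (-f).1 = f.1 := by rw [← e1, smul_smul]; simp
      rw [e1] at h1
      rw [e2] at h2
      simp only [abs_neg, abs_one, one_mul] at h1 h2
      exact le_antisymm h1 h2
    eq_zero_of_map_eq_zero' := by
      rintro ⟨f, f0, f2, f3, f4, f5, f6⟩ h
      have h' : normM2 ε f = 0 := h
      have h1 : wSup (Ioo (-1) 1) (fun x => (1 + x) ^ ε) f ≤ 0 := by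
        have h5 : 0 ≤ wSup (Ioo (-1) 1) (fun x => (1 + x) ^ (1 + ε)) (deriv f) := wSup_nonneg
        have h6 : 0 ≤ wSup (Ioo (-1) 1) (fun x => (1 + x) ^ (2 + ε)) (deriv (deriv f)) :=
          wSup_nonneg
        simp only [normM2] at h'
        linarith
      apply Subtype.ext
      funext x
      by_cases hx : x ∈ Ioo (-1 : ℝ) 1
      · exact eq_zero_of_wSup f4 (weight_pos _) h1 x hx
      · exact f0 x hx }

noncomputable instance : NormedSpace ℝ (M1 ε) where
  norm_smul_le c f := normM1_smul_le c f

noncomputable instance : NormedSpace ℝ (M2 ε) where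
  norm_smul_le c f := normM2_smul_le c f

end Instances

/-- `X(ε) = M₁(ε) × M₂(ε)` with the norm `‖U‖_X = ‖U_θ‖_{M₁} + ‖U_φ‖_{M₂}`; the components
`U_θ` and `U_φ` are `U.fst` and `U.snd`. -/
abbrev X (ε : ℝ) : Type := WithLp 1 (M1 ε × M2 ε)

theorem norm_X (ε : ℝ) (U : X ε) : ‖U‖ = normM1 ε U.fst + normM2 ε U.snd := by
  have h : ‖U‖ = ‖U.fst‖ + ‖U.snd‖ := by simpa using WithLp.prod_norm_eq_of_nat 1 (by norm_num) U
  exact h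

/-- The linear functional `l₂(V) = V_φ(0)`. -/
noncomputable def l2 (ε : ℝ) : X ε →ₗ[ℝ] ℝ where
  toFun V := V.snd 0
  map_add' _ _ := rfl
  map_smul' _ _ := rfl

/-- `X₁(ε) = ker l₂`. -/
noncomputable abbrev X1 (ε : ℝ) : Submodule ℝ (X ε) := LinearMap.ker (l2 ε)

/-! ### The equations -/

/-- The integrand `2 U_φ U_φ' / (1 - s²)`. -/
noncomputable def swirlDensity (Uφ : ℝ → ℝ) (s : ℝ) : ℝ := 2 * Uφ s * deriv Uφ s / (1 - s ^ 2)

/-- `∫_l^1 ∫_t^1 2 U_φ U_φ' / (1 - s²) ds dt`. -/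
noncomputable def psiInner (Uφ : ℝ → ℝ) (l : ℝ) : ℝ :=
  ∫ t in l..1, ∫ s in t..1, swirlDensity Uφ s

/-- `ψ[U_φ](x) = ∫_x^1 ∫_l^1 ∫_t^1 2 U_φ U_φ' / (1 - s²) ds dt dl`. -/
noncomputable def psi (Uφ : ℝ → ℝ) (x : ℝ) : ℝ := ∫ l in x..1, psiInner Uφ l

/-- `U = (U_θ, U_φ)` solves on `(-1, 1)`, with the constant `κ`, the system
`(1-x²) U_θ' + 2x U_θ + U_θ²/2 - ψ[U_φ] = κ (1-x)²`, `(1-x²) U_φ'' + U_θ U_φ' = 0`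
satisfied by axisymmetric `(-1)`-homogeneous Navier-Stokes solutions that are smooth on the
sphere minus the south pole. -/
structure IsSolution (Uθ Uφ : ℝ → ℝ) (κ : ℝ) : Prop where
  contDiffOn_theta : ContDiffOn ℝ 1 Uθ (Ioo (-1) 1)
  contDiffOn_phi : ContDiffOn ℝ 2 Uφ (Ioo (-1) 1)
  integrable : ∀ t ∈ Ioo (-1 : ℝ) 1, IntervalIntegrable (swirlDensity Uφ) volume t 1
  eq_theta : ∀ x ∈ Ioo (-1 : ℝ) 1,
    (1 - x ^ 2) * deriv Uθ x + 2 * x * Uθ x + 1 / 2 * Uθ x ^ 2 - psi Uφ x = κ * (1 - x) ^ 2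
  eq_phi : ∀ x ∈ Ioo (-1 : ℝ) 1,
    (1 - x ^ 2) * deriv (deriv Uφ) x + Uθ x * deriv Uφ x = 0

/-- The `θ`-component of the no-swirl solution `U^{μ,γ}`, `γ = -1 - √(1+2μ)`;
its `φ`-component is zero. -/
noncomputable def Ubar (μ x : ℝ) : ℝ := (1 + √(1 + 2 * μ)) * (1 - x)

/-- `b_μ(x) = ∫_0^x Ū_θ / (1 - s²) ds`. -/
noncomputable def bFun (μ x : ℝ) : ℝ := ∫ s in (0 : ℝ)..x, Ubar μ s / (1 - s ^ 2)

/-- The `φ`-component `∫_x^1 e^{-b_μ(t)} dt` of the kernel element `V²_{μ,γ}`,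
`γ = -1 - √(1+2μ)`; its `θ`-component is zero. -/
noncomputable def V2phi (μ x : ℝ) : ℝ := ∫ t in x..1, Real.exp (-bFun μ t)

/-- The `θ`-component of `U^{μ,γ} + β V²_{μ,γ} + V`. -/
noncomputable def familyTheta {ε : ℝ} (μ : ℝ) (V : X ε) (x : ℝ) : ℝ := Ubar μ x + V.fst x

/-- The `φ`-component of `U^{μ,γ} + β V²_{μ,γ} + V`. -/
noncomputable def familyPhi {ε : ℝ} (μ β : ℝ) (V : X ε) (x : ℝ) : ℝ := β * V2phi μ x + V.snd x

end ConicalNS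

open ConicalNS

/-! Put `a = √(1+2μ)`, `U_θ = Ū_θ + w`, `y = w/(1-x)`, `z = y'` and `h = U_φ'`. Divided by `(1-x)²`,
the first equation reads `(1+x) z + a y + y²/2 - ψ/(1-x)² = κ - μ`. Differentiation removes the
unknown constant `κ`, and division of the second equation by `1-x` gives the companion. The result
is the reduced system `(1+x) z' + (1+a+y) z = (ψ/(1-x)²)'`, `(1+x) h' + (1+a+y) h = 0`. Conversely,
an integral of the reduced system is constant, and letting `x → -1`, where `y` and `(1+x) z` vanish,
identifies the constant as `κ - μ = -ψ(-1)/4` (`reduced_of_isSolution`, `isSolution_of_reduced`).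

The only linear operator involved is `(1+x) d/dx + (1+a)`, whose kernel is spanned by
`(1+x)^{-1-a}`. For `z` the weight excludes the kernel and the inverse integrates from `-1`. For `h`
the weight admits it, since `a < ε`; this is the direction `V²`, and the condition `u(0) = 0` picks
one solution. With all weights factored out, both inverses are bounded operators on bounded
continuous functions on `(-1,1)`, and the right-hand sides `ζ`, `g` of the two linear equations
serve as unknowns.

Near a fixed `a`, a different parameter `a'` contributes only the terms `(a'-a) z` and `(a'-a) h`. A
third unknown `k` describes the kernel function for `a'` through the operators for `a`. The system
becomes a polynomial equation `chartMap = 0` in a Banach space whose derivative in the unknowns at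
`0` is the identity, so the implicit function theorem gives an analytic solution, unique near `0`
(`exists_implicit`, `ParamAt.exists_local`). The terms carrying the swirl are quadratic, whence
`∂V/∂β = 0`.

Uniqueness glues the local solutions along the compact set `K` (`exists_glued`,
`exists_solution_map`). Finally, any small perturbation splits as `β V² + v` with `v_φ(0) = 0`, with
bounds uniform in `μ` (`exists_decomposition`), and uniqueness identifies `v` with `V(μ,β)`. At `μ =
-1/2` the square root is not smooth; there the parameter is frozen by a constant parametrization. -/

namespace ConicalNS

open Filter Topology

/-! ### Primitives on `(-1, 1)` -/

/-- The open interval `(-1, 1)`. -/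
abbrev Dom : Set ℝ := Ioo (-1) 1

theorem Dom.pos {x : ℝ} (hx : x ∈ Dom) : 0 < 1 + x := by linarith [hx.1]

theorem Dom.pos' {x : ℝ} (hx : x ∈ Dom) : 0 < 1 - x := by linarith [hx.2]

theorem Dom.nhds {x : ℝ} (hx : x ∈ Dom) : Dom ∈ 𝓝 x := isOpen_Ioo.mem_nhds hx

theorem zero_mem_Dom : (0 : ℝ) ∈ Dom := ⟨by norm_num, by norm_num⟩

/-- Functions continuous on `(-1, 1)` and integrable near `1`. -/
structure RegAtOne (φ : ℝ → ℝ) : Prop where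
  cont : ContinuousOn φ Dom
  int : ∀ t ∈ Dom, IntervalIntegrable φ volume t 1

/-- The primitive `x ↦ ∫_x^1 φ`. -/
noncomputable def tailInt (φ : ℝ → ℝ) (x : ℝ) : ℝ := ∫ s in x..1, φ s

@[simp] theorem tailInt_one (φ : ℝ → ℝ) : tailInt φ 1 = 0 := intervalIntegral.integral_same

theorem tailInt_congr {φ χ : ℝ → ℝ} (h : EqOn φ χ Dom) {x : ℝ} (hx : x ∈ Icc (-1 : ℝ) 1) :
    tailInt φ x = tailInt χ x := by
  refine intervalIntegral.integral_congr_ae ?_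
  have h1 : ∀ᵐ s : ℝ, s ≠ 1 := by simp [ae_iff]
  filter_upwards [h1] with s hs hsx
  rw [uIoc_of_le hx.2] at hsx
  exact h ⟨lt_of_le_of_lt hx.1 hsx.1, lt_of_le_of_ne hsx.2 hs⟩

theorem aestronglyMeasurable_dom {φ : ℝ → ℝ} (h : ContinuousOn φ Dom) {a b : ℝ} (ha : -1 ≤ a)
    (hb : b ≤ 1) : AEStronglyMeasurable φ (volume.restrict (Ioc a b)) := by
  have h1 : AEStronglyMeasurable φ (volume.restrict Dom) := h.aestronglyMeasurable measurableSet_Ioo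
  have h2 : volume.restrict Dom = volume.restrict (Ioc (-1 : ℝ) 1) :=
    Measure.restrict_congr_set Ioo_ae_eq_Ioc
  rw [h2] at h1
  exact h1.mono_measure (Measure.restrict_mono (Ioc_subset_Ioc ha hb) le_rfl)

theorem ae_restrict_dom {p : ℝ → Prop} (h : ∀ x ∈ Dom, p x) {a b : ℝ} (ha : -1 ≤ a)
    (hb : b ≤ 1) : ∀ᵐ x ∂(volume.restrict (Ioc a b)), p x := by
  rw [ae_restrict_iff' measurableSet_Ioc]
  have h1 : ∀ᵐ s : ℝ, s ≠ 1 := by simp [ae_iff]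
  filter_upwards [h1] with s hs hsx
  exact h s ⟨lt_of_le_of_lt ha hsx.1, lt_of_le_of_ne (hsx.2.trans hb) hs⟩

theorem intervalIntegrable_of_le {φ χ : ℝ → ℝ} (h : ContinuousOn φ Dom) {a b : ℝ} (ha : -1 ≤ a)
    (hab : a ≤ b) (hb : b ≤ 1) (hχ : IntervalIntegrable χ volume a b)
    (hle : ∀ x ∈ Dom, |φ x| ≤ χ x) : IntervalIntegrable φ volume a b := by
  rw [intervalIntegrable_iff_integrableOn_Ioc_of_le hab] at hχ ⊢
  exact Integrable.mono' hχ (aestronglyMeasurable_dom h ha hb) (ae_restrict_dom hle ha hb)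

theorem abs_integral_le {φ χ : ℝ → ℝ} {a b : ℝ} (ha : -1 ≤ a)
    (hab : a ≤ b) (hb : b ≤ 1) (hχ : IntervalIntegrable χ volume a b)
    (hle : ∀ x ∈ Dom, x ∈ Ioc a b → |φ x| ≤ χ x) : |∫ s in a..b, φ s| ≤ ∫ s in a..b, χ s := by
  rw [← Real.norm_eq_abs]
  refine intervalIntegral.norm_integral_le_of_norm_le hab ?_ hχ
  have h1 : ∀ᵐ s : ℝ, s ≠ 1 := by simp [ae_iff]
  filter_upwards [h1] with s hs hsx
  exact hle s ⟨lt_of_le_of_lt ha hsx.1, lt_of_le_of_ne (hsx.2.trans hb) hs⟩ hsx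

theorem RegAtOne.of_continuousOn_Ioc {φ : ℝ → ℝ} (h : ContinuousOn φ (Ioc (-1) 1)) :
    RegAtOne φ where
  cont := h.mono Ioo_subset_Ioc_self
  int t ht := by
    apply ContinuousOn.intervalIntegrable
    rw [uIcc_of_le ht.2.le]
    exact h.mono fun s hs => ⟨lt_of_lt_of_le ht.1 hs.1, hs.2⟩

theorem RegAtOne.congr {φ χ : ℝ → ℝ} (h : RegAtOne φ) (he : EqOn χ φ Dom) : RegAtOne χ where
  cont := h.cont.congr he
  int t ht := by
    refine intervalIntegrable_of_le (χ := fun s => |φ s|) (h.cont.congr he) ht.1.le ht.2.le le_rfl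
      (h.int t ht).abs fun x hx => by rw [he hx]

theorem RegAtOne.const_mul {φ : ℝ → ℝ} (h : RegAtOne φ) (c : ℝ) :
    RegAtOne (fun x => c * φ x) :=
  ⟨continuousOn_const.mul h.cont, fun t ht => (h.int t ht).const_mul c⟩

theorem RegAtOne.mul_of_bdd {φ k : ℝ → ℝ} (h : RegAtOne φ) (hk : ContinuousOn k Dom) (C : ℝ)
    (hC : ∀ x ∈ Dom, |k x| ≤ C) : RegAtOne (fun x => k x * φ x) where
  cont := hk.mul h.cont
  int t ht := by
    refine intervalIntegrable_of_le (χ := fun s => C * |φ s|) (hk.mul h.cont) ht.1.le ht.2.le le_rfl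
      ((h.int t ht).abs.const_mul C) fun x hx => ?_
    refine (abs_mul (k x) (φ x)).le.trans ?_
    exact mul_le_mul_of_nonneg_right (hC x hx) (abs_nonneg _)

theorem tailInt_add {φ χ : ℝ → ℝ} (h : RegAtOne φ) (h' : RegAtOne χ) {x : ℝ} (hx : x ∈ Dom) :
    tailInt (fun s => φ s + χ s) x = tailInt φ x + tailInt χ x :=
  intervalIntegral.integral_add (h.int x hx) (h'.int x hx)

theorem tailInt_const_mul (c : ℝ) (φ : ℝ → ℝ) (x : ℝ) :
    tailInt (fun s => c * φ s) x = c * tailInt φ x :=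
  intervalIntegral.integral_const_mul c φ

theorem stronglyMeasurableAtFilter_dom {φ : ℝ → ℝ} (h : ContinuousOn φ Dom) {x : ℝ}
    (hx : x ∈ Dom) : StronglyMeasurableAtFilter φ (𝓝 x) volume :=
  ⟨Dom, Dom.nhds hx, h.aestronglyMeasurable measurableSet_Ioo⟩

theorem RegAtOne.hasDerivAt {φ : ℝ → ℝ} (h : RegAtOne φ) {x : ℝ} (hx : x ∈ Dom) :
    HasDerivAt (tailInt φ) (-φ x) x :=
  intervalIntegral.integral_hasDerivAt_left (h.int x hx) (stronglyMeasurableAtFilter_dom h.cont hx)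
    (h.cont.continuousAt (Dom.nhds hx))

theorem RegAtOne.continuousOn_tailInt {φ : ℝ → ℝ} (h : RegAtOne φ) :
    ContinuousOn (tailInt φ) (Ioc (-1) 1) := by
  intro x hx
  have hm : (-1 + x) / 2 ∈ Dom := ⟨by linarith [hx.1], by linarith [hx.2]⟩
  have hi : IntegrableOn φ (uIcc ((-1 + x) / 2) 1) volume := by
    rw [uIcc_of_le hm.2.le, integrableOn_Icc_iff_integrableOn_Ioc]
    exact (intervalIntegrable_iff_integrableOn_Ioc_of_le hm.2.le).1 (h.int _ hm)
  have h1 := intervalIntegral.continuousOn_primitive_interval_left hi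
  rw [uIcc_of_le hm.2.le] at h1
  refine (h1 x ⟨by linarith [hx.1], hx.2⟩).mono_of_mem_nhdsWithin ?_
  have : Ioi ((-1 + x) / 2) ∈ 𝓝 x := Ioi_mem_nhds (by linarith [hx.1])
  filter_upwards [mem_nhdsWithin_of_mem_nhds this, self_mem_nhdsWithin] with y hy hy'
  exact ⟨le_of_lt hy, hy'.2⟩

theorem RegAtOne.tail {φ : ℝ → ℝ} (h : RegAtOne φ) : RegAtOne (tailInt φ) :=
  .of_continuousOn_Ioc h.continuousOn_tailInt

/-- Two functions that are continuous on `(-1, 1]`, agree at `1` and have the same derivative on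
`(-1, 1)` are equal. -/
theorem eqOn_of_hasDerivAt {f g d : ℝ → ℝ} (hf : ContinuousOn f (Ioc (-1) 1))
    (hg : ContinuousOn g (Ioc (-1) 1)) (hfd : ∀ x ∈ Dom, HasDerivAt f (d x) x)
    (hgd : ∀ x ∈ Dom, HasDerivAt g (d x) x) (h1 : f 1 = g 1) : EqOn f g (Ioc (-1) 1) := by
  intro x hx
  have hsub : Icc x 1 ⊆ Ioc (-1) 1 := fun s hs => ⟨lt_of_lt_of_le hx.1 hs.1, hs.2⟩
  have h2 := constant_of_has_deriv_right_zero (f := f - g) (a := x) (b := 1)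
    ((hf.sub hg).mono hsub) (fun s hs => by
      have hs' : s ∈ Dom := ⟨lt_of_lt_of_le hx.1 hs.1, hs.2⟩
      simpa using ((hfd s hs').sub (hgd s hs')).hasDerivWithinAt) 1 ⟨hx.2, le_rfl⟩
  simp only [Pi.sub_apply, h1, sub_self] at h2
  linarith

theorem eqOn_tailInt {f d : ℝ → ℝ} (hf : ContinuousOn f (Ioc (-1) 1))
    (hfd : ∀ x ∈ Dom, HasDerivAt f (-d x) x) (hd : RegAtOne d) (h1 : f 1 = 0) :
    EqOn f (tailInt d) (Ioc (-1) 1) :=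
  eqOn_of_hasDerivAt hf hd.continuousOn_tailInt hfd (fun _ hx => hd.hasDerivAt hx) (by simp [h1])

/-- At the end point `1` the one-sided derivative exists because it is the limit of the derivatives
from the left, and this limit is `h 1`. -/
theorem contDiffOn_one_Ioc {u h : ℝ → ℝ} (hu : ContinuousOn u (Ioc (-1) 1))
    (hd : ∀ x ∈ Dom, HasDerivAt u (h x) x) (hh : ContinuousOn h (Ioc (-1) 1)) :
    ContDiffOn ℝ 1 u (Ioc (-1) 1) := by
  have key : ∀ x ∈ Ioc (-1 : ℝ) 1, HasDerivWithinAt u (h x) (Ioc (-1) 1) x := by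
    intro x hx
    rcases hx.2.lt_or_eq with h1 | rfl
    · exact (hd x ⟨hx.1, h1⟩).hasDerivWithinAt
    · have hl : Tendsto (fun x => deriv u x) (𝓝[<] (1 : ℝ)) (𝓝 (h 1)) := by
        have h2 : Tendsto h (𝓝[<] (1 : ℝ)) (𝓝 (h 1)) :=
          ((hh 1 hx).mono_of_mem_nhdsWithin (Ioc_mem_nhdsLT hx.1 |> fun h => mem_of_superset h
            fun y hy => hy))
        refine h2.congr' ?_
        filter_upwards [Ioo_mem_nhdsLT hx.1] with y hy
        exact (hd y hy).deriv.symm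
      refine (hasDerivWithinAt_Iic_of_tendsto_deriv (s := Dom)
        (fun y hy => (hd y hy).differentiableAt.differentiableWithinAt)
        ((hu 1 hx).mono Ioo_subset_Ioc_self) (Ioo_mem_nhdsLT hx.1) hl).mono ?_
      exact fun y hy => hy.2
  have hun : UniqueDiffOn ℝ (Ioc (-1 : ℝ) 1) := uniqueDiffOn_Ioc _ _
  refine ((contDiffOn_succ_iff_derivWithin (n := 0) hun).2 ⟨fun x hx =>
    (key x hx).differentiableWithinAt, by simp, ?_⟩).of_le (by simp)
  rw [contDiffOn_zero]
  exact hh.congr fun x hx => (key x hx).derivWithin (hun x hx)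

theorem contDiffOn_two_of_hasDerivAt {s : Set ℝ} (hs : IsOpen s) {u h k : ℝ → ℝ}
    (hu : ∀ x ∈ s, HasDerivAt u (h x) x) (hh : ∀ x ∈ s, HasDerivAt h (k x) x)
    (hk : ContinuousOn k s) : ContDiffOn ℝ 2 u s := by
  have e1 : EqOn (deriv u) h s := fun x hx => (hu x hx).deriv
  have e2 : EqOn (deriv h) k s := fun x hx => (hh x hx).deriv
  have c1 : ContDiffOn ℝ 1 h s := by
    have := (contDiffOn_succ_iff_deriv_of_isOpen (n := 0) (f := h) hs).2
      ⟨fun x hx => (hh x hx).differentiableAt.differentiableWithinAt, by simp,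
        contDiffOn_zero.2 (hk.congr e2)⟩
    simpa using this
  have := (contDiffOn_succ_iff_deriv_of_isOpen (n := 1) (f := u) hs).2
      ⟨fun x hx => (hu x hx).differentiableAt.differentiableWithinAt, by simp, c1.congr e1⟩
  simpa [one_add_one_eq_two] using this

/-! ### Power weights -/

theorem continuousOn_rpow_weight (p : ℝ) : ContinuousOn (fun s : ℝ => (1 + s) ^ p) (Ioc (-1) 1) :=
  (continuousOn_const.add continuousOn_id).rpow_const fun x hx => Or.inl (by
    have h : 0 < 1 + x := by linarith [hx.1]
    exact h.ne')

theorem hasDerivAt_rpow_weight (p : ℝ) {x : ℝ} (hx : x ∈ Dom) :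
    HasDerivAt (fun s : ℝ => (1 + s) ^ p) (p * (1 + x) ^ (p - 1)) x := by
  have := ((hasDerivAt_id x).const_add 1).rpow_const (p := p) (Or.inl (Dom.pos hx).ne')
  simpa using this

theorem intervalIntegrable_rpow_weight {p : ℝ} (hp : -1 < p) (a b : ℝ) :
    IntervalIntegrable (fun s : ℝ => (1 + s) ^ p) volume a b := by
  have := (intervalIntegral.intervalIntegrable_rpow' hp (a := 1 + a) (b := 1 + b)).comp_add_left 1
  simpa using this

theorem integral_rpow_weight {p : ℝ} (hp : -1 < p) (x : ℝ) :
    ∫ s in (-1 : ℝ)..x, (1 + s) ^ p = (1 + x) ^ (p + 1) / (p + 1) := by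
  rw [intervalIntegral.integral_comp_add_left (fun s : ℝ => s ^ p) 1, integral_rpow (Or.inl hp)]
  have : p + 1 ≠ 0 := by linarith
  simp [Real.zero_rpow this]

theorem integral_rpow_weight_tail {q : ℝ} (hq : 0 < q) {x : ℝ} (hx : x ∈ Dom) :
    ∫ s in x..1, (1 + s) ^ (-1 - q) = ((1 + x) ^ (-q) - 2 ^ (-q)) / q := by
  rw [intervalIntegral.integral_comp_add_left (fun s : ℝ => s ^ (-1 - q)) 1,
    integral_rpow (Or.inr ⟨by linarith, ?_⟩)]
  · have : -1 - q + 1 = -q := by ring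
    rw [this, one_add_one_eq_two, div_neg, ← neg_div, neg_sub]
  · rw [uIcc_of_le (by linarith [hx.2])]
    rintro ⟨h, -⟩
    linarith [Dom.pos hx]

/-- For `x ≤ 0` the explicit integral suffices, as `1 - x ≥ 1`. For `x ≥ 0` the integrand is at most
`(1+x)^{-q}` and the factor `1 - x` is the length of the interval. -/
theorem integral_rpow_weight_tail_le {q : ℝ} (hq : 0 < q) {x : ℝ} (hx : x ∈ Dom) :
    ∫ s in x..1, (1 + s) ^ (-1 - q) ≤ (1 + 1 / q) * ((1 - x) * (1 + x) ^ (-q)) := by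
  have hw : 0 < (1 + x) ^ (-q) := Real.rpow_pos_of_pos (Dom.pos hx) _
  rcases le_total x 0 with h0 | h0
  · rw [integral_rpow_weight_tail hq hx]
    have h2 : (0 : ℝ) < 2 ^ (-q) := Real.rpow_pos_of_pos two_pos _
    calc ((1 + x) ^ (-q) - 2 ^ (-q)) / q ≤ (1 + x) ^ (-q) / q := by gcongr; linarith
      _ = 1 / q * (1 * (1 + x) ^ (-q)) := by ring
      _ ≤ (1 + 1 / q) * ((1 - x) * (1 + x) ^ (-q)) := by gcongr <;> linarith
  · have h1 : ∫ s in x..1, (1 + s) ^ (-1 - q) ≤ ∫ s in x..1, (1 + x) ^ (-q) := by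
      refine intervalIntegral.integral_mono_on hx.2.le ?_ (by simp) fun s hs => ?_
      · exact (RegAtOne.of_continuousOn_Ioc (continuousOn_rpow_weight _)).int x hx
      · have h3 : 1 + x ≤ 1 + s := by linarith [hs.1]
        have h4 : 0 < 1 + s := (Dom.pos hx).trans_le h3
        calc (1 + s) ^ (-1 - q) ≤ (1 + s) ^ (-q) :=
              Real.rpow_le_rpow_of_exponent_le (by linarith) (by linarith)
          _ ≤ (1 + x) ^ (-q) := Real.rpow_le_rpow_of_nonpos (Dom.pos hx) h3 (by linarith)
    rw [intervalIntegral.integral_const, smul_eq_mul] at h1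
    have : 0 ≤ 1 / q * ((1 - x) * (1 + x) ^ (-q)) := by
      have := Dom.pos' hx
      positivity
    linarith

theorem regAtOne_weight (n : ℕ) (p : ℝ) :
    RegAtOne (fun s : ℝ => (1 - s) ^ n * (1 + s) ^ p) :=
  .of_continuousOn_Ioc (((continuousOn_const.sub continuousOn_id).pow n).mul
    (continuousOn_rpow_weight p))

/-- The factor `(1-s)^n` is at most `(1-x)^n` on the range of integration. A tail integral thus
gains one order of vanishing at `1` and one power of `1+x` at `-1`. -/
theorem abs_tailInt_le {φ : ℝ → ℝ} {C q : ℝ} (n : ℕ) (hq : 0 < q) (hC : 0 ≤ C)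
    (hle : ∀ x ∈ Dom, |φ x| ≤ C * ((1 - x) ^ n * (1 + x) ^ (-1 - q))) {x : ℝ} (hx : x ∈ Dom) :
    |tailInt φ x| ≤ C * (1 + 1 / q) * ((1 - x) ^ (n + 1) * (1 + x) ^ (-q)) := by
  have h1 : |tailInt φ x| ≤ ∫ s in x..1, C * (1 - x) ^ n * (1 + s) ^ (-1 - q) := by
    refine abs_integral_le hx.1.le hx.2.le le_rfl
      (((RegAtOne.of_continuousOn_Ioc (continuousOn_rpow_weight _)).int x hx).const_mul _) ?_
    intro s hs hsx
    refine (hle s hs).trans ?_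
    rw [← mul_assoc]
    have h2 := Real.rpow_nonneg (Dom.pos hs).le (-1 - q)
    have h3 := (Dom.pos' hs).le
    gcongr
    exact hsx.1.le
  rw [intervalIntegral.integral_const_mul] at h1
  have h4 := integral_rpow_weight_tail_le hq hx
  have h5 := (Dom.pos' hx).le
  calc _ ≤ _ := h1
    _ ≤ C * (1 - x) ^ n * ((1 + 1 / q) * ((1 - x) * (1 + x) ^ (-q))) := by gcongr
    _ = _ := by ring

/-! ### Primitives starting at `-1` -/

/-- The primitive `x ↦ ∫_{-1}^x φ`. -/
noncomputable def headInt (φ : ℝ → ℝ) (x : ℝ) : ℝ := ∫ s in (-1)..x, φ s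

section Head

variable {φ : ℝ → ℝ} {C p : ℝ}

theorem intervalIntegrable_head (hφ : ContinuousOn φ Dom) (hp : -1 < p)
    (hle : ∀ x ∈ Dom, |φ x| ≤ C * (1 + x) ^ p) : IntervalIntegrable φ volume (-1) 1 :=
  intervalIntegrable_of_le hφ le_rfl (by norm_num) le_rfl
    ((intervalIntegrable_rpow_weight hp _ _).const_mul C) hle

theorem intervalIntegrable_head' (h : IntervalIntegrable φ volume (-1) 1) {x : ℝ}
    (hx : x ∈ Icc (-1 : ℝ) 1) : IntervalIntegrable φ volume (-1) x :=
  h.mono_set (by rw [uIcc_of_le hx.1, uIcc_of_le (by norm_num)]; exact Icc_subset_Icc_right hx.2)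

theorem abs_headInt_le (hp : -1 < p)
    (hle : ∀ x ∈ Dom, |φ x| ≤ C * (1 + x) ^ p) {x : ℝ} (hx : x ∈ Icc (-1 : ℝ) 1) :
    |headInt φ x| ≤ C * ((1 + x) ^ (p + 1) / (p + 1)) := by
  have := abs_integral_le le_rfl hx.1 hx.2
    ((intervalIntegrable_rpow_weight hp (-1) x).const_mul C) (fun s hs _ => hle s hs)
  rwa [intervalIntegral.integral_const_mul, integral_rpow_weight hp] at this

theorem hasDerivAt_headInt (hφ : ContinuousOn φ Dom) (h : IntervalIntegrable φ volume (-1) 1)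
    {x : ℝ} (hx : x ∈ Dom) : HasDerivAt (headInt φ) (φ x) x :=
  intervalIntegral.integral_hasDerivAt_right (intervalIntegrable_head' h ⟨hx.1.le, hx.2.le⟩)
    (stronglyMeasurableAtFilter_dom hφ hx) (hφ.continuousAt (Dom.nhds hx))

theorem continuousOn_headInt (h : IntervalIntegrable φ volume (-1) 1) :
    ContinuousOn (headInt φ) (Icc (-1) 1) := by
  have := intervalIntegral.continuousOn_primitive_interval' h left_mem_uIcc
  rwa [uIcc_of_le (by norm_num)] at this

@[simp] theorem headInt_neg_one : headInt φ (-1) = 0 := intervalIntegral.integral_same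

end Head

/-- A function with derivative `d` on `(-1, 1)` that tends to `0` at `-1` is `∫_{-1}^x d`. -/
theorem eqOn_headInt {f d : ℝ → ℝ} (hf : Tendsto f (𝓝[>] (-1)) (𝓝 0))
    (hfd : ∀ x ∈ Dom, HasDerivAt f (d x) x) (hd : ContinuousOn d Dom)
    (hi : IntervalIntegrable d volume (-1) 1) : EqOn f (headInt d) Dom := by
  obtain ⟨c, hc⟩ : ∃ c, ∀ x ∈ Dom, f x - headInt d x = c := by
    refine IsOpen.exists_is_const_of_deriv_eq_zero isOpen_Ioo isPreconnected_Ioo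
      (f := fun x => f x - headInt d x) (fun x hx => ?_) fun x hx => ?_
    · exact ((hfd x hx).sub (hasDerivAt_headInt hd hi hx)).differentiableAt.differentiableWithinAt
    · have := (hfd x hx).sub (hasDerivAt_headInt hd hi hx)
      rw [sub_self] at this
      exact this.deriv
  have h1 : Tendsto (headInt d) (𝓝[>] (-1)) (𝓝 0) := by
    have := (continuousOn_headInt hi (-1) ⟨le_rfl, by norm_num⟩).mono Ioc_subset_Icc_self
    rw [ContinuousWithinAt, headInt_neg_one, nhdsWithin_Ioc_eq_nhdsGT (by norm_num)] at this
    exact this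
  have h2 : Tendsto (fun x => f x - headInt d x) (𝓝[>] (-1)) (𝓝 (0 - 0)) := hf.sub h1
  have h3 : Tendsto (fun x => f x - headInt d x) (𝓝[>] (-1)) (𝓝 c) := by
    refine tendsto_const_nhds.congr' ?_
    filter_upwards [Ioo_mem_nhdsGT (show (-1 : ℝ) < 1 by norm_num)] with x hx
    exact (hc x hx).symm
  intro x hx
  have := tendsto_nhds_unique h2 h3
  have := hc x hx
  linarith

/-- The homogeneous equation `(1 + x) f' + b f = 0` has the solutions `c (1 + x)^{-b}`. -/
theorem exists_eq_const_mul_rpow {f f' : ℝ → ℝ} {b : ℝ} (hf : ∀ x ∈ Dom, HasDerivAt f (f' x) x)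
    (h : ∀ x ∈ Dom, (1 + x) * f' x + b * f x = 0) :
    ∃ c, ∀ x ∈ Dom, f x = c * (1 + x) ^ (-b) := by
  have hd : ∀ x ∈ Dom, HasDerivAt (fun x => (1 + x) ^ b * f x) 0 x := fun x hx => by
    refine ((hasDerivAt_rpow_weight b hx).mul (hf x hx)).congr_deriv ?_
    have h0 := Dom.pos hx
    have : (1 + x) ^ b = (1 + x) ^ (b - 1) * (1 + x) := by
      rw [← Real.rpow_add_one h0.ne', sub_add_cancel]
    rw [this]
    linear_combination ((1 + x) ^ (b - 1)) * h x hx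
  obtain ⟨c, hc⟩ := IsOpen.exists_is_const_of_deriv_eq_zero isOpen_Ioo isPreconnected_Ioo
      (fun x hx => (hd x hx).differentiableAt.differentiableWithinAt) fun x hx => (hd x hx).deriv
  refine ⟨c, fun x hx => ?_⟩
  rw [← hc x hx, mul_right_comm, ← Real.rpow_add (Dom.pos hx)]
  simp

/-! ### Bounded continuous functions on `(-1, 1)` and weighted integral operators -/

/-- The Banach algebra of bounded continuous functions on `(-1, 1)`. -/
abbrev BddFun : Type := BoundedContinuousFunction Dom ℝ

/-- Extension by zero. -/
noncomputable def ext (f : BddFun) (x : ℝ) : ℝ :=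
  open Classical in if h : x ∈ Dom then f ⟨x, h⟩ else 0

theorem ext_of_mem (f : BddFun) {x : ℝ} (hx : x ∈ Dom) : ext f x = f ⟨x, hx⟩ := dif_pos hx

@[simp] theorem ext_add (f g : BddFun) (x : ℝ) : ext (f + g) x = ext f x + ext g x := by
  unfold ext; split_ifs <;> simp

@[simp] theorem ext_sub (f g : BddFun) (x : ℝ) : ext (f - g) x = ext f x - ext g x := by
  unfold ext; split_ifs <;> simp

@[simp] theorem ext_neg (f : BddFun) (x : ℝ) : ext (-f) x = -ext f x := by
  unfold ext; split_ifs <;> simp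

@[simp] theorem ext_smul (c : ℝ) (f : BddFun) (x : ℝ) : ext (c • f) x = c * ext f x := by
  unfold ext; split_ifs <;> simp

@[simp] theorem ext_mul (f g : BddFun) (x : ℝ) : ext (f * g) x = ext f x * ext g x := by
  unfold ext; split_ifs <;> simp

@[simp] theorem ext_zero (x : ℝ) : ext 0 x = 0 := by
  unfold ext; split_ifs <;> simp

theorem abs_ext_le (f : BddFun) (x : ℝ) : |ext f x| ≤ ‖f‖ := by
  unfold ext; split_ifs with h
  · exact f.norm_coe_le_norm _
  · simp

theorem continuousOn_ext (f : BddFun) : ContinuousOn (ext f) Dom := by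
  rw [continuousOn_iff_continuous_domRestrict]
  convert f.continuous using 1
  ext x
  exact ext_of_mem f x.2

theorem BddFun.ext' {f g : BddFun} (h : ∀ x ∈ Dom, ext f x = ext g x) : f = g := by
  ext x
  rw [← ext_of_mem f x.2, ← ext_of_mem g x.2, h x x.2]

theorem norm_le_of_ext {f : BddFun} {C : ℝ} (hC : 0 ≤ C) (h : ∀ x ∈ Dom, |ext f x| ≤ C) :
    ‖f‖ ≤ C :=
  (BoundedContinuousFunction.norm_le hC).2 fun x => by
    rw [← ext_of_mem f x.2]; exact h x x.2

/-- The restriction to `(-1, 1)` of a bounded continuous function. -/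
noncomputable def ofFun (φ : ℝ → ℝ) (hφ : ContinuousOn φ Dom) (C : ℝ) (hC : ∀ x ∈ Dom, |φ x| ≤ C) :
    BddFun :=
  BoundedContinuousFunction.ofNormedAddCommGroup (fun x : Dom => φ x)
    (continuousOn_iff_continuous_domRestrict.1 hφ) C fun x => hC x x.2

@[simp] theorem ext_ofFun (φ : ℝ → ℝ) (hφ : ContinuousOn φ Dom) (C : ℝ)
    (hC : ∀ x ∈ Dom, |φ x| ≤ C) {x : ℝ} (hx : x ∈ Dom) : ext (ofFun φ hφ C hC) x = φ x := by
  rw [ext_of_mem _ hx]; rfl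

/-- The continuous linear map to `BddFun` given by a pointwise bounded linear operation. -/
noncomputable def mkOp {E : Type*} [SeminormedAddCommGroup E] [NormedSpace ℝ E] (Φ : E → ℝ → ℝ)
    (C : ℝ) (hC : 0 ≤ C) (hc : ∀ f, ContinuousOn (Φ f) Dom)
    (ha : ∀ f g, ∀ x ∈ Dom, Φ (f + g) x = Φ f x + Φ g x)
    (hs : ∀ (c : ℝ) f, ∀ x ∈ Dom, Φ (c • f) x = c * Φ f x)
    (hb : ∀ f, ∀ x ∈ Dom, |Φ f x| ≤ C * ‖f‖) : E →L[ℝ] BddFun :=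
  LinearMap.mkContinuous
    { toFun := fun f => ofFun (Φ f) (hc f) (C * ‖f‖) (hb f)
      map_add' := fun f g => BddFun.ext' fun x hx => by simp [hx, ha f g x hx]
      map_smul' := fun c f => BddFun.ext' fun x hx => by simp [hx, hs c f x hx] } C
    fun f => norm_le_of_ext (mul_nonneg hC (norm_nonneg _)) fun x hx => by
      simpa [hx] using hb f x hx

theorem ext_mkOp {E : Type*} [SeminormedAddCommGroup E] [NormedSpace ℝ E] {Φ : E → ℝ → ℝ}
    {C : ℝ} {hC : 0 ≤ C} {hc : ∀ f, ContinuousOn (Φ f) Dom}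
    {ha : ∀ f g, ∀ x ∈ Dom, Φ (f + g) x = Φ f x + Φ g x}
    {hs : ∀ (c : ℝ) f, ∀ x ∈ Dom, Φ (c • f) x = c * Φ f x}
    {hb : ∀ f, ∀ x ∈ Dom, |Φ f x| ≤ C * ‖f‖} (f : E) {x : ℝ} (hx : x ∈ Dom) :
    ext (mkOp Φ C hC hc ha hs hb f) x = Φ f x :=
  ext_ofFun (Φ f) (hc f) (C * ‖f‖) (hb f) hx

theorem continuousOn_rpow_dom (p : ℝ) : ContinuousOn (fun s : ℝ => (1 + s) ^ p) Dom :=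
  (continuousOn_rpow_weight p).mono Ioo_subset_Ioc_self

theorem rpow_dom_pos (p : ℝ) {x : ℝ} (hx : x ∈ Dom) : 0 < (1 + x) ^ p :=
  Real.rpow_pos_of_pos (Dom.pos hx) p

theorem rpow_dom_le {p : ℝ} (hp : 0 ≤ p) {x : ℝ} (hx : x ∈ Dom) : (1 + x) ^ p ≤ 2 ^ p :=
  Real.rpow_le_rpow (Dom.pos hx).le (by linarith [hx.2]) hp

/-- A nonnegative power of `1 + x`, as a bounded function. -/
noncomputable def powFun (p : ℝ) (hp : 0 ≤ p) : BddFun :=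
  ofFun (fun x => (1 + x) ^ p) (continuousOn_rpow_dom p) (2 ^ p) fun x hx => by
    rw [abs_of_pos (rpow_dom_pos p hx)]; exact rpow_dom_le hp hx

theorem ext_powFun {p : ℝ} (hp : 0 ≤ p) {x : ℝ} (hx : x ∈ Dom) :
    ext (powFun p hp) x = (1 + x) ^ p := ext_ofFun _ _ _ _ hx

/-- The function `1 - x`. -/
noncomputable def oneSub : BddFun :=
  ofFun (fun x => 1 - x) (continuousOn_const.sub continuousOn_id) 2 fun x hx => by
    rw [abs_of_pos (Dom.pos' hx)]; linarith [hx.1]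

theorem ext_oneSub {x : ℝ} (hx : x ∈ Dom) : ext oneSub x = 1 - x := ext_ofFun _ _ _ _ hx

/-! ### Weighted integration from `-1` -/

section HeadOp

variable {p : ℝ}

theorem continuousOn_weight_ext (p : ℝ) (f : BddFun) :
    ContinuousOn (fun s => (1 + s) ^ p * ext f s) Dom :=
  (continuousOn_rpow_dom p).mul (continuousOn_ext f)

theorem abs_weight_ext_le (p : ℝ) (f : BddFun) : ∀ x ∈ Dom,
    |(1 + x) ^ p * ext f x| ≤ ‖f‖ * (1 + x) ^ p := fun x hx => by
  rw [abs_mul, abs_of_pos (rpow_dom_pos p hx), mul_comm]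
  exact mul_le_mul_of_nonneg_right (abs_ext_le f x) (rpow_dom_pos p hx).le

theorem intervalIntegrable_weight_ext (hp : -1 < p) (f : BddFun) :
    IntervalIntegrable (fun s => (1 + s) ^ p * ext f s) volume (-1) 1 :=
  intervalIntegrable_head (continuousOn_weight_ext p f) hp (abs_weight_ext_le p f)

/-- The operator `f ↦ (1+x)^{-(p+1)} ∫_{-1}^x (1+s)^p f(s) ds`. -/
noncomputable def headOp (p : ℝ) (hp : -1 < p) : BddFun →L[ℝ] BddFun :=
  mkOp (fun f x => (1 + x) ^ (-(p + 1)) * headInt (fun s => (1 + s) ^ p * ext f s) x) (1 / (p + 1))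
    (by have : 0 < p + 1 := by linarith
        positivity)
    (fun f => (continuousOn_rpow_dom _).mul
      ((continuousOn_headInt (intervalIntegrable_weight_ext hp f)).mono Ioo_subset_Icc_self))
    (fun f g x hx => by
      rw [← mul_add, headInt, headInt, headInt, ← intervalIntegral.integral_add
        (intervalIntegrable_head' (intervalIntegrable_weight_ext hp f) ⟨hx.1.le, hx.2.le⟩)
        (intervalIntegrable_head' (intervalIntegrable_weight_ext hp g) ⟨hx.1.le, hx.2.le⟩)]
      simp only [ext_add, mul_add])
    (fun c f x hx => by
      rw [mul_left_comm c, headInt, headInt, ← intervalIntegral.integral_const_mul c]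
      simp only [ext_smul, mul_left_comm])
    (fun f x hx => by
      have h1 := abs_headInt_le hp (abs_weight_ext_le p f) ⟨hx.1.le, hx.2.le⟩
      rw [abs_mul, abs_of_pos (rpow_dom_pos _ hx)]
      calc _ ≤ (1 + x) ^ (-(p + 1)) * (‖f‖ * ((1 + x) ^ (p + 1) / (p + 1))) := by
            have := rpow_dom_pos (-(p + 1)) hx
            gcongr
        _ = ((1 + x) ^ (-(p + 1)) * (1 + x) ^ (p + 1)) * (1 / (p + 1) * ‖f‖) := by ring
        _ = _ := by rw [← Real.rpow_add (Dom.pos hx), neg_add_cancel, Real.rpow_zero, one_mul])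

theorem rpow_mul_ext_headOp (hp : -1 < p) (f : BddFun) {x : ℝ} (hx : x ∈ Dom) (r : ℝ) :
    (1 + x) ^ r * ext (headOp p hp f) x =
      (1 + x) ^ (r - (p + 1)) * headInt (fun s => (1 + s) ^ p * ext f s) x := by
  rw [headOp, ext_mkOp f hx, ← mul_assoc, ← Real.rpow_add (Dom.pos hx), sub_eq_add_neg]

end HeadOp

/-! ### Weighted integration up to `1` -/

section TailOp

variable {q : ℝ} (n : ℕ)

theorem regAtOne_weight_ext (p : ℝ) (f : BddFun) :
    RegAtOne (fun s => (1 - s) ^ n * (1 + s) ^ p * ext f s) := by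
  have := (regAtOne_weight n p).mul_of_bdd (continuousOn_ext f) ‖f‖ fun x _ => abs_ext_le f x
  exact this.congr fun x _ => mul_comm _ _

theorem abs_weight_ext_le' (p : ℝ) (f : BddFun) : ∀ x ∈ Dom,
    |(1 - x) ^ n * (1 + x) ^ p * ext f x| ≤ ‖f‖ * ((1 - x) ^ n * (1 + x) ^ p) := fun x hx => by
  have h1 : 0 < (1 - x) ^ n * (1 + x) ^ p := mul_pos (pow_pos (Dom.pos' hx) n) (rpow_dom_pos p hx)
  rw [abs_mul, abs_of_pos h1, mul_comm]
  exact mul_le_mul_of_nonneg_right (abs_ext_le f x) h1.le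

/-- The operator `f ↦ (1-x)^{-(n+1)} (1+x)^q ∫_x^1 (1-s)^n (1+s)^{-1-q} f(s) ds`. -/
noncomputable def tailOp (q : ℝ) (hq : 0 < q) : BddFun →L[ℝ] BddFun :=
  mkOp (fun f x => ((1 - x) ^ (n + 1))⁻¹ * (1 + x) ^ q *
      tailInt (fun s => (1 - s) ^ n * (1 + s) ^ (-1 - q) * ext f s) x) (1 + 1 / q)
    (by positivity)
    (fun f => by
      refine ((ContinuousOn.inv₀ (by fun_prop) fun x hx =>
        (pow_pos (Dom.pos' hx) _).ne').mul (continuousOn_rpow_dom _)).mul ?_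
      exact (regAtOne_weight_ext n _ f).continuousOn_tailInt.mono Ioo_subset_Ioc_self)
    (fun f g x hx => by
      rw [← mul_add, ← tailInt_add (regAtOne_weight_ext n _ f) (regAtOne_weight_ext n _ g) hx]
      simp only [ext_add, mul_add])
    (fun c f x hx => by
      rw [mul_left_comm c, ← tailInt_const_mul c]
      simp only [ext_smul, mul_left_comm])
    (fun f x hx => by
      have h1 := abs_tailInt_le n hq (norm_nonneg f) (abs_weight_ext_le' n _ f) hx
      have h2 : 0 < ((1 - x) ^ (n + 1))⁻¹ := inv_pos.2 (pow_pos (Dom.pos' hx) _)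
      have h3 := rpow_dom_pos q hx
      rw [abs_mul, abs_of_pos (mul_pos h2 h3)]
      calc _ ≤ ((1 - x) ^ (n + 1))⁻¹ * (1 + x) ^ q *
            (‖f‖ * (1 + 1 / q) * ((1 - x) ^ (n + 1) * (1 + x) ^ (-q))) := by gcongr
        _ = (((1 - x) ^ (n + 1))⁻¹ * (1 - x) ^ (n + 1)) * ((1 + x) ^ q * (1 + x) ^ (-q)) *
            ((1 + 1 / q) * ‖f‖) := by ring
        _ = _ := by
          rw [← Real.rpow_add (Dom.pos hx), add_neg_cancel, Real.rpow_zero,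
            inv_mul_cancel₀ (pow_pos (Dom.pos' hx) _).ne', one_mul, one_mul])

theorem pow_mul_rpow_mul_ext_tailOp (hq : 0 < q) (f : BddFun) {x : ℝ} (hx : x ∈ Dom) :
    (1 - x) ^ (n + 1) * (1 + x) ^ (-q) * ext (tailOp n q hq f) x =
      tailInt (fun s => (1 - s) ^ n * (1 + s) ^ (-1 - q) * ext f s) x := by
  rw [tailOp, ext_mkOp f hx]
  have h2 := (pow_pos (Dom.pos' hx) (n + 1)).ne'
  have h3 : (1 + x) ^ (-q) * (1 + x) ^ q = 1 := by
    rw [← Real.rpow_add (Dom.pos hx), neg_add_cancel, Real.rpow_zero]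
  calc _ = ((1 - x) ^ (n + 1) * ((1 - x) ^ (n + 1))⁻¹) * ((1 + x) ^ (-q) * (1 + x) ^ q) *
        tailInt (fun s => (1 - s) ^ n * (1 + s) ^ (-1 - q) * ext f s) x := by ring
    _ = _ := by rw [h3, mul_inv_cancel₀ h2, one_mul, one_mul]

end TailOp

/-! ### The operators of the linearized system -/

/-- The range of the parameters: `a` stands for `√(1+2μ)`. -/
structure Admissible (ε a : ℝ) : Prop where
  nonneg : 0 ≤ a
  lt : a < ε
  half : ε < 1 / 2

namespace Admissible

variable {ε a : ℝ} (c : Admissible ε a)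

theorem pos (c : Admissible ε a) : 0 < ε := c.nonneg.trans_lt c.lt

/-- The solution operator of `(1+x) z' + (1+a) z = ζ`. -/
noncomputable def zOp : BddFun →L[ℝ] BddFun :=
  headOp (a - 2 * ε) (by linarith [c.nonneg, c.half])

/-- The operator `z ↦ ∫_{-1}^x z`. -/
noncomputable def yOp : BddFun →L[ℝ] BddFun := headOp (-2 * ε) (by linarith [c.half])

/-- The operator `h ↦ -∫_x^1 h`. -/
noncomputable def uOp : BddFun →L[ℝ] BddFun := -tailOp 0 ε c.pos

/-- The weighted function `-(1+x)^{-1-a}`. -/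
noncomputable def qFun : BddFun := -powFun (ε - a) (by linarith [c.lt])

/-- A solution operator of `(1+x) h' + (1+a) h = g`. -/
noncomputable def tOpAux : BddFun →L[ℝ] BddFun :=
  -(ContinuousLinearMap.mul ℝ BddFun oneSub).comp (tailOp 0 (ε - a) (by linarith [c.lt]))

/-- Evaluation at `0` of `-∫_x^1 h`. -/
noncomputable def evOp : BddFun →L[ℝ] ℝ :=
  (BoundedContinuousFunction.evalCLM ℝ (⟨0, zero_mem_Dom⟩ : Dom)).comp c.uOp

theorem evOp_apply (f : BddFun) : c.evOp f = ext (c.uOp f) 0 := by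
  rw [ext_of_mem _ zero_mem_Dom]; rfl

/-- The solution operator of `(1+x) h' + (1+a) h = g`, `∫_0^1 h = 0`. -/
noncomputable def tOp : BddFun →L[ℝ] BddFun :=
  c.tOpAux - ((c.evOp c.qFun)⁻¹ • c.evOp.comp c.tOpAux).smulRight c.qFun

/-- The quadratic term of the first equation, as an operator on products. -/
noncomputable def bOp : BddFun →L[ℝ] BddFun :=
  (-2 : ℝ) • (tailOp 2 (2 * ε) (by linarith [c.pos])).comp
    (tailOp 1 (1 + 2 * ε) (by linarith [c.pos]))

/-- The weight of a product with `∫_{-1}^x z`. -/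
noncomputable def mFun : BddFun := powFun (1 - 2 * ε) (by linarith [c.half])

/-! The unweighted functions. -/

/-- The function `z`. -/
noncomputable def zF (ε : ℝ) (z : BddFun) (x : ℝ) : ℝ := (1 + x) ^ (-2 * ε) * ext z x

/-- The function `y`. -/
noncomputable def yF (ε : ℝ) (y : BddFun) (x : ℝ) : ℝ := (1 + x) ^ (1 - 2 * ε) * ext y x

/-- The function `h`. -/
noncomputable def hF (ε : ℝ) (h : BddFun) (x : ℝ) : ℝ := (1 + x) ^ (-1 - ε) * ext h x

/-- The function `u`. -/
noncomputable def uF (ε : ℝ) (u : BddFun) (x : ℝ) : ℝ := (1 - x) * (1 + x) ^ (-ε) * ext u x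

theorem continuousOn_zF (z : BddFun) : ContinuousOn (zF ε z) Dom := continuousOn_weight_ext _ _

theorem continuousOn_hF (h : BddFun) : ContinuousOn (hF ε h) Dom := continuousOn_weight_ext _ _

theorem regAtOne_hF (h : BddFun) : RegAtOne (hF ε h) :=
  (regAtOne_weight_ext 0 (-1 - ε) h).congr fun x _ => by simp [hF]

theorem intervalIntegrable_zF (c : Admissible ε a) (z : BddFun) : IntervalIntegrable (zF ε z) volume (-1) 1 :=
  intervalIntegrable_weight_ext (by linarith [c.half]) z

theorem yF_yOp (z : BddFun) {x : ℝ} (hx : x ∈ Dom) : yF ε (c.yOp z) x = headInt (zF ε z) x := by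
  rw [yF, yOp, rpow_mul_ext_headOp _ _ hx]
  have : 1 - 2 * ε - (-2 * ε + 1) = 0 := by ring
  rw [this, Real.rpow_zero, one_mul]
  rfl

theorem hasDerivAt_yF (z : BddFun) {x : ℝ} (hx : x ∈ Dom) :
    HasDerivAt (yF ε (c.yOp z)) (zF ε z x) x := by
  refine (hasDerivAt_headInt (continuousOn_zF z) (c.intervalIntegrable_zF z)
    hx).congr_of_eventuallyEq ?_
  filter_upwards [Dom.nhds hx] with y hy using c.yF_yOp z hy

theorem uF_uOp (h : BddFun) {x : ℝ} (hx : x ∈ Dom) : uF ε (c.uOp h) x = -tailInt (hF ε h) x := by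
  have := pow_mul_rpow_mul_ext_tailOp 0 c.pos h hx
  simp only [zero_add, pow_one, pow_zero, one_mul] at this
  simp only [uF, uOp, neg_apply, ext_neg, mul_neg, this]
  rfl

theorem hasDerivAt_uF (h : BddFun) {x : ℝ} (hx : x ∈ Dom) :
    HasDerivAt (uF ε (c.uOp h)) (hF ε h x) x := by
  have := ((regAtOne_hF (ε := ε) h).hasDerivAt hx).neg
  rw [neg_neg] at this
  refine this.congr_of_eventuallyEq ?_
  filter_upwards [Dom.nhds hx] with y hy using c.uF_uOp h hy

theorem evOp_eq (h : BddFun) : c.evOp h = -tailInt (hF ε h) 0 := by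
  rw [← c.uF_uOp h zero_mem_Dom, evOp_apply]; simp [uF]

/-- Variation of constants: `(1+x)^{1+a}` is an integrating factor, and the weight `(1+s)^{-2ε}` of
the source combines with `(1+s)^a`. The resulting exponent exceeds `-1`, so the integral may start
at `-1`. -/
theorem zF_zOp (ζ : BddFun) {x : ℝ} (hx : x ∈ Dom) : zF ε (c.zOp ζ) x =
    (1 + x) ^ (-(1 + a)) * headInt (fun s => (1 + s) ^ (a - 2 * ε) * ext ζ s) x := by
  rw [zF, zOp, rpow_mul_ext_headOp _ _ hx]
  congr 2; ring

theorem hasDerivAt_zF (ζ : BddFun) {x : ℝ} (hx : x ∈ Dom) :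
    HasDerivAt (zF ε (c.zOp ζ)) ((zF ε ζ x - (1 + a) * zF ε (c.zOp ζ) x) / (1 + x)) x := by
  have h0 := Dom.pos hx
  have h1 := (hasDerivAt_rpow_weight (-(1 + a)) hx).mul
    (hasDerivAt_headInt (continuousOn_weight_ext (a - 2 * ε) ζ) (intervalIntegrable_weight_ext
      (by linarith [c.nonneg, c.half]) ζ) hx)
  refine (h1.congr_deriv ?_).congr_of_eventuallyEq
    (by filter_upwards [Dom.nhds hx] with y hy using c.zF_zOp ζ hy)
  rw [c.zF_zOp ζ hx, zF, eq_div_iff h0.ne']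
  have e1 : (1 + x) ^ (-(1 + a) - 1) * (1 + x) = (1 + x) ^ (-(1 + a)) := by
    rw [← Real.rpow_add_one h0.ne', sub_add_cancel]
  have e2 : (1 + x) ^ (-(1 + a)) * (1 + x) ^ (a - 2 * ε) * (1 + x) = (1 + x) ^ (-2 * ε) := by
    rw [← Real.rpow_add h0, ← Real.rpow_add_one h0.ne']
    congr 1; ring
  linear_combination (-(1 + a)) * headInt (fun s => (1 + s) ^ (a - 2 * ε) * ext ζ s) x * e1
    + ext ζ x * e2

theorem hF_qFun {x : ℝ} (hx : x ∈ Dom) : hF ε c.qFun x = -(1 + x) ^ (-(1 + a)) := by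
  rw [hF, qFun, ext_neg, ext_powFun _ hx, mul_neg, ← Real.rpow_add (Dom.pos hx)]
  congr 2; ring

/-- The same integrating factor, but here the exponent `-1-(ε-a)` is below `-1` because `a < ε`. The
integral has to be taken up to `1`. -/
theorem hF_tOpAux (g : BddFun) {x : ℝ} (hx : x ∈ Dom) : hF ε (c.tOpAux g) x =
    -((1 + x) ^ (-(1 + a)) * tailInt (fun s => (1 + s) ^ (-1 - (ε - a)) * ext g s) x) := by
  have h1 := pow_mul_rpow_mul_ext_tailOp 0 (sub_pos.2 c.lt) g hx
  simp only [zero_add, pow_one, pow_zero, one_mul] at h1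
  have h0 := Dom.pos hx
  have e : (1 + x) ^ (-(1 + a)) * (1 + x) ^ (-(ε - a)) = (1 + x) ^ (-1 - ε) := by
    rw [← Real.rpow_add h0]; congr 1; ring
  rw [← h1, hF, tOpAux, ← e]
  simp only [neg_apply, ContinuousLinearMap.comp_apply,
    ContinuousLinearMap.mul_apply', ext_neg, ext_mul, ext_oneSub hx]
  ring

theorem evOp_qFun_eq : c.evOp c.qFun = tailInt (fun s => (1 + s) ^ (-(1 + a))) 0 := by
  rw [evOp_eq, tailInt_congr (χ := fun s => (-1) * (1 + s) ^ (-(1 + a)))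
    (fun s hs => by rw [c.hF_qFun hs]; ring) (by norm_num), tailInt_const_mul]
  ring

/-- The constant in the definition of `tOp`. -/
noncomputable def tConst (g : BddFun) : ℝ := (c.evOp c.qFun)⁻¹ * c.evOp (c.tOpAux g)

theorem tOp_apply (g : BddFun) : c.tOp g = c.tOpAux g - c.tConst g • c.qFun := by
  simp [tOp, tConst]

theorem hF_sub_smul (f g : BddFun) (k x : ℝ) : hF ε (f - k • g) x = hF ε f x - k * hF ε g x := by
  simp only [hF, ext_sub, ext_smul]; ring

theorem hF_tOp (g : BddFun) {x : ℝ} (hx : x ∈ Dom) : hF ε (c.tOp g) x = (1 + x) ^ (-(1 + a)) *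
    (c.tConst g - tailInt (fun s => (1 + s) ^ (-1 - (ε - a)) * ext g s) x) := by
  rw [tOp_apply, hF_sub_smul, c.hF_tOpAux g hx, c.hF_qFun hx]
  ring

theorem regAtOne_tOp (g : BddFun) : RegAtOne (fun s => (1 + s) ^ (-1 - (ε - a)) * ext g s) :=
  (regAtOne_weight_ext 0 (-1 - (ε - a)) g).congr fun x _ => by simp

theorem hasDerivAt_hF (g : BddFun) {x : ℝ} (hx : x ∈ Dom) :
    HasDerivAt (hF ε (c.tOp g)) ((hF ε g x - (1 + a) * hF ε (c.tOp g) x) / (1 + x)) x := by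
  have h0 := Dom.pos hx
  have h1 := (hasDerivAt_rpow_weight (-(1 + a)) hx).mul
    (((regAtOne_tOp (ε := ε) (a := a) g).hasDerivAt hx).const_sub (c.tConst g))
  refine (h1.congr_deriv ?_).congr_of_eventuallyEq
    (by filter_upwards [Dom.nhds hx] with y hy using c.hF_tOp g hy)
  rw [c.hF_tOp g hx, hF, eq_div_iff h0.ne']
  have e1 : (1 + x) ^ (-(1 + a) - 1) * (1 + x) = (1 + x) ^ (-(1 + a)) := by
    rw [← Real.rpow_add_one h0.ne', sub_add_cancel]
  have e2 : (1 + x) ^ (-(1 + a)) * (1 + x) ^ (-1 - (ε - a)) * (1 + x) = (1 + x) ^ (-1 - ε) := by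
    rw [← Real.rpow_add h0, ← Real.rpow_add_one h0.ne']
    congr 1; ring
  linear_combination (-(1 + a)) *
    (c.tConst g - tailInt (fun s => (1 + s) ^ (-1 - (ε - a)) * ext g s) x) * e1 + ext g x * e2

theorem evOp_qFun_pos : 0 < c.evOp c.qFun := by
  rw [evOp_qFun_eq]
  refine intervalIntegral.intervalIntegral_pos_of_pos_on ?_ (fun x hx => ?_) one_pos
  · exact (RegAtOne.of_continuousOn_Ioc (continuousOn_rpow_weight _)).int 0 zero_mem_Dom
  · exact Real.rpow_pos_of_pos (by linarith [hx.1]) _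

/-- The multiple of the kernel function subtracted in `tOp` is chosen for this. It is well defined
because the kernel function has nonzero integral over `(0,1)`. -/
theorem evOp_tOp (g : BddFun) : c.evOp (c.tOp g) = 0 := by
  have := c.evOp_qFun_pos.ne'
  rw [tOp_apply, map_sub, map_smul, tConst, smul_eq_mul]
  field_simp
  ring

theorem zF_bOp (p : BddFun) {x : ℝ} (hx : x ∈ Dom) : (1 - x) ^ 3 * zF ε (c.bOp p) x =
    -2 * tailInt (tailInt (fun s => (1 - s) * (1 + s) ^ (-2 - 2 * ε) * ext p s)) x := by
  have h1 := pow_mul_rpow_mul_ext_tailOp 2 (q := 2 * ε) (by linarith [c.pos])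
    (tailOp 1 (1 + 2 * ε) (by linarith [c.pos]) p) hx
  have h2 : EqOn (fun s => (1 - s) ^ 2 * (1 + s) ^ (-1 - 2 * ε) *
      ext (tailOp 1 (1 + 2 * ε) (by linarith [c.pos]) p) s)
      (tailInt (fun s => (1 - s) * (1 + s) ^ (-2 - 2 * ε) * ext p s)) Dom := fun s hs => by
    have h3 := pow_mul_rpow_mul_ext_tailOp 1 (q := 1 + 2 * ε) (by linarith [c.pos]) p hs
    have e1 : -(1 + 2 * ε) = -1 - 2 * ε := by ring
    have e2 : -1 - (1 + 2 * ε) = -2 - 2 * ε := by ring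
    simp only [e1, e2, pow_one] at h3
    exact h3
  rw [tailInt_congr h2 ⟨hx.1.le, hx.2.le⟩] at h1
  rw [← h1]
  have e1 : -(2 * ε) = -2 * ε := by ring
  simp only [zF, bOp, smul_apply, ContinuousLinearMap.comp_apply, ext_smul, e1]
  ring

/-! Uniqueness for the linear equations. -/

/-- Two solutions differ by `k (1+x)^{-1-a}`. The weighted difference is bounded, so `|k|` is at
most a constant times `(1+x)^{1+a-2ε}`, which tends to `0` at `-1`. -/
theorem zOp_eq {ζ z : BddFun} {z' : ℝ → ℝ} (hz : ∀ x ∈ Dom, HasDerivAt (zF ε z) (z' x) x)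
    (h : ∀ x ∈ Dom, (1 + x) * z' x + (1 + a) * zF ε z x = zF ε ζ x) : c.zOp ζ = z := by
  obtain ⟨k, hk⟩ := exists_eq_const_mul_rpow (b := 1 + a)
    (fun x hx => (hz x hx).sub (c.hasDerivAt_zF ζ hx)) (fun x hx => by
      have := Dom.pos hx
      rw [← sub_eq_zero.2 (h x hx)]
      simp only [Pi.sub_apply]
      field_simp
      ring)
  have hb : ∀ x ∈ Dom, |k| ≤ ‖z - c.zOp ζ‖ * (1 + x) ^ (1 + a - 2 * ε) := fun x hx => by
    have h0 := Dom.pos hx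
    have e : k = (1 + x) ^ (1 + a - 2 * ε) * ext (z - c.zOp ζ) x := by
      have h1 := hk x hx
      simp only [Pi.sub_apply, zF] at h1
      have e1 : (1 + x) ^ (1 + a) * (1 + x) ^ (-(1 + a)) = 1 := by
        rw [← Real.rpow_add h0, add_neg_cancel, Real.rpow_zero]
      have e2 : (1 + x) ^ (1 + a - 2 * ε) = (1 + x) ^ (1 + a) * (1 + x) ^ (-2 * ε) := by
        rw [← Real.rpow_add h0]; congr 1; ring
      rw [e2, ext_sub]
      linear_combination (-k) * e1 - (1 + x) ^ (1 + a) * h1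
    rw [e]
    exact abs_weight_ext_le _ _ x hx
  have hk0 : |k| ≤ 0 := by
    have ht : Tendsto (fun x : ℝ => ‖z - c.zOp ζ‖ * (1 + x) ^ (1 + a - 2 * ε)) (𝓝[>] (-1))
        (𝓝 (‖z - c.zOp ζ‖ * (1 + -1) ^ (1 + a - 2 * ε))) := by
      refine Tendsto.const_mul _ (Tendsto.mono_left ?_ nhdsWithin_le_nhds)
      exact (ContinuousAt.rpow_const (continuousAt_const.add continuousAt_id)
        (Or.inr (by linarith [c.half, c.nonneg])))
    rw [add_neg_cancel, Real.zero_rpow (by linarith [c.half, c.nonneg]), mul_zero] at ht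
    refine ge_of_tendsto ht ?_
    filter_upwards [Ioo_mem_nhdsGT (show (-1 : ℝ) < 1 by norm_num)] with x hx using hb x hx
  have hk1 : k = 0 := abs_nonpos_iff.1 hk0
  refine BddFun.ext' fun x hx => ?_
  have h1 := hk x hx
  rw [hk1, zero_mul] at h1
  simp only [Pi.sub_apply, zF, ← mul_sub] at h1
  rcases mul_eq_zero.1 h1 with h2 | h2
  · exact absurd h2 (rpow_dom_pos _ hx).ne'
  · linarith

/-- Two solutions differ by a multiple of `qFun`. Both are annihilated by `evOp`, while `qFun` is
not. -/
theorem tOp_eq {g h : BddFun} {h' : ℝ → ℝ} (hh : ∀ x ∈ Dom, HasDerivAt (hF ε h) (h' x) x)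
    (he : ∀ x ∈ Dom, (1 + x) * h' x + (1 + a) * hF ε h x = hF ε g x) (h0 : c.evOp h = 0) :
    c.tOp g = h := by
  obtain ⟨k, hk⟩ := exists_eq_const_mul_rpow (b := 1 + a)
    (fun x hx => (hh x hx).sub (c.hasDerivAt_hF g hx)) (fun x hx => by
      have := Dom.pos hx
      rw [← sub_eq_zero.2 (he x hx)]
      simp only [Pi.sub_apply]
      field_simp
      ring)
  have e : h - c.tOp g = -k • c.qFun := BddFun.ext' fun x hx => by
    have h1 := hk x hx
    have h2 := c.hF_qFun hx
    have h3 := (rpow_dom_pos (-1 - ε) hx).ne'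
    simp only [Pi.sub_apply, hF] at h1 h2
    apply mul_left_cancel₀ h3
    rw [ext_sub, ext_smul]
    linear_combination h1 + k * h2
  have h1 := congrArg c.evOp e
  rw [map_sub, map_smul, h0, c.evOp_tOp, sub_zero, smul_eq_mul, eq_comm, mul_eq_zero] at h1
  rcases h1 with h1 | h1
  · rw [h1, zero_smul] at e
    exact (sub_eq_zero.1 e).symm
  · exact absurd h1 c.evOp_qFun_pos.ne'

end Admissible

/-! ### The operators with values in `M₁(ε)` and `M₂(ε)` -/

theorem wSup_le_of_mem {s : Set ℝ} {w f : ℝ → ℝ} {C : ℝ} (h0 : 0 ≤ C)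
    (hC : ∀ x ∈ s, |w x * f x| ≤ C) : WBdd s w f ∧ wSup s w f ≤ C :=
  ⟨wbdd_of_le hC, wSup_le h0 hC⟩

namespace Admissible

variable {ε a : ℝ} (c : Admissible ε a)

theorem uF_of_notMem (u : BddFun) {x : ℝ} (hx : x ∉ Dom) : uF ε u x = 0 := by
  simp [uF, ext, hx]

theorem yF_of_notMem (y : BddFun) {x : ℝ} (hx : x ∉ Dom) : yF ε y x = 0 := by
  simp [yF, ext, hx]

/-- The second derivative is controlled by solving the differential equation for `h'`, with `1 + a ≤
2`. The function `H` supplies the continuity of the derivative at `x = 1`, where a bounded function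
on the open interval carries no information. -/
theorem mem_M2Sub {h g : BddFun} {H : ℝ → ℝ}
    (hh : ∀ x ∈ Dom, HasDerivAt (hF ε h) ((hF ε g x - (1 + a) * hF ε h x) / (1 + x)) x)
    (hH : EqOn (hF ε h) H Dom) (hc : ContinuousOn H (Ioc (-1) 1)) :
    uF ε (c.uOp h) ∈ M2Sub ε ∧
      normM2 ε (uF ε (c.uOp h)) ≤ 2 * ‖c.uOp h‖ + ‖h‖ + (‖g‖ + 2 * ‖h‖) := by
  have hR : RegAtOne (hF ε h) := regAtOne_hF h
  have e0 : EqOn (uF ε (c.uOp h)) (fun x => -tailInt (hF ε h) x) (Ioc (-1) 1) := fun x hx => by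
    rcases hx.2.lt_or_eq with h1 | rfl
    · exact c.uF_uOp h ⟨hx.1, h1⟩
    · simp [uF]
  have e1 : EqOn (deriv (uF ε (c.uOp h))) (hF ε h) Dom := fun x hx => (c.hasDerivAt_uF h hx).deriv
  have e2 : EqOn (deriv (deriv (uF ε (c.uOp h))))
      (fun x => (hF ε g x - (1 + a) * hF ε h x) / (1 + x)) Dom := fun x hx => by
    rw [((eventuallyEq_of_mem (Dom.nhds hx) e1).deriv_eq), (hh x hx).deriv]
  have b0 : ∀ x ∈ Dom, |(1 + x) ^ ε * uF ε (c.uOp h) x| ≤ 2 * ‖c.uOp h‖ := fun x hx => by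
    have : (1 + x) ^ ε * uF ε (c.uOp h) x = (1 - x) * ext (c.uOp h) x := by
      have : (1 + x) ^ ε * (1 + x) ^ (-ε) = 1 := by
        rw [← Real.rpow_add (Dom.pos hx), add_neg_cancel, Real.rpow_zero]
      rw [uF]
      linear_combination (1 - x) * ext (c.uOp h) x * this
    rw [this, abs_mul, abs_of_pos (Dom.pos' hx)]
    exact mul_le_mul (by linarith [hx.1]) (abs_ext_le _ _) (abs_nonneg _) (by norm_num)
  have b1 : ∀ x ∈ Dom, |(1 + x) ^ (1 + ε) * deriv (uF ε (c.uOp h)) x| ≤ ‖h‖ := fun x hx => by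
    rw [e1 hx, hF, ← mul_assoc, ← Real.rpow_add (Dom.pos hx)]
    have : 1 + ε + (-1 - ε) = 0 := by ring
    rw [this, Real.rpow_zero, one_mul]
    exact abs_ext_le _ _
  have b2 : ∀ x ∈ Dom, |(1 + x) ^ (2 + ε) * deriv (deriv (uF ε (c.uOp h))) x| ≤
      ‖g‖ + 2 * ‖h‖ := fun x hx => by
    have h0 := Dom.pos hx
    have : (1 + x) ^ (2 + ε) * deriv (deriv (uF ε (c.uOp h))) x = ext g x - (1 + a) * ext h x := by
      have e3 : (1 + x) ^ (2 + ε) * (1 + x) ^ (-1 - ε) = 1 + x := by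
        rw [← Real.rpow_add h0]
        have : 2 + ε + (-1 - ε) = 1 := by ring
        rw [this, Real.rpow_one]
      rw [e2 hx]
      simp only [hF]
      rw [← mul_div_assoc, div_eq_iff h0.ne']
      linear_combination (ext g x - (1 + a) * ext h x) * e3
    rw [this]
    refine (abs_sub _ _).trans (add_le_add (abs_ext_le _ _) ?_)
    rw [abs_mul, abs_of_pos (by linarith [c.nonneg])]
    exact mul_le_mul (by linarith [c.lt, c.half]) (abs_ext_le _ _) (abs_nonneg _) (by norm_num)
  obtain ⟨w0, s0⟩ := wSup_le_of_mem (by positivity) b0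
  obtain ⟨w1, s1⟩ := wSup_le_of_mem (norm_nonneg h) b1
  obtain ⟨w2, s2⟩ := wSup_le_of_mem (by positivity) b2
  refine ⟨⟨fun x hx => uF_of_notMem _ hx, ?_, ?_, w0, w1, w2⟩, ?_⟩
  · exact contDiffOn_one_Ioc (hR.continuousOn_tailInt.neg.congr e0)
      (fun x hx => hH hx ▸ c.hasDerivAt_uF h hx) hc
  · refine contDiffOn_two_of_hasDerivAt isOpen_Ioo (fun x hx => c.hasDerivAt_uF h hx) hh ?_
    exact ((continuousOn_hF g).sub (continuousOn_const.mul (continuousOn_hF h))).div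
      (by fun_prop) fun x hx => (Dom.pos hx).ne'
  · exact add_le_add (add_le_add s0 s1) s2

theorem continuousOn_tOp (g : BddFun) : ContinuousOn (fun x => (1 + x) ^ (-(1 + a)) *
    (c.tConst g - tailInt (fun s => (1 + s) ^ (-1 - (ε - a)) * ext g s) x)) (Ioc (-1) 1) :=
  (continuousOn_rpow_weight _).mul
    (continuousOn_const.sub (regAtOne_tOp (ε := ε) (a := a) g).continuousOn_tailInt)

/-- The solution operator `g ↦ u` of `(1+x) u'' + (1+a) u' = g`, `u(0) = u(1) = 0`. -/
noncomputable def phiOp : BddFun →L[ℝ] M2 ε :=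
  LinearMap.mkContinuous
    { toFun := fun g => (⟨uF ε (c.uOp (c.tOp g)), (c.mem_M2Sub (fun _ hx => c.hasDerivAt_hF g hx)
        (fun _ hx => c.hF_tOp g hx) (c.continuousOn_tOp g)).1⟩ : M2Sub ε)
      map_add' := fun f g => Subtype.ext <| funext fun x => by
        change uF ε _ x = uF ε _ x + uF ε _ x
        simp only [uF, map_add, ext_add, mul_add]
      map_smul' := fun k g => Subtype.ext <| funext fun x => by
        change uF ε _ x = k * uF ε _ x
        simp only [uF, map_smul, ext_smul, mul_left_comm] }
    (2 * ‖c.uOp.comp c.tOp‖ + ‖c.tOp‖ + (1 + 2 * ‖c.tOp‖)) fun g => by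
      refine (c.mem_M2Sub (fun _ hx => c.hasDerivAt_hF g hx)
        (fun _ hx => c.hF_tOp g hx) (c.continuousOn_tOp g)).2.trans ?_
      have h1 := (c.uOp.comp c.tOp).le_opNorm g
      have h2 := c.tOp.le_opNorm g
      rw [ContinuousLinearMap.comp_apply] at h1
      linarith

theorem phiOp_apply (g : BddFun) : (c.phiOp g : ℝ → ℝ) = uF ε (c.uOp (c.tOp g)) := rfl

theorem hasDerivAt_qFun {x : ℝ} (hx : x ∈ Dom) : HasDerivAt (hF ε c.qFun)
    ((hF ε 0 x - (1 + a) * hF ε c.qFun x) / (1 + x)) x := by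
  have h1 := (hasDerivAt_rpow_weight (-(1 + a)) hx).neg
  refine (h1.congr_of_eventuallyEq (eventuallyEq_of_mem (Dom.nhds hx)
    fun y hy => c.hF_qFun hy)).congr_deriv ?_
  have h0 := Dom.pos hx
  have e1 : (1 + x) ^ (-(1 + a) - 1) * (1 + x) = (1 + x) ^ (-(1 + a)) := by
    rw [← Real.rpow_add_one h0.ne', sub_add_cancel]
  rw [c.hF_qFun hx, eq_div_iff h0.ne', hF, ext_zero]
  linear_combination (1 + a) * e1

theorem mem_M2Sub_qFun : uF ε (c.uOp c.qFun) ∈ M2Sub ε ∧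
    normM2 ε (uF ε (c.uOp c.qFun)) ≤ 2 * ‖c.uOp c.qFun‖ + ‖c.qFun‖ + (‖(0 : BddFun)‖ +
      2 * ‖c.qFun‖) :=
  c.mem_M2Sub (fun _ hx => c.hasDerivAt_qFun hx) (fun _ hx => c.hF_qFun hx)
    (continuousOn_rpow_weight _).neg

/-- The kernel element `∫_x^1 (1+t)^{-1-a} dt` of `M₂(ε)`. -/
noncomputable def kerElt : M2 ε := (⟨uF ε (c.uOp c.qFun), c.mem_M2Sub_qFun.1⟩ : M2Sub ε)

theorem kerElt_apply : (c.kerElt : ℝ → ℝ) = uF ε (c.uOp c.qFun) := rfl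

/-- The derivative of an element of `M₂(ε)`, with weight. -/
noncomputable def hHat (ε : ℝ) : M2 ε →L[ℝ] BddFun :=
  mkOp (fun u x => (1 + x) ^ (1 + ε) * deriv (u : ℝ → ℝ) x) 1 zero_le_one
    (fun u => (continuousOn_rpow_dom _).mul
      (u.2.2.2.1.continuousOn_deriv_of_isOpen isOpen_Ioo (by norm_num)))
    (fun u v x hx => by
      have : deriv ((u + v : M2 ε) : ℝ → ℝ) x = deriv (u : ℝ → ℝ) x + deriv (v : ℝ → ℝ) x :=
        deriv_add_on isOpen_Ioo (u.2.2.2.1.differentiableOn (by norm_num))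
          (v.2.2.2.1.differentiableOn (by norm_num)) x hx
      rw [this, mul_add])
    (fun k u x hx => by
      have : deriv ((k • u : M2 ε) : ℝ → ℝ) x = k * deriv (u : ℝ → ℝ) x :=
        deriv_smul_on (s := Dom) (f := u.1) k x hx
      rw [this, mul_left_comm])
    (fun u x hx => by
      rw [one_mul]
      refine (le_wSup u.2.2.2.2.2.1 hx).trans ?_
      change _ ≤ normM2 ε u.1
      rw [normM2]
      have h1 : 0 ≤ wSup (Ioo (-1) 1) (fun x => (1 + x) ^ ε) u.1 := wSup_nonneg
      have h2 : 0 ≤ wSup (Ioo (-1) 1) (fun x => (1 + x) ^ (2 + ε)) (deriv (deriv u.1)) :=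
        wSup_nonneg
      linarith)

theorem hF_hHat (u : M2 ε) {x : ℝ} (hx : x ∈ Dom) : hF ε (hHat ε u) x = deriv (u : ℝ → ℝ) x := by
  rw [hF, hHat, ext_mkOp u hx, ← mul_assoc, ← Real.rpow_add (Dom.pos hx)]
  have : -1 - ε + (1 + ε) = 0 := by ring
  rw [this, Real.rpow_zero, one_mul]

theorem hasDerivAt_M2 (u : M2 ε) {x : ℝ} (hx : x ∈ Dom) :
    HasDerivAt (u : ℝ → ℝ) (hF ε (hHat ε u) x) x := by
  rw [hF_hHat u hx]
  exact ((u.2.2.2.1.differentiableOn (by norm_num)).differentiableAt (Dom.nhds hx)).hasDerivAt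

/-- An element of `M₂` vanishes at `1`, so it is minus the tail integral of its derivative. Hence
`hHat` is injective, and identities in `M₂` can be checked on derivatives. -/
theorem eq_uF (u : M2 ε) : (u : ℝ → ℝ) = uF ε (c.uOp (hHat ε u)) := by
  funext x
  by_cases hx : x ∈ Dom
  · have h1 := eqOn_tailInt (f := fun x => -(u : ℝ → ℝ) x) (d := hF ε (hHat ε u))
      (u.2.2.1.continuousOn.neg) (fun x hx => (hasDerivAt_M2 u hx).neg) (regAtOne_hF _)
      (by rw [u.2.1 1 (by simp), neg_zero]) ⟨hx.1, hx.2.le⟩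
    rw [c.uF_uOp _ hx, ← h1, neg_neg]
  · rw [uF_of_notMem _ hx, u.2.1 x hx]

theorem evOp_hHat (u : M2 ε) : c.evOp (hHat ε u) = (u : ℝ → ℝ) 0 := by
  rw [evOp_apply, c.eq_uF u]; simp [uF]

theorem hHat_eq {u : M2 ε} {h : BddFun} (hu : (u : ℝ → ℝ) = uF ε (c.uOp h)) : hHat ε u = h :=
  BddFun.ext' fun x hx => by
    have h1 : hF ε (hHat ε u) x = hF ε h x := by
      rw [hF_hHat u hx, hu, (c.hasDerivAt_uF h hx).deriv]
    exact mul_left_cancel₀ (rpow_dom_pos _ hx).ne' h1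

theorem hHat_phiOp (g : BddFun) : hHat ε (c.phiOp g) = c.tOp g := c.hHat_eq (c.phiOp_apply g)

theorem hHat_kerElt : hHat ε c.kerElt = c.qFun := c.hHat_eq c.kerElt_apply

theorem M2_ext (c : Admissible ε a) {u v : M2 ε} (h : hHat ε u = hHat ε v) : u = v :=
  Subtype.ext (by rw [c.eq_uF u, c.eq_uF v, h])

/-- The second derivative of `(1-x) y` involves `z'`, which the equation expresses through `ζ` and
`z`. On `(0,1)` the weights at `-1` are harmless. -/
theorem mem_M1Sub (ζ : BddFun) :
    (fun x => (1 - x) * yF ε (c.yOp (c.zOp ζ)) x) ∈ M1Sub ε ∧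
      normM1 ε (fun x => (1 - x) * yF ε (c.yOp (c.zOp ζ)) x) ≤ 2 * ‖c.yOp (c.zOp ζ)‖ +
        (2 * ‖c.zOp ζ‖ + 2 * ‖c.yOp (c.zOp ζ)‖) + (‖ζ‖ + 4 * ‖c.zOp ζ‖) := by
  set z := c.zOp ζ with hz
  set y := c.yOp z with hy
  have hyd : ∀ x ∈ Dom, HasDerivAt (yF ε y) (zF ε z x) x := fun x hx => c.hasDerivAt_yF z hx
  have hzd : ∀ x ∈ Dom, HasDerivAt (zF ε z) ((zF ε ζ x - (1 + a) * zF ε z x) / (1 + x)) x :=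
    fun x hx => c.hasDerivAt_zF ζ hx
  have d1 : ∀ x ∈ Dom, HasDerivAt (fun x => (1 - x) * yF ε y x)
      ((1 - x) * zF ε z x - yF ε y x) x := fun x hx => by
    refine (((hasDerivAt_id x).const_sub 1).mul (hyd x hx)).congr_deriv ?_
    simp only [id]; ring
  have d2 : ∀ x ∈ Dom, HasDerivAt (fun x => (1 - x) * zF ε z x - yF ε y x)
      ((1 - x) * ((zF ε ζ x - (1 + a) * zF ε z x) / (1 + x)) - 2 * zF ε z x) x := fun x hx => by
    refine ((((hasDerivAt_id x).const_sub 1).mul (hzd x hx)).sub (hyd x hx)).congr_deriv ?_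
    simp only [id]; ring
  have e1 : EqOn (deriv fun x => (1 - x) * yF ε y x)
    (fun x => (1 - x) * zF ε z x - yF ε y x) Dom := fun x hx => (d1 x hx).deriv
  have e2 : EqOn (deriv (deriv fun x => (1 - x) * yF ε y x))
      (fun x => (1 - x) * ((zF ε ζ x - (1 + a) * zF ε z x) / (1 + x)) - 2 * zF ε z x) Dom :=
    fun x hx => by
      rw [(eventuallyEq_of_mem (Dom.nhds hx) e1).deriv_eq, (d2 x hx).deriv]
  have hhead := continuousOn_headInt (c.intervalIntegrable_zF z)
  have e0 : EqOn (fun x => (1 - x) * yF ε y x) (fun x => (1 - x) * headInt (zF ε z) x)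
      (Icc (-1) 1) := fun x hx => by
    rcases hx.1.eq_or_lt with rfl | h1
    · simp [yF_of_notMem]
    · rcases hx.2.lt_or_eq with h2 | rfl
      · simp only [hy, c.yF_yOp z ⟨h1, h2⟩]
      · simp
  have cw : ContinuousOn (fun x => (1 - x) * yF ε y x) (Icc (-1) 1) :=
    ((continuousOn_const.sub continuousOn_id).mul hhead).congr e0
  have cz : ContinuousOn (fun x => (1 + x) ^ (-(1 + a)) *
      headInt (fun s => (1 + s) ^ (a - 2 * ε) * ext ζ s) x) (Ioc (-1) 1) :=
    (continuousOn_rpow_weight _).mul ((continuousOn_headInt (intervalIntegrable_weight_ext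
      (by linarith [c.nonneg, c.half]) ζ)).mono Ioc_subset_Icc_self)
  have b0 : ∀ x ∈ Dom, |(1 + x) ^ (-1 + 2 * ε) * ((1 - x) * yF ε y x)| ≤ 2 * ‖y‖ := fun x hx => by
    have : (1 + x) ^ (-1 + 2 * ε) * ((1 - x) * yF ε y x) = (1 - x) * ext y x := by
      have : (1 + x) ^ (-1 + 2 * ε) * (1 + x) ^ (1 - 2 * ε) = 1 := by
        rw [← Real.rpow_add (Dom.pos hx)]
        have : -1 + 2 * ε + (1 - 2 * ε) = 0 := by ring
        rw [this, Real.rpow_zero]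
      rw [yF]
      linear_combination (1 - x) * ext y x * this
    rw [this, abs_mul, abs_of_pos (Dom.pos' hx)]
    exact mul_le_mul (by linarith [hx.1]) (abs_ext_le _ _) (abs_nonneg _) (by norm_num)
  have b1 : ∀ x ∈ Dom, |(1 + x) ^ (2 * ε) * deriv (fun x => (1 - x) * yF ε y x) x| ≤
      2 * ‖z‖ + 2 * ‖y‖ := fun x hx => by
    have h0 := Dom.pos hx
    have : (1 + x) ^ (2 * ε) * deriv (fun x => (1 - x) * yF ε y x) x =
        (1 - x) * ext z x - (1 + x) * ext y x := by
      have t1 : (1 + x) ^ (2 * ε) * (1 + x) ^ (-2 * ε) = 1 := by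
        rw [← Real.rpow_add h0]
        have : 2 * ε + -2 * ε = 0 := by ring
        rw [this, Real.rpow_zero]
      have t2 : (1 + x) ^ (2 * ε) * (1 + x) ^ (1 - 2 * ε) = 1 + x := by
        rw [← Real.rpow_add h0]
        have : 2 * ε + (1 - 2 * ε) = 1 := by ring
        rw [this, Real.rpow_one]
      rw [e1 hx]
      simp only [yF, zF]
      linear_combination (1 - x) * ext z x * t1 - ext y x * t2
    rw [this]
    refine (abs_sub _ _).trans (add_le_add ?_ ?_)
    · rw [abs_mul, abs_of_pos (Dom.pos' hx)]
      exact mul_le_mul (by linarith [hx.1]) (abs_ext_le _ _) (abs_nonneg _) (by norm_num)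
    · rw [abs_mul, abs_of_pos h0]
      exact mul_le_mul (by linarith [hx.2]) (abs_ext_le _ _) (abs_nonneg _) (by norm_num)
  have b2 : ∀ x ∈ Ioo (0 : ℝ) 1, |1 * deriv (deriv fun x => (1 - x) * yF ε y x) x| ≤
      ‖ζ‖ + 4 * ‖z‖ := fun x hx => by
    have hxD : x ∈ Dom := ⟨by linarith [hx.1], hx.2⟩
    have h0 := Dom.pos hxD
    have hw : ∀ f : BddFun, |zF ε f x| ≤ ‖f‖ := fun f => by
      rw [zF, abs_mul, abs_of_pos (rpow_dom_pos _ hxD)]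
      have : (1 + x) ^ (-2 * ε) ≤ 1 :=
        Real.rpow_le_one_of_one_le_of_nonpos (by linarith [hx.1]) (by linarith [c.pos])
      calc _ ≤ 1 * ‖f‖ := mul_le_mul this (abs_ext_le _ _) (abs_nonneg _) zero_le_one
        _ = _ := one_mul _
    have h1 : |zF ε ζ x - (1 + a) * zF ε z x| ≤ ‖ζ‖ + 2 * ‖z‖ := by
      refine (abs_sub _ _).trans (add_le_add (hw _) ?_)
      rw [abs_mul, abs_of_pos (by linarith [c.nonneg])]
      exact mul_le_mul (by linarith [c.lt, c.half]) (hw _) (abs_nonneg _) (by norm_num)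
    have h2 : |(1 - x) * ((zF ε ζ x - (1 + a) * zF ε z x) / (1 + x))| ≤ ‖ζ‖ + 2 * ‖z‖ := by
      rw [mul_div_assoc', mul_div_right_comm, abs_mul]
      have : |(1 - x) / (1 + x)| ≤ 1 := by
        rw [abs_of_pos (div_pos (Dom.pos' hxD) h0), div_le_one h0]
        linarith [hx.1]
      calc _ ≤ 1 * (‖ζ‖ + 2 * ‖z‖) := mul_le_mul this h1 (abs_nonneg _) zero_le_one
        _ = _ := one_mul _
    rw [one_mul, e2 hxD]
    refine (abs_sub _ _).trans ?_
    rw [abs_mul 2, abs_two]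
    linarith [hw z]
  obtain ⟨w0, s0⟩ := wSup_le_of_mem (by positivity) b0
  obtain ⟨w1, s1⟩ := wSup_le_of_mem (by positivity) b1
  obtain ⟨w2, s2⟩ := wSup_le_of_mem (by positivity) b2
  refine ⟨⟨fun x hx => by simp [yF_of_notMem y hx], cw, ?_, ?_, w0, w1, w2⟩, ?_⟩
  · refine contDiffOn_one_Ioc (h := fun x => (1 - x) * ((1 + x) ^ (-(1 + a)) *
      headInt (fun s => (1 + s) ^ (a - 2 * ε) * ext ζ s) x) - headInt (zF ε z) x)
      (cw.mono Ioc_subset_Icc_self) (fun x hx => ?_) ?_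
    · rw [← c.zF_zOp ζ hx, ← c.yF_yOp z hx]
      exact d1 x hx
    · exact ((continuousOn_const.sub continuousOn_id).mul cz).sub (hhead.mono Ioc_subset_Icc_self)
  · refine (contDiffOn_two_of_hasDerivAt isOpen_Ioo d1 d2 ?_).mono
      (Ioo_subset_Ioo_left (by norm_num))
    refine ContinuousOn.sub (ContinuousOn.mul (by fun_prop) (ContinuousOn.div ?_ (by fun_prop)
      fun x hx => (Dom.pos hx).ne')) (continuousOn_const.mul (continuousOn_zF z))
    exact (continuousOn_zF ζ).sub (continuousOn_const.mul (continuousOn_zF z))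
  · exact add_le_add (add_le_add s0 s1) s2

/-- The operator `ζ ↦ (1-x) ∫_{-1}^x z`, where `(1+x) z' + (1+a) z = ζ`. -/
noncomputable def thetaOp : BddFun →L[ℝ] M1 ε :=
  LinearMap.mkContinuous
    { toFun := fun ζ => (⟨fun x => (1 - x) * yF ε (c.yOp (c.zOp ζ)) x, (c.mem_M1Sub ζ).1⟩ :
        M1Sub ε)
      map_add' := fun f g => Subtype.ext <| funext fun x => by
        change (1 - x) * yF ε _ x = (1 - x) * yF ε _ x + (1 - x) * yF ε _ x
        simp only [yF, map_add, ext_add, mul_add]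
      map_smul' := fun k g => Subtype.ext <| funext fun x => by
        change (1 - x) * yF ε _ x = k * ((1 - x) * yF ε _ x)
        simp only [yF, map_smul, ext_smul, mul_left_comm] }
    (2 * ‖c.yOp.comp c.zOp‖ + (2 * ‖c.zOp‖ + 2 * ‖c.yOp.comp c.zOp‖) + (1 + 4 * ‖c.zOp‖))
    fun g => by
      refine (c.mem_M1Sub g).2.trans ?_
      have h1 := (c.yOp.comp c.zOp).le_opNorm g
      have h2 := c.zOp.le_opNorm g
      rw [ContinuousLinearMap.comp_apply] at h1
      linarith

theorem thetaOp_apply (ζ : BddFun) :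
    (c.thetaOp ζ : ℝ → ℝ) = fun x => (1 - x) * yF ε (c.yOp (c.zOp ζ)) x := rfl

/-! ### Recovering an element of `M₁` from the derivative of `w/(1-x)` -/

section M1

theorem normM1_bounds (w : M1 ε) :
    (∀ x ∈ Dom, |(1 + x) ^ (-1 + 2 * ε) * w x| ≤ ‖w‖) ∧
    (∀ x ∈ Dom, |(1 + x) ^ (2 * ε) * deriv (w : ℝ → ℝ) x| ≤ ‖w‖) ∧
    (∀ x ∈ Ioo (0 : ℝ) 1, |deriv (deriv (w : ℝ → ℝ)) x| ≤ ‖w‖) := by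
  have h1 : 0 ≤ wSup (Ioo (-1) 1) (fun x => (1 + x) ^ (-1 + 2 * ε)) w.1 := wSup_nonneg
  have h2 : 0 ≤ wSup (Ioo (-1) 1) (fun x => (1 + x) ^ (2 * ε)) (deriv w.1) := wSup_nonneg
  have h3 : 0 ≤ wSup (Ioo 0 1) (fun _ => 1) (deriv (deriv w.1)) := wSup_nonneg
  have e : ‖w‖ = normM1 ε w.1 := rfl
  rw [e, normM1]
  refine ⟨fun x hx => (le_wSup w.2.2.2.2.2.1 hx).trans (by linarith),
    fun x hx => (le_wSup w.2.2.2.2.2.2.1 hx).trans (by linarith), fun x hx => ?_⟩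
  have := le_wSup w.2.2.2.2.2.2.2 hx
  rw [one_mul] at this
  linarith

theorem differentiableAt_M1 (w : M1 ε) {x : ℝ} (hx : x ∈ Dom) : DifferentiableAt ℝ w.1 x :=
  ((w.2.2.2.1.differentiableOn (by norm_num)).mono Ioo_subset_Ioc_self).differentiableAt
    (Dom.nhds hx)

/-- The derivative of `w / (1 - x)` times `(1 - x)²`. -/
theorem abs_wronskian_le (c : Admissible ε a) (w : M1 ε) {x : ℝ} (hx : x ∈ Ioo (0 : ℝ) 1) :
    |(1 - x) * deriv (w : ℝ → ℝ) x + w x| ≤ ‖w‖ * (1 - x) ^ 2 := by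
  obtain ⟨-, hb1, hb2⟩ := normM1_bounds w
  have hD : ∀ y ∈ Ioo (0 : ℝ) 1, HasDerivAt
      (fun x => (1 - x) * deriv (w : ℝ → ℝ) x + (w : ℝ → ℝ) x)
      ((1 - y) * deriv (deriv (w : ℝ → ℝ)) y) y := fun y hy => by
    have hyD : y ∈ Dom := ⟨by linarith [hy.1], hy.2⟩
    have h1 : DifferentiableAt ℝ (deriv (w : ℝ → ℝ)) y :=
      (((contDiffOn_succ_iff_deriv_of_isOpen (n := 1) isOpen_Ioo).1
        (by simpa [one_add_one_eq_two] using w.2.2.2.2.1)).2.2.differentiableOn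
        (by norm_num)).differentiableAt (isOpen_Ioo.mem_nhds hy)
    refine ((((hasDerivAt_id y).const_sub 1).mul h1.hasDerivAt).add
      (differentiableAt_M1 w hyD).hasDerivAt).congr_deriv ?_
    simp only [id]; ring
  -- The expression has derivative `(1-s) w''(s)`, at most `(1-x)‖w‖` on `[x,y]`, an interval
  -- shorter than `1-x`. Its value at `y` disappears as `y → 1`, since `w'` is bounded near `1` and
  -- `w(1) = 0`.
  have hle : ∀ y ∈ Ioo x 1, |(1 - x) * deriv (w : ℝ → ℝ) x + w x| ≤
      ((1 - y) * ‖w‖ + |(w : ℝ → ℝ) y|) + ‖w‖ * (1 - x) ^ 2 := fun y hy => by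
    have hyD : y ∈ Dom := ⟨by linarith [hx.1, hy.1], hy.2⟩
    have h1 := Convex.norm_image_sub_le_of_norm_hasDerivWithin_le (C := (1 - x) * ‖w‖)
      (s := Icc x y) (x := x) (y := y)
      (fun s hs => (hD s ⟨by linarith [hs.1, hx.1], by linarith [hs.2, hy.2]⟩).hasDerivWithinAt)
      (fun s hs => by
        rw [Real.norm_eq_abs, abs_mul, abs_of_pos (by linarith [hs.2, hy.2])]
        exact mul_le_mul (by linarith [hs.1])
          (hb2 s ⟨by linarith [hs.1, hx.1], by linarith [hs.2, hy.2]⟩) (abs_nonneg _)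
          (by linarith [hx.2])) (convex_Icc x y) ⟨le_rfl, hy.1.le⟩ ⟨hy.1.le, le_rfl⟩
    rw [Real.norm_eq_abs, Real.norm_eq_abs, abs_of_pos (show 0 < y - x by linarith [hy.1])] at h1
    have h2 : (1 - x) * ‖w‖ * (y - x) ≤ ‖w‖ * (1 - x) ^ 2 := by
      have : (1 - x) * ‖w‖ * (y - x) ≤ (1 - x) * ‖w‖ * (1 - x) :=
        mul_le_mul_of_nonneg_left (by linarith [hy.2])
          (mul_nonneg (by linarith [hx.2]) (norm_nonneg _))
      linarith
    have h3 : |deriv (w : ℝ → ℝ) y| ≤ ‖w‖ := by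
      have h4 := hb1 y hyD
      rw [abs_mul, abs_of_pos (rpow_dom_pos _ hyD)] at h4
      have h5 : 1 ≤ (1 + y) ^ (2 * ε) :=
        Real.one_le_rpow (by linarith [hx.1, hy.1]) (by linarith [c.pos])
      exact (le_mul_of_one_le_left (abs_nonneg _) h5).trans h4
    have h6 : |(1 - y) * deriv (w : ℝ → ℝ) y + (w : ℝ → ℝ) y| ≤
        (1 - y) * ‖w‖ + |(w : ℝ → ℝ) y| := by
      refine (abs_add_le _ _).trans (add_le_add ?_ le_rfl)
      rw [abs_mul, abs_of_pos (Dom.pos' hyD)]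
      exact mul_le_mul_of_nonneg_left h3 (Dom.pos' hyD).le
    have h7 := abs_sub_abs_le_abs_sub ((1 - x) * deriv (w : ℝ → ℝ) x + w x)
      ((1 - y) * deriv (w : ℝ → ℝ) y + (w : ℝ → ℝ) y)
    rw [abs_sub_comm] at h7
    linarith
  have hw1 : Tendsto (w : ℝ → ℝ) (𝓝[<] 1) (𝓝 0) := by
    have h1 := w.2.2.1 1 ⟨by norm_num, le_rfl⟩
    rw [ContinuousWithinAt, w.2.1 1 (by simp)] at h1
    exact h1.mono_left (nhdsWithin_le_of_mem (mem_of_superset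
      (Ioo_mem_nhdsLT (show (-1 : ℝ) < 1 by norm_num)) Ioo_subset_Icc_self))
  have ht : Tendsto (fun y => ((1 - y) * ‖w‖ + |(w : ℝ → ℝ) y|) + ‖w‖ * (1 - x) ^ 2) (𝓝[<] 1)
      (𝓝 (((1 - 1) * ‖w‖ + |0|) + ‖w‖ * (1 - x) ^ 2)) := by
    refine ((Tendsto.mul_const _ ?_).add hw1.abs).add_const _
    exact (tendsto_id.mono_left nhdsWithin_le_nhds).const_sub 1
  have := ge_of_tendsto ht (by filter_upwards [Ioo_mem_nhdsLT hx.2] with y hy using hle y hy)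
  simpa using this

/-- The derivative of `w / (1 - x)`, with weight. -/
noncomputable def zHat (c : Admissible ε a) : M1 ε →L[ℝ] BddFun :=
  mkOp (fun w x => (1 + x) ^ (2 * ε) * (((1 - x) * deriv (w : ℝ → ℝ) x + w x) / (1 - x) ^ 2)) 2
    zero_le_two
    (fun w => by
      have h1 : ContDiffOn ℝ 1 w.1 Dom := w.2.2.2.1.mono Ioo_subset_Ioc_self
      refine (continuousOn_rpow_dom _).mul (ContinuousOn.div (ContinuousOn.add
        (ContinuousOn.mul (by fun_prop) (h1.continuousOn_deriv_of_isOpen isOpen_Ioo (by norm_num)))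
        h1.continuousOn) (by fun_prop) fun x hx => (pow_pos (Dom.pos' hx) 2).ne'))
    (fun u v x hx => by
      have h1 : deriv ((u + v : M1 ε) : ℝ → ℝ) x = deriv (u : ℝ → ℝ) x + deriv (v : ℝ → ℝ) x :=
        deriv_add (differentiableAt_M1 u hx) (differentiableAt_M1 v hx)
      have h2 : ((u + v : M1 ε) : ℝ → ℝ) x = u x + v x := rfl
      rw [h1, h2]; ring)
    (fun k u x hx => by
      have h1 : deriv ((k • u : M1 ε) : ℝ → ℝ) x = k * deriv (u : ℝ → ℝ) x :=
        deriv_smul_on (s := Dom) (f := u.1) k x hx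
      have h2 : ((k • u : M1 ε) : ℝ → ℝ) x = k * u x := rfl
      rw [h1, h2]; ring)
    (fun w x hx => by
      obtain ⟨hb0, hb1, -⟩ := normM1_bounds w
      have h0 := Dom.pos hx
      have hw := rpow_dom_pos (2 * ε) hx
      -- For `x ≤ 0` the denominator is at least `1` and the two weighted bounds of the norm
      -- suffice. For `x > 0` the numerator is `O((1-x)²)`, which uses the bound on `w''`.
      rcases le_or_gt x 0 with hx0 | hx0
      · have e1 : (1 + x) ^ (2 * ε) * w x = (1 + x) * ((1 + x) ^ (-1 + 2 * ε) * w x) := by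
          rw [Real.rpow_add h0, Real.rpow_neg_one]
          field_simp
        have h1 : |(1 + x) ^ (2 * ε) * w x| ≤ ‖w‖ := by
          rw [e1, abs_mul, abs_of_pos h0]
          calc _ ≤ 1 * ‖w‖ := mul_le_mul (by linarith) (hb0 x hx) (abs_nonneg _) zero_le_one
            _ = _ := one_mul _
        have h3 : (1 : ℝ) ≤ (1 - x) ^ 2 := one_le_pow₀ (by linarith)
        have h4 : |(1 - x) * ((1 + x) ^ (2 * ε) * deriv (w : ℝ → ℝ) x)| ≤ (1 - x) * ‖w‖ := by
          rw [abs_mul, abs_of_pos (Dom.pos' hx)]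
          exact mul_le_mul_of_nonneg_left (hb1 x hx) (Dom.pos' hx).le
        have h5 : (1 - x) ≤ (1 - x) ^ 2 := by nlinarith
        rw [mul_div_assoc', abs_div, abs_of_pos (pow_pos (Dom.pos' hx) 2),
          div_le_iff₀ (pow_pos (Dom.pos' hx) 2)]
        calc _ = |(1 - x) * ((1 + x) ^ (2 * ε) * deriv (w : ℝ → ℝ) x) + (1 + x) ^ (2 * ε) * w x| :=
              by congr 1; ring
          _ ≤ (1 - x) * ‖w‖ + ‖w‖ := (abs_add_le _ _).trans (add_le_add h4 h1)
          _ ≤ (1 - x) ^ 2 * ‖w‖ + (1 - x) ^ 2 * ‖w‖ := by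
              have := norm_nonneg w
              gcongr
              exact le_mul_of_one_le_left this h3
          _ = _ := by ring
      · have h1 := abs_wronskian_le c w ⟨hx0, hx.2⟩
        rw [abs_mul, abs_of_pos hw, abs_div, abs_of_pos (pow_pos (Dom.pos' hx) 2)]
        refine mul_le_mul ?_ ((div_le_iff₀ (pow_pos (Dom.pos' hx) 2)).2 h1) (by positivity)
          zero_le_two
        calc (1 + x) ^ (2 * ε) ≤ (1 + x) ^ (1 : ℝ) :=
              Real.rpow_le_rpow_of_exponent_le (by linarith) (by linarith [c.half])
          _ ≤ 2 := by rw [Real.rpow_one]; linarith [hx.2])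

theorem zF_zHat (c : Admissible ε a) (w : M1 ε) {x : ℝ} (hx : x ∈ Dom) : zF ε (c.zHat w) x =
    ((1 - x) * deriv (w : ℝ → ℝ) x + w x) / (1 - x) ^ 2 := by
  rw [zF, zHat, ext_mkOp w hx, ← mul_assoc, ← Real.rpow_add (Dom.pos hx)]
  have : -2 * ε + 2 * ε = 0 := by ring
  rw [this, Real.rpow_zero, one_mul]

/-- Since `w(-1) = 0`, the quotient `w/(1-x)` tends to `0` at `-1` and is the integral of its
derivative from there. -/
theorem eq_yF (w : M1 ε) : (w : ℝ → ℝ) = fun x => (1 - x) * yF ε (c.yOp (c.zHat w)) x := by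
  funext x
  by_cases hx : x ∈ Dom
  · have ht : Tendsto (fun x => (w : ℝ → ℝ) x / (1 - x)) (𝓝[>] (-1)) (𝓝 0) := by
      have h1 := w.2.2.1 (-1) ⟨le_rfl, by norm_num⟩
      rw [ContinuousWithinAt, w.2.1 (-1) (by simp)] at h1
      have h2 : Tendsto (w : ℝ → ℝ) (𝓝[>] (-1)) (𝓝 0) := h1.mono_left (nhdsWithin_le_of_mem
        (mem_of_superset (Ioo_mem_nhdsGT (show (-1 : ℝ) < 1 by norm_num)) Ioo_subset_Icc_self))
      have h3 : Tendsto (fun x : ℝ => 1 - x) (𝓝[>] (-1)) (𝓝 (1 - -1)) :=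
        (tendsto_id.mono_left nhdsWithin_le_nhds).const_sub 1
      have h4 := h2.div h3 (by norm_num)
      rw [zero_div] at h4
      exact h4
    have h1 := eqOn_headInt ht (d := zF ε (c.zHat w)) (fun x hx => by
      rw [c.zF_zHat w hx]
      refine ((differentiableAt_M1 w hx).hasDerivAt.div ((hasDerivAt_id x).const_sub 1)
        (Dom.pos' hx).ne').congr_deriv ?_
      simp only [id]; ring) (continuousOn_zF _) (c.intervalIntegrable_zF _) hx
    simp only [c.yF_yOp _ hx, ← h1]
    rw [mul_div_cancel₀ _ (Dom.pos' hx).ne']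
  · simp only [yF_of_notMem _ hx, mul_zero]
    exact w.2.1 x hx

theorem M1_ext {w v : M1 ε} (h : c.zHat w = c.zHat v) : w = v :=
  Subtype.ext (by rw [c.eq_yF w, c.eq_yF v, h])

theorem zHat_thetaOp (ζ : BddFun) : c.zHat (c.thetaOp ζ) = c.zOp ζ := BddFun.ext' fun x hx => by
  have h1 : zF ε (c.zHat (c.thetaOp ζ)) x = zF ε (c.zOp ζ) x := by
    rw [c.zF_zHat _ hx, thetaOp_apply]
    have h2 : HasDerivAt (fun x => (1 - x) * yF ε (c.yOp (c.zOp ζ)) x) _ x :=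
      ((hasDerivAt_id x).const_sub 1).mul (c.hasDerivAt_yF (c.zOp ζ) hx)
    have h0 := (Dom.pos' hx).ne'
    rw [h2.deriv, div_eq_iff (pow_ne_zero 2 h0)]
    simp only [id]; ring
  exact mul_left_cancel₀ (rpow_dom_pos _ hx).ne' h1

end M1

end Admissible

/-! ### The Navier–Stokes system in terms of `z = (w/(1-x))'` and `h = u'` -/

theorem swirlDensity_congr {f g : ℝ → ℝ} (h : EqOn f g Dom) :
    EqOn (swirlDensity f) (swirlDensity g) Dom := fun x hx => by
  rw [swirlDensity, swirlDensity, h hx, (eventuallyEq_of_mem (Dom.nhds hx) h).deriv_eq]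

theorem psiInner_eq (f : ℝ → ℝ) : psiInner f = tailInt (tailInt (swirlDensity f)) := rfl

theorem psi_eq (f : ℝ → ℝ) : psi f = tailInt (psiInner f) := rfl

theorem psiInner_congr {f g : ℝ → ℝ} (h : EqOn f g Dom) : EqOn (psiInner f) (psiInner g) Dom := by
  have h1 : EqOn (tailInt (swirlDensity f)) (tailInt (swirlDensity g)) Dom := fun x hx =>
    tailInt_congr (swirlDensity_congr h) ⟨hx.1.le, hx.2.le⟩
  exact fun x hx => tailInt_congr h1 ⟨hx.1.le, hx.2.le⟩

theorem psi_congr {f g : ℝ → ℝ} (h : EqOn f g Dom) : EqOn (psi f) (psi g) (Icc (-1) 1) :=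
  fun _ hx => tailInt_congr (psiInner_congr h) hx

theorem IsSolution.congr {f f' g g' : ℝ → ℝ} {κ : ℝ} (h : IsSolution f g κ) (hf : EqOn f' f Dom)
    (hg : EqOn g' g Dom) : IsSolution f' g' κ where
  contDiffOn_theta := h.contDiffOn_theta.congr hf
  contDiffOn_phi := h.contDiffOn_phi.congr hg
  integrable t ht := by
    refine (h.integrable t ht).congr_ae ?_
    rw [uIoc_of_le ht.2.le]
    exact ae_restrict_dom (fun x hx => (swirlDensity_congr hg hx).symm) ht.1.le le_rfl
  eq_theta x hx := by
    rw [hf hx, (eventuallyEq_of_mem (Dom.nhds hx) hf).deriv_eq,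
      psi_congr hg ⟨hx.1.le, hx.2.le⟩]
    exact h.eq_theta x hx
  eq_phi x hx := by
    rw [hf hx, (eventuallyEq_of_mem (Dom.nhds hx) hg).deriv_eq,
      (eventuallyEq_of_mem (Dom.nhds hx) hg).deriv.deriv_eq]
    exact h.eq_phi x hx

namespace Admissible

variable {ε a : ℝ} (c : Admissible ε a)

/-! ### The kernel element and `V²_μ` -/

section Kernel

variable {μ : ℝ}

/-- The integrand is `(1+a)/(1+s)`, the factor `1-s` cancelling. Hence `e^{-b_μ}` is the power
`(1+x)^{-1-a}`. -/
theorem bFun_eq (ha : √(1 + 2 * μ) = a) {x : ℝ} (hx : x ∈ Dom) :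
    bFun μ x = (1 + a) * Real.log (1 + x) := by
  have hsub : uIcc 0 x ⊆ Dom := (convex_Ioo (-1 : ℝ) 1).ordConnected.uIcc_subset zero_mem_Dom hx
  have h1 : ∀ s ∈ uIcc 0 x, HasDerivAt (fun s => (1 + a) * Real.log (1 + s))
      (Ubar μ s / (1 - s ^ 2)) s := fun s hs => by
    have h0 := Dom.pos (hsub hs)
    have h0' := Dom.pos' (hsub hs)
    refine ((((hasDerivAt_id s).const_add 1).log h0.ne').const_mul (1 + a)).congr_deriv ?_
    have e : 1 - s ^ 2 = (1 - s) * (1 + s) := by ring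
    rw [Ubar, ha, e]
    simp only [id]
    field_simp
  rw [bFun, intervalIntegral.integral_eq_sub_of_hasDerivAt h1]
  · simp
  · apply ContinuousOn.intervalIntegrable
    unfold Ubar
    refine ContinuousOn.div (by fun_prop) (by fun_prop) fun s hs => ?_
    have e : 1 - s ^ 2 = (1 - s) * (1 + s) := by ring
    rw [e]
    exact (mul_pos (Dom.pos' (hsub hs)) (Dom.pos (hsub hs))).ne'

theorem kerElt_eq (ha : √(1 + 2 * μ) = a) {x : ℝ} (hx : x ∈ Ioc (-1 : ℝ) 1) :
    c.kerElt x = V2phi μ x := by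
  have h2 : V2phi μ x = -tailInt (hF ε c.qFun) x := by
    have e : V2phi μ x = tailInt (fun t => Real.exp (-bFun μ t)) x := rfl
    rw [e, tailInt_congr (χ := fun t => (-1) * hF ε c.qFun t) (fun s hs => ?_) ⟨hx.1.le, hx.2⟩,
      tailInt_const_mul]
    · ring
    · simp only [c.hF_qFun hs, bFun_eq ha hs, Real.rpow_def_of_pos (Dom.pos hs)]
      rw [neg_mul_neg, one_mul]
      congr 1; ring
  rw [h2]
  rcases hx.2.lt_or_eq with h1 | rfl
  · exact c.uF_uOp _ ⟨hx.1, h1⟩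
  · rw [tailInt_one, neg_zero]
    exact c.kerElt.2.1 1 (by simp)

theorem kerElt_zero_pos : 0 < c.kerElt 0 := by
  rw [← c.evOp_hHat, hHat_kerElt]; exact c.evOp_qFun_pos

end Kernel

/-! ### The swirl integral `ψ` and the derivative of `ψ/(1-x)²` -/

section Density

/-- The weighted product of `u` and `u'`. -/
noncomputable def prodHat (u : M2 ε) : BddFun := c.uOp (hHat ε u) * hHat ε u

/-- The factor `1-x` contained in `u` cancels the one in `1-x²`, so the density stays bounded at
`1`. -/
theorem swirlDensity_eq (c : Admissible ε a) (u : M2 ε) {x : ℝ} (hx : x ∈ Dom) :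
    swirlDensity u x = 2 * ((1 + x) ^ (-2 - 2 * ε) * ext (c.prodHat u) x) := by
  have h0 := Dom.pos hx
  have h0' := Dom.pos' hx
  have e : (1 + x) ^ (-2 - 2 * ε) * (1 + x) = (1 + x) ^ (-ε) * (1 + x) ^ (-1 - ε) := by
    rw [← Real.rpow_add_one h0.ne', ← Real.rpow_add h0]; congr 1; ring
  have e2 : 1 - x ^ 2 = (1 - x) * (1 + x) := by ring
  rw [swirlDensity, ← hF_hHat u hx, e2, div_eq_iff (mul_pos h0' h0).ne', prodHat, ext_mul]
  have h1 : (u : ℝ → ℝ) x = uF ε (c.uOp (hHat ε u)) x := congrFun (c.eq_uF u) x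
  rw [h1, uF, hF]
  linear_combination (-2 * (1 - x) * ext (c.uOp (hHat ε u)) x * ext (hHat ε u) x) * e

theorem regAtOne_swirlDensity (c : Admissible ε a) (u : M2 ε) : RegAtOne (swirlDensity u) :=
  ((regAtOne_weight_ext 0 (-2 - 2 * ε) (c.prodHat u)).const_mul 2).congr fun x hx => by
    rw [c.swirlDensity_eq u hx]; simp

/-- Each of the two tail integrals raises the exponent `-2-2ε` of the density by one. The final
exponent `-2ε` is integrable at `-1` because `ε < 1/2`, which makes `ψ(-1)` converge. -/
theorem exists_psiInner_bound (c : Admissible ε a) (u : M2 ε) : ∃ C, ∀ x ∈ Dom, |psiInner u x| ≤ C * (1 + x) ^ (-2 * ε) := by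
  have h1 : ∀ x ∈ Dom, |swirlDensity u x| ≤
      (2 * ‖c.prodHat u‖) * ((1 - x) ^ 0 * (1 + x) ^ (-1 - (1 + 2 * ε))) := fun x hx => by
    have e : -1 - (1 + 2 * ε) = -2 - 2 * ε := by ring
    rw [c.swirlDensity_eq u hx, abs_mul, abs_two, e, pow_zero, one_mul, mul_assoc]
    exact mul_le_mul_of_nonneg_left (abs_weight_ext_le _ _ x hx) zero_le_two
  have hε := c.pos
  have h2 : ∀ x ∈ Dom, |tailInt (swirlDensity u) x| ≤ (2 * ‖c.prodHat u‖ * (1 + 1 / (1 + 2 * ε))) *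
      ((1 - x) ^ 1 * (1 + x) ^ (-1 - 2 * ε)) := fun x hx => by
    have := abs_tailInt_le 0 (by positivity) (by positivity) h1 hx
    have e : -(1 + 2 * ε) = -1 - 2 * ε := by ring
    rwa [e] at this
  refine ⟨2 * ‖c.prodHat u‖ * (1 + 1 / (1 + 2 * ε)) * (1 + 1 / (2 * ε)) * 4, fun x hx => ?_⟩
  refine (abs_tailInt_le 1 (by positivity) (by positivity) h2 hx).trans ?_
  have e : -(2 * ε) = -2 * ε := by ring
  rw [mul_assoc _ (4 : ℝ), e]
  have := rpow_dom_pos (-2 * ε) hx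
  have h3 : (1 - x) ^ (1 + 1) ≤ 4 := 
    (pow_le_pow_left₀ (Dom.pos' hx).le (by linarith [hx.1] : 1 - x ≤ 2) _).trans (by norm_num)
  gcongr

theorem intervalIntegrable_psiInner (c : Admissible ε a) (u : M2 ε) : IntervalIntegrable (psiInner u) volume (-1) 1 := by
  obtain ⟨C, hC⟩ := c.exists_psiInner_bound u
  exact intervalIntegrable_head (c.regAtOne_swirlDensity u).tail.tail.cont
    (by linarith [c.half]) hC

theorem tendsto_psi (c : Admissible ε a) (u : M2 ε) : Tendsto (psi u) (𝓝[>] (-1)) (𝓝 (psi u (-1))) := by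
  have hi := c.intervalIntegrable_psiInner u
  have h2 : IntegrableOn (psiInner u) (uIcc (-1) 1) volume := by
    rw [uIcc_of_le (by norm_num), integrableOn_Icc_iff_integrableOn_Ioc]
    exact (intervalIntegrable_iff_integrableOn_Ioc_of_le (by norm_num)).1 hi
  have h1 := intervalIntegral.continuousOn_primitive_interval_left h2
  rw [uIcc_of_le (by norm_num)] at h1
  exact (h1 (-1) ⟨le_rfl, by norm_num⟩).mono_left (nhdsWithin_le_of_mem
    (mem_of_superset (Ioo_mem_nhdsGT (show (-1 : ℝ) < 1 by norm_num)) Ioo_subset_Icc_self))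

/-- This is the numerator of `(ψ/(1-x)²)'`. Integration by parts, done twice, rewrites it as minus a
double tail integral of `(1-s)` times the density. This exhibits the factor `(1-x)³` needed to
divide. -/
theorem two_mul_psi_sub (c : Admissible ε a) (u : M2 ε) {x : ℝ} (hx : x ∈ Dom) : 2 * psi u x - (1 - x) * psiInner u x =
    (1 - x) ^ 3 * zF ε (c.bOp (c.prodHat u)) x := by
  have hρ := c.regAtOne_swirlDensity u
  have hσ : RegAtOne (fun s => (1 - s) * swirlDensity u s) :=
    hρ.mul_of_bdd (by fun_prop) 2 fun x hx => by
      rw [abs_of_pos (Dom.pos' hx)]; linarith [hx.1]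
  have c1 : ContinuousOn (fun x : ℝ => 1 - x) (Ioc (-1) 1) := by fun_prop
  have h1 : EqOn (fun x => (1 - x) * tailInt (swirlDensity u) x - psiInner u x)
      (tailInt fun s => (1 - s) * swirlDensity u s) (Ioc (-1) 1) := by
    refine eqOn_tailInt ((c1.mul hρ.continuousOn_tailInt).sub hρ.tail.continuousOn_tailInt)
      (fun x hx => ?_) hσ (by simp [psiInner_eq])
    refine ((((hasDerivAt_id x).const_sub 1).mul (hρ.hasDerivAt hx)).sub
      (hρ.tail.hasDerivAt hx)).congr_deriv ?_
    simp only [id]; ring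
  have h2 : EqOn (fun x => (1 - x) * psiInner u x - 2 * psi u x)
      (tailInt (tailInt fun s => (1 - s) * swirlDensity u s)) (Ioc (-1) 1) := by
    refine eqOn_tailInt ((c1.mul hρ.tail.continuousOn_tailInt).sub
      (continuousOn_const.mul hρ.tail.tail.continuousOn_tailInt))
      (fun x hx => ?_) hσ.tail (by simp [psi_eq])
    refine ((((hasDerivAt_id x).const_sub 1).mul (hρ.tail.hasDerivAt hx)).sub
      ((hρ.tail.tail.hasDerivAt hx).const_mul 2)).congr_deriv ?_
    rw [← h1 ⟨hx.1, hx.2.le⟩]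
    simp only [id, psiInner_eq]; ring
  have h3 : EqOn (fun s => (1 - s) * swirlDensity u s)
      (fun s => 2 * ((1 - s) * (1 + s) ^ (-2 - 2 * ε) * ext (c.prodHat u) s)) Dom := fun s hs => by
    simp only [c.swirlDensity_eq u hs]; ring
  have h4 : EqOn (tailInt fun s => (1 - s) * swirlDensity u s)
      (fun x => 2 * tailInt (fun s => (1 - s) * (1 + s) ^ (-2 - 2 * ε) * ext (c.prodHat u) s) x)
      Dom := fun s hs => by
    rw [tailInt_congr h3 ⟨hs.1.le, hs.2.le⟩, tailInt_const_mul]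
  have h5 := h2 ⟨hx.1, hx.2.le⟩
  rw [tailInt_congr h4 ⟨hx.1.le, hx.2.le⟩, tailInt_const_mul] at h5
  rw [c.zF_bOp _ hx]
  linarith

theorem hasDerivAt_psi_div (c : Admissible ε a) (u : M2 ε) {x : ℝ} (hx : x ∈ Dom) :
    HasDerivAt (fun x => psi u x / (1 - x) ^ 2) (zF ε (c.bOp (c.prodHat u)) x) x := by
  have h0 := (Dom.pos' hx).ne'
  have hρ := c.regAtOne_swirlDensity u
  refine ((hρ.tail.tail.hasDerivAt hx).div (((hasDerivAt_id x).const_sub 1).pow 2)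
    (pow_ne_zero 2 h0)).congr_deriv ?_
  have h1 := c.two_mul_psi_sub u hx
  simp only [psi_eq, psiInner_eq] at h1
  rw [div_eq_iff (by simpa using h0)]
  simp only [id, Pi.pow_apply]
  linear_combination (1 - x) * h1

end Density

/-! ### Equivalence with the reduced system -/

section Reduced

theorem hasDerivAt_of_eqOn {P y z : ℝ → ℝ} {P' k x : ℝ}
    (e : EqOn z (fun x => (P x - a * y x - 1 / 2 * y x ^ 2 + k) / (1 + x)) Dom)
    (hP : HasDerivAt P P' x) (hy : HasDerivAt y (z x) x) (hx : x ∈ Dom) :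
    HasDerivAt z ((P' - (1 + a + y x) * z x) / (1 + x)) x := by
  have h0 := (Dom.pos hx).ne'
  have h2 := (((hP.sub (hy.const_mul a)).sub ((hy.pow 2).const_mul (1 / 2))).add_const k).div
    ((hasDerivAt_id' x).const_add 1) h0
  refine (h2.congr_of_eventuallyEq (eventuallyEq_of_mem (Dom.nhds hx) e)).congr_deriv ?_
  have h3 := e hx
  simp only [eq_div_iff h0] at h3
  rw [div_eq_div_iff (pow_ne_zero 2 h0) h0]
  simp only [Pi.sub_apply, Pi.pow_apply]
  push_cast
  linear_combination (1 + x) * h3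

/-- The first equation, divided by `(1-x)²` and differentiated, and the second equation,
divided by `1-x`. -/
structure Reduced (w : M1 ε) (u : M2 ε) : Prop where
  theta : ∀ x ∈ Dom, HasDerivAt (zF ε (c.zHat w)) ((zF ε (c.bOp (c.prodHat u)) x -
    (1 + a + yF ε (c.yOp (c.zHat w)) x) * zF ε (c.zHat w) x) / (1 + x)) x
  phi : ∀ x ∈ Dom, HasDerivAt (hF ε (hHat ε u))
    (-((1 + a + yF ε (c.yOp (c.zHat w)) x) * hF ε (hHat ε u) x) / (1 + x)) x

variable {μ : ℝ} {w : M1 ε} {u : M2 ε}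

theorem hasDerivAt_theta (ha : √(1 + 2 * μ) = a) {x : ℝ} (hx : x ∈ Dom) :
    HasDerivAt (fun x => Ubar μ x + w x)
      (-(1 + a) + ((1 - x) * zF ε (c.zHat w) x - yF ε (c.yOp (c.zHat w)) x)) x := by
  have h1 : HasDerivAt (w : ℝ → ℝ)
      ((1 - x) * zF ε (c.zHat w) x - yF ε (c.yOp (c.zHat w)) x) x := by
    have h3 := (((hasDerivAt_id' x).const_sub 1).mul (c.hasDerivAt_yF (c.zHat w) hx))
    refine (h3.congr_of_eventuallyEq (Eventually.of_forall fun y =>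
      congrFun (c.eq_yF w) y)).congr_deriv ?_
    ring
  have h2 : HasDerivAt (Ubar μ) (-(1 + a)) x := by
    refine (((hasDerivAt_id x).const_sub 1).const_mul (1 + √(1 + 2 * μ))).congr_deriv ?_
    rw [ha]; ring
  exact h2.add h1

/-- Because `a² = 1+2μ`, the background flow solves the equation without swirl with constant `μ`,
leaving `κ - μ` on the right. With `w = (1-x) y` every remaining term carries the factor `(1-x)²`,
including `ψ` once it is written as a quotient. -/
theorem theta_eq_iff (ha : √(1 + 2 * μ) = a) (hμ : a ^ 2 = 1 + 2 * μ) {κ : ℝ} {x : ℝ}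
    (hx : x ∈ Dom) :
    (1 - x ^ 2) * deriv (fun x => Ubar μ x + w x) x + 2 * x * (Ubar μ x + w x) +
      1 / 2 * (Ubar μ x + w x) ^ 2 - psi u x = κ * (1 - x) ^ 2 ↔
    (1 + x) * zF ε (c.zHat w) x + a * yF ε (c.yOp (c.zHat w)) x +
      1 / 2 * yF ε (c.yOp (c.zHat w)) x ^ 2 - psi u x / (1 - x) ^ 2 = κ - μ := by
  have h0 := (pow_pos (Dom.pos' hx) 2).ne'
  have h1 : w x = (1 - x) * yF ε (c.yOp (c.zHat w)) x := congrFun (c.eq_yF w) x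
  have h2 : psi u x = psi u x / (1 - x) ^ 2 * (1 - x) ^ 2 := (div_mul_cancel₀ _ h0).symm
  rw [(c.hasDerivAt_theta ha hx).deriv, h1, Ubar, ha, h2, ← h2]
  constructor
  · intro h
    apply mul_right_cancel₀ h0
    linear_combination h - (1 - x) ^ 2 / 2 * hμ + h2
  · intro h
    linear_combination (1 - x) ^ 2 * h + (1 - x) ^ 2 / 2 * hμ - h2

theorem phi_eq_iff (ha : √(1 + 2 * μ) = a) {x : ℝ} (hx : x ∈ Dom) (d : ℝ) :
    (1 - x ^ 2) * d + (Ubar μ x + w x) * deriv (u : ℝ → ℝ) x = 0 ↔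
    d = -((1 + a + yF ε (c.yOp (c.zHat w)) x) * hF ε (hHat ε u) x) / (1 + x) := by
  have h0 := (Dom.pos' hx).ne'
  have h1 : w x = (1 - x) * yF ε (c.yOp (c.zHat w)) x := congrFun (c.eq_yF w) x
  rw [eq_div_iff (Dom.pos hx).ne', h1, Ubar, ha, ← hF_hHat u hx]
  constructor
  · intro h
    apply mul_left_cancel₀ h0
    linear_combination h
  · intro h
    linear_combination (1 - x) * h

/-- Solved for `z`, the first equation shows that `z` is differentiable, which membership of `w` in
`M₁` does not give on all of `(-1,1)`. Differentiation then drops `κ`. -/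
theorem reduced_of_isSolution (ha : √(1 + 2 * μ) = a) (hμ : a ^ 2 = 1 + 2 * μ) {κ : ℝ}
    (h : IsSolution (fun x => Ubar μ x + w x) u κ) : c.Reduced w u where
  theta x hx := by
    set z := c.zHat w with hz
    have h0 := Dom.pos hx
    have e : EqOn (zF ε z) (fun x => (psi u x / (1 - x) ^ 2 - a * yF ε (c.yOp z) x -
        1 / 2 * yF ε (c.yOp z) x ^ 2 + (κ - μ)) / (1 + x)) Dom := fun x hx => by
      have h1 := (c.theta_eq_iff ha hμ hx).1 (h.eq_theta x hx)
      simp only [← hz] at h1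
      simp only
      rw [eq_div_iff (Dom.pos hx).ne']
      linarith
    exact hasDerivAt_of_eqOn e (c.hasDerivAt_psi_div u hx) (c.hasDerivAt_yF z hx) hx
  phi x hx := by
    have h2 : DifferentiableAt ℝ (deriv (u : ℝ → ℝ)) x :=
      (((contDiffOn_succ_iff_deriv_of_isOpen (n := 1) isOpen_Ioo).1
        (by simpa [one_add_one_eq_two] using u.2.2.2.1)).2.2.differentiableOn
        (by norm_num)).differentiableAt (Dom.nhds hx)
    rw [← (c.phi_eq_iff ha hx _).1 (h.eq_phi x hx)]
    exact h2.hasDerivAt.congr_of_eventuallyEq (eventuallyEq_of_mem (Dom.nhds hx)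
      fun y hy => hF_hHat u hy)

theorem isSolution_of_reduced (ha : √(1 + 2 * μ) = a) (hμ : a ^ 2 = 1 + 2 * μ)
    (h : c.Reduced w u) :
    IsSolution (fun x => Ubar μ x + w x) u (μ - 1 / 4 * psi u (-1)) where
  contDiffOn_theta := by
    refine ContDiffOn.add ?_ (w.2.2.2.1.mono Ioo_subset_Ioc_self)
    unfold Ubar
    fun_prop
  contDiffOn_phi := u.2.2.2.1
  integrable := (c.regAtOne_swirlDensity u).int
  eq_theta := by
    set z := c.zHat w with hz
    have hd : ∀ x ∈ Dom, HasDerivAt (fun x => (1 + x) * zF ε z x + a * yF ε (c.yOp z) x +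
        1 / 2 * yF ε (c.yOp z) x ^ 2 - psi u x / (1 - x) ^ 2) 0 x := fun x hx => by
      have hy := c.hasDerivAt_yF z hx
      refine ((((((hasDerivAt_id x).const_add 1).mul (h.theta x hx)).add (hy.const_mul a)).add
        ((hy.pow 2).const_mul (1 / 2))).sub (c.hasDerivAt_psi_div u hx)).congr_deriv ?_
      have h0 := (Dom.pos hx).ne'
      simp only [id, ← hz]
      field_simp
      ring
    obtain ⟨k, hk⟩ := IsOpen.exists_is_const_of_deriv_eq_zero isOpen_Ioo isPreconnected_Ioo
      (fun x hx => (hd x hx).differentiableAt.differentiableWithinAt) fun x hx => (hd x hx).deriv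
    -- The conserved quantity has the value `k`, found from its limit at `-1`. There `(1+x) z` and
    -- `y` are of order `(1+x)^{1-2ε}` and vanish, while `(1-x)²` tends to `4`.
    have hpow : ∀ p : ℝ, 0 < p → ∀ f : BddFun,
        Tendsto (fun x => (1 + x) ^ p * ext f x) (𝓝[>] (-1)) (𝓝 0) := fun p hp f => by
      have h1 : Tendsto (fun x : ℝ => ‖f‖ * (1 + x) ^ p) (𝓝[>] (-1))
          (𝓝 (‖f‖ * (1 + -1) ^ p)) := by
        refine Tendsto.const_mul _ (Tendsto.mono_left ?_ nhdsWithin_le_nhds)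
        exact ContinuousAt.rpow_const (continuousAt_const.add continuousAt_id) (Or.inr hp.le)
      rw [add_neg_cancel, Real.zero_rpow hp.ne', mul_zero] at h1
      refine squeeze_zero_norm' ?_ h1
      filter_upwards [Ioo_mem_nhdsGT (show (-1 : ℝ) < 1 by norm_num)] with x hx
      exact abs_weight_ext_le p f x hx
    have h12 : 0 < 1 - 2 * ε := by linarith [c.half]
    have l1 : Tendsto (fun x => (1 + x) * zF ε z x) (𝓝[>] (-1)) (𝓝 0) := by
      refine (hpow _ h12 z).congr' ?_
      filter_upwards [Ioo_mem_nhdsGT (show (-1 : ℝ) < 1 by norm_num)] with x hx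
      have e : (1 + x) ^ (1 - 2 * ε) = (1 + x) * (1 + x) ^ (-2 * ε) := by
        rw [mul_comm (1 + x), ← Real.rpow_add_one (Dom.pos hx).ne']; congr 1; ring
      rw [zF, e, mul_assoc]
    have l2 : Tendsto (yF ε (c.yOp z)) (𝓝[>] (-1)) (𝓝 0) := hpow _ h12 _
    have l3 : Tendsto (fun x : ℝ => (1 - x) ^ 2) (𝓝[>] (-1)) (𝓝 ((1 - -1) ^ 2)) :=
      ((tendsto_id.mono_left nhdsWithin_le_nhds).const_sub 1).pow 2
    have l4 := (((l1.add (l2.const_mul a)).add ((l2.pow 2).const_mul (1 / 2))).sub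
      ((c.tendsto_psi u).div l3 (by norm_num)))
    have l5 : Tendsto (fun x => (1 + x) * zF ε z x + a * yF ε (c.yOp z) x +
        1 / 2 * yF ε (c.yOp z) x ^ 2 - psi u x / (1 - x) ^ 2) (𝓝[>] (-1)) (𝓝 k) := by
      refine tendsto_const_nhds.congr' ?_
      filter_upwards [Ioo_mem_nhdsGT (show (-1 : ℝ) < 1 by norm_num)] with x hx
      exact (hk x hx).symm
    have e := tendsto_nhds_unique l5 l4
    intro x hx
    refine (c.theta_eq_iff ha hμ hx).2 ((hk x hx).trans ?_)
    rw [e]; ring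
  eq_phi x hx := by
    refine (c.phi_eq_iff ha hx _).2 (((h.phi x hx).congr_of_eventuallyEq
      (eventuallyEq_of_mem (Dom.nhds hx) fun y hy => ?_)).deriv)
    exact (hF_hHat u hy).symm

end Reduced

section Chart

/-! The reduced system near a base value `a` of the parameter, for the parameter `a'`. -/

variable {a' : ℝ} (c' : Admissible ε a')

theorem zF_add (f g : BddFun) (x : ℝ) : zF ε (f + g) x = zF ε f x + zF ε g x := by
  simp only [zF, ext_add, mul_add]

theorem zF_sub (f g : BddFun) (x : ℝ) : zF ε (f - g) x = zF ε f x - zF ε g x := by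
  simp only [zF, ext_sub, mul_sub]

theorem zF_smul (k : ℝ) (f : BddFun) (x : ℝ) : zF ε (k • f) x = k * zF ε f x := by
  simp only [zF, ext_smul, mul_left_comm]

theorem zF_zero (x : ℝ) : zF ε 0 x = 0 := by simp [zF]

theorem hF_add (f g : BddFun) (x : ℝ) : hF ε (f + g) x = hF ε f x + hF ε g x := by
  simp only [hF, ext_add, mul_add]

theorem hF_sub (f g : BddFun) (x : ℝ) : hF ε (f - g) x = hF ε f x - hF ε g x := by
  simp only [hF, ext_sub, mul_sub]

theorem hF_smul (k : ℝ) (f : BddFun) (x : ℝ) : hF ε (k • f) x = k * hF ε f x := by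
  simp only [hF, ext_smul, mul_left_comm]

theorem hF_neg (f : BddFun) (x : ℝ) : hF ε (-f) x = -hF ε f x := by
  simp only [hF, ext_neg, mul_neg]

theorem hF_zero (x : ℝ) : hF ε 0 x = 0 := by simp [hF]

/-- The weighted derivative of the swirl. -/
noncomputable def swirlHat (b : ℝ) (g k : BddFun) : BddFun := b • (c.qFun + c.tOp k) + c.tOp g

theorem ext_mFun {x : ℝ} (hx : x ∈ Dom) : ext c.mFun x = (1 + x) ^ (1 - 2 * ε) := ext_powFun _ hx

theorem zF_mFun_mul (y z : BddFun) {x : ℝ} (hx : x ∈ Dom) :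
    zF ε (c.mFun * y * z) x = yF ε y x * zF ε z x := by
  rw [zF, zF, yF, ext_mul, ext_mul, c.ext_mFun hx]; ring

theorem hF_mFun_mul (y h : BddFun) {x : ℝ} (hx : x ∈ Dom) :
    hF ε (c.mFun * y * h) x = yF ε y x * hF ε h x := by
  rw [hF, hF, yF, ext_mul, ext_mul, c.ext_mFun hx]; ring

/-- The kernel element for `a'` in terms of the operators for `a`. -/
theorem smul_kerElt_eq {k : BddFun} (hk : k + (a' - a) • (c.qFun + c.tOp k) = 0) :
    c.kerElt + c.phiOp k = (c.kerElt 0 / c'.kerElt 0) • c'.kerElt := by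
  set h := c.qFun + c.tOp k with hh
  -- By construction `(1+x) h' + (1+a) h = k`, and the hypothesis says `k = -(a'-a) h`. So `h` lies
  -- in the kernel for `a'`.
  have hd : ∀ x ∈ Dom, HasDerivAt (hF ε h) (-(1 + a') * hF ε h x / (1 + x)) x := fun x hx => by
    have e0 : hF ε h = fun x => hF ε c.qFun x + hF ε (c.tOp k) x := by
      funext x; simp only [hF, hh, ext_add, mul_add]
    have e1 : hF ε k x = -(a' - a) * hF ε h x := by
      have := congrArg (fun f => hF ε f x) hk
      simp only [hF_add, hF_smul, hF_zero] at this
      rw [neg_mul]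
      linarith
    rw [e0]
    refine ((c.hasDerivAt_qFun hx).add (c.hasDerivAt_hF k hx)).congr_deriv ?_
    have e2 : hF ε (0 : BddFun) x = 0 := by simp [hF]
    rw [e1, e2, e0]
    ring
  obtain ⟨l, hl⟩ := exists_eq_const_mul_rpow (b := 1 + a') hd fun x hx => by
    have := (Dom.pos hx).ne'
    field_simp
    ring
  have e : c.kerElt + c.phiOp k = (-l) • c'.kerElt := by
    refine M2_ext c (BddFun.ext' fun x hx => mul_left_cancel₀ (rpow_dom_pos (-1 - ε) hx).ne' ?_)
    have h1 := hl x hx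
    have h2 := c'.hF_qFun hx
    simp only [hF] at h1 h2
    rw [map_add, map_smul, hHat_kerElt, hHat_phiOp, hHat_kerElt, ← hh, ext_smul]
    linear_combination h1 + l * h2
  -- The scalar is found by evaluation at `0`, where `phiOp k` vanishes.
  have h0 : c.kerElt 0 = -l * c'.kerElt 0 := by
    have h1 : (c.kerElt + c.phiOp k : M2 ε) 0 = ((-l) • c'.kerElt : M2 ε) 0 := by rw [e]
    have h2 : c.phiOp k 0 = 0 := by rw [← c.evOp_hHat, hHat_phiOp, evOp_tOp]
    have h3 : (c.kerElt + c.phiOp k : M2 ε) 0 = c.kerElt 0 + c.phiOp k 0 := rfl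
    have h4 : ((-l) • c'.kerElt : M2 ε) 0 = -l * c'.kerElt 0 := rfl
    rw [h3, h4, h2, add_zero] at h1
    exact h1
  rw [e, h0, mul_div_cancel_right₀ _ c'.kerElt_zero_pos.ne']

theorem hHat_swirl {b β : ℝ} {g k : BddFun} (hk : k + (a' - a) • (c.qFun + c.tOp k) = 0)
    (hb : b * c.kerElt 0 = β * c'.kerElt 0) :
    hHat ε (β • c'.kerElt + c.phiOp g) = c.swirlHat b g k := by
  have h1 : β • c'.kerElt = b • (c.kerElt + c.phiOp k) := by
    rw [c.smul_kerElt_eq c' hk, smul_smul, ← mul_div_assoc, hb,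
      mul_div_cancel_right₀ _ c'.kerElt_zero_pos.ne']
  rw [h1, map_add, map_smul, map_add, hHat_kerElt, hHat_phiOp, hHat_phiOp, swirlHat]

/-- The operator for `a'` is the one for `a` plus multiplication by `a'-a`. The unknowns `ζ`, `g`,
`k` are the images of `z` and of the parts of the swirl under the operator for `a`, so `h1`, `h2 + b
h3` are the two reduced equations. -/
theorem reduced_of_chart {b β : ℝ} {ζ g k : BddFun} (hb : b * c.kerElt 0 = β * c'.kerElt 0)
    (h1 : ζ + (a' - a) • c.zOp ζ + c.mFun * c.yOp (c.zOp ζ) * c.zOp ζ -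
      c.bOp (c.uOp (c.swirlHat b g k) * c.swirlHat b g k) = 0)
    (h2 : g + (a' - a) • c.tOp g + c.mFun * c.yOp (c.zOp ζ) * c.swirlHat b g k = 0)
    (h3 : k + (a' - a) • (c.qFun + c.tOp k) = 0) :
    c'.Reduced (c.thetaOp ζ) (β • c'.kerElt + c.phiOp g) := by
  have eh := c.hHat_swirl c' (g := g) h3 hb
  have ez : c'.zHat (c.thetaOp ζ) = c.zOp ζ := c.zHat_thetaOp ζ
  have ep : c'.prodHat (β • c'.kerElt + c.phiOp g) =
      c.uOp (c.swirlHat b g k) * c.swirlHat b g k := by rw [prodHat, eh]; rfl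
  refine ⟨fun x hx => ?_, fun x hx => ?_⟩
  · rw [ez, ep]
    refine (c.hasDerivAt_zF ζ hx).congr_deriv ?_
    have h4 := congrArg (fun f => zF ε f x) h1
    have e6 : c'.yOp = c.yOp := rfl
    have e7 : c'.bOp = c.bOp := rfl
    simp only [zF_add, zF_sub, zF_smul, zF_zero, c.zF_mFun_mul _ _ hx] at h4
    rw [e6, e7]
    congr 1
    linear_combination h4
  · rw [ez, eh]
    have e6 : c'.yOp = c.yOp := rfl
    rw [e6]
    have e0 : hF ε (c.swirlHat b g k) =
        fun x => b * (hF ε c.qFun x + hF ε (c.tOp k) x) + hF ε (c.tOp g) x := by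
      funext x; simp only [swirlHat, hF_add, hF_smul]
    have h4 := congrArg (fun f => hF ε f x) h2
    have h5 := congrArg (fun f => hF ε f x) h3
    simp only [hF_add, hF_smul, hF_zero, c.hF_mFun_mul _ _ hx, e0] at h4 h5
    rw [e0]
    refine ((((c.hasDerivAt_qFun hx).add (c.hasDerivAt_hF k hx)).const_mul b).add
      (c.hasDerivAt_hF g hx)).congr_deriv ?_
    rw [hF_zero, ← add_div, ← mul_div_assoc, ← add_div]
    congr 1
    linear_combination h4 + b * h5

/-- Converse of `reduced_of_chart`: the reduced equations dictate `ζ` and `g`, and uniqueness for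
the two linear equations shows that the solution operators give `w` and `v` back. The condition `v 0
= 0` is the normalization in `tOp`. -/
theorem chart_of_reduced {b β : ℝ} {w : M1 ε} {v : M2 ε} {k : BddFun} (hv : v 0 = 0)
    (hb : b * c.kerElt 0 = β * c'.kerElt 0)
    (h3 : k + (a' - a) • (c.qFun + c.tOp k) = 0)
    (h : c'.Reduced w (β • c'.kerElt + v)) {ζ g : BddFun}
    (hζ : ζ = c.bOp (c.uOp (b • (c.qFun + c.tOp k) + hHat ε v) *
      (b • (c.qFun + c.tOp k) + hHat ε v)) - (a' - a) • c.zHat w -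
      c.mFun * c.yOp (c.zHat w) * c.zHat w)
    (hg : g = -((a' - a) • hHat ε v) - c.mFun * c.yOp (c.zHat w) *
      (b • (c.qFun + c.tOp k) + hHat ε v)) :
    w = c.thetaOp ζ ∧ v = c.phiOp g ∧ c.zOp ζ = c.zHat w ∧ c.tOp g = hHat ε v := by
  have eh : hHat ε (β • c'.kerElt + v) = b • (c.qFun + c.tOp k) + hHat ε v := by
    have h1 : β • c'.kerElt = b • (c.kerElt + c.phiOp k) := by
      rw [c.smul_kerElt_eq c' h3, smul_smul, ← mul_div_assoc, hb,
        mul_div_cancel_right₀ _ c'.kerElt_zero_pos.ne']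
    rw [h1, map_add, map_smul, map_add, hHat_kerElt, hHat_phiOp]
  have ez : c'.zHat w = c.zHat w := rfl
  have ep : c'.prodHat (β • c'.kerElt + v) = c.uOp (b • (c.qFun + c.tOp k) + hHat ε v) *
      (b • (c.qFun + c.tOp k) + hHat ε v) := by rw [prodHat, eh]; rfl
  have e6 : c'.yOp = c.yOp := rfl
  have e7 : c'.bOp = c.bOp := rfl
  obtain ⟨ht, hp⟩ := h
  rw [ez, ep, e6, e7] at ht
  rw [ez, eh, e6] at hp
  have k1 : c.zOp ζ = c.zHat w := c.zOp_eq ht fun x hx => by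
    have h0 := (Dom.pos hx).ne'
    rw [mul_div_cancel₀ _ h0, hζ]
    simp only [zF_sub, zF_smul, c.zF_mFun_mul _ _ hx]
    ring
  have k2 : c.tOp g = hHat ε v := by
    have ev : hF ε (hHat ε v) = fun x => hF ε (b • (c.qFun + c.tOp k) + hHat ε v) x -
        b * (hF ε c.qFun x + hF ε (c.tOp k) x) := by
      funext x; simp only [hF_add, hF_smul]; ring
    -- The derivative of `v'` is written as that of the full swirl, known from the reduced system,
    -- minus that of the kernel part.
    refine c.tOp_eq (h' := fun x => -((1 + a' + yF ε (c.yOp (c.zHat w)) x) *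
      hF ε (b • (c.qFun + c.tOp k) + hHat ε v) x) / (1 + x) - b * ((hF ε 0 x - (1 + a) *
      hF ε c.qFun x) / (1 + x) + (hF ε k x - (1 + a) * hF ε (c.tOp k) x) / (1 + x)))
      (fun x hx => ?_) (fun x hx => ?_) (by rw [evOp_hHat, hv])
    · rw [ev]
      exact (hp x hx).sub (((c.hasDerivAt_qFun hx).add (c.hasDerivAt_hF k hx)).const_mul b)
    · have h0 := (Dom.pos hx).ne'
      have h5 := congrArg (fun f => hF ε f x) h3
      rw [hg, hF_zero]
      simp only [hF_add, hF_sub, hF_smul, hF_zero, hF_neg, c.hF_mFun_mul _ _ hx] at h5 ⊢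
      field_simp
      linear_combination (-b) * h5
  exact ⟨c.M1_ext (by rw [zHat_thetaOp, k1]), M2_ext c (by rw [hHat_phiOp, k2]), k1, k2⟩

end Chart

end Admissible

/-! ### The local solution map -/

theorem HasFDerivAt.mul_of_eq_zero {G : Type*} [NormedAddCommGroup G] [NormedSpace ℝ G]
    {f g : G → BddFun} {f' g' : G →L[ℝ] BddFun} {x : G} (hf : HasFDerivAt f f' x)
    (hg : HasFDerivAt g g' x) (hf0 : f x = 0) (hg0 : g x = 0) :
    HasFDerivAt (fun y => f y * g y) (0 : G →L[ℝ] BddFun) x := by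
  refine (hf.mul hg).congr_fderiv ?_
  rw [hf0, hg0]
  ext; simp

theorem HasFDerivAt.smul_of_eq_zero {G H : Type*} [NormedAddCommGroup G] [NormedSpace ℝ G]
    [NormedAddCommGroup H] [NormedSpace ℝ H]
    {f : G → ℝ} {g : G → H} {f' : G →L[ℝ] ℝ} {g' : G →L[ℝ] H} {x : G} (hf : HasFDerivAt f f' x)
    (hg : HasFDerivAt g g' x) (hf0 : f x = 0) (hg0 : g x = 0) :
    HasFDerivAt (fun y => f y • g y) (0 : G →L[ℝ] H) x := by
  refine (hf.smul hg).congr_fderiv ?_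
  rw [hf0, hg0]
  ext; simp

namespace Admissible

variable {ε a : ℝ} (c : Admissible ε a)

/-- The reduced system near `a`, as an equation in a Banach space: the parameters are `a' - a` and
a multiple of the swirl at `0`. -/
noncomputable def chartMap (ξ : (ℝ × ℝ) × (BddFun × BddFun × BddFun)) :
    BddFun × BddFun × BddFun :=
  (ξ.2.1 + ξ.1.1 • c.zOp ξ.2.1 + c.mFun * c.yOp (c.zOp ξ.2.1) * c.zOp ξ.2.1 -
      c.bOp (c.uOp (c.swirlHat ξ.1.2 ξ.2.2.1 ξ.2.2.2) * c.swirlHat ξ.1.2 ξ.2.2.1 ξ.2.2.2),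
    ξ.2.2.1 + ξ.1.1 • c.tOp ξ.2.2.1 +
      c.mFun * c.yOp (c.zOp ξ.2.1) * c.swirlHat ξ.1.2 ξ.2.2.1 ξ.2.2.2,
    ξ.2.2.2 + ξ.1.1 • (c.qFun + c.tOp ξ.2.2.2))

theorem contDiff_chartMap : ContDiff ℝ ω c.chartMap := by
  unfold chartMap swirlHat
  fun_prop

theorem chartMap_zero : c.chartMap 0 = 0 := by
  simp [chartMap, swirlHat]

/-- The derivative of `chartMap` at `0`. -/
noncomputable def chartDeriv :
    ((ℝ × ℝ) × (BddFun × BddFun × BddFun)) →L[ℝ] (BddFun × BddFun × BddFun) :=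
  ContinuousLinearMap.snd ℝ _ _ +
    (ContinuousLinearMap.inr ℝ BddFun (BddFun × BddFun)).comp
      ((ContinuousLinearMap.inr ℝ BddFun BddFun).comp
        (((ContinuousLinearMap.fst ℝ ℝ ℝ).comp (ContinuousLinearMap.fst ℝ _ _)).smulRight c.qFun))

/-- Apart from the unknowns themselves and the term `(a'-a) • qFun`, every term is built from a
product of two factors that vanish at `0` and contributes nothing to the derivative there. -/
theorem hasFDerivAt_chartMap : HasFDerivAt c.chartMap c.chartDeriv 0 := by
  set G := (ℝ × ℝ) × (BddFun × BddFun × BddFun) with hG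
  have d {H : Type} [NormedAddCommGroup H] [NormedSpace ℝ H] (L : G →L[ℝ] H) :
    HasFDerivAt (fun ξ => L ξ) L 0 := L.hasFDerivAt
  let πt : G →L[ℝ] ℝ := (ContinuousLinearMap.fst ℝ ℝ ℝ).comp (ContinuousLinearMap.fst ℝ _ _)
  let πb : G →L[ℝ] ℝ := (ContinuousLinearMap.snd ℝ ℝ ℝ).comp (ContinuousLinearMap.fst ℝ _ _)
  let π1 : G →L[ℝ] BddFun := (ContinuousLinearMap.fst ℝ _ _).comp (ContinuousLinearMap.snd ℝ _ _)
  let π2 : G →L[ℝ] BddFun := (ContinuousLinearMap.fst ℝ BddFun BddFun).comp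
    ((ContinuousLinearMap.snd ℝ _ _).comp (ContinuousLinearMap.snd ℝ _ _))
  let π3 : G →L[ℝ] BddFun := (ContinuousLinearMap.snd ℝ BddFun BddFun).comp
    ((ContinuousLinearMap.snd ℝ _ _).comp (ContinuousLinearMap.snd ℝ _ _))
  have hs : HasFDerivAt (fun ξ : G => c.swirlHat ξ.1.2 ξ.2.2.1 ξ.2.2.2)
      (πb.smulRight c.qFun + c.tOp.comp π2) 0 := by
    have h1 : HasFDerivAt (fun ξ : G => ξ.1.2 • c.qFun + ξ.1.2 • c.tOp ξ.2.2.2 + c.tOp ξ.2.2.1)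
        (πb.smulRight c.qFun + 0 + c.tOp.comp π2) 0 :=
      ((d (πb.smulRight c.qFun)).add (HasFDerivAt.smul_of_eq_zero (d πb) (d (c.tOp.comp π3))
        (map_zero _) (map_zero _))).add (d (c.tOp.comp π2))
    rw [add_zero] at h1
    refine h1.congr_of_eventuallyEq (Eventually.of_forall fun ξ => ?_)
    simp only [swirlHat, smul_add]
  have hs0 : c.swirlHat (0 : G).1.2 (0 : G).2.2.1 (0 : G).2.2.2 = 0 := by simp [swirlHat]
  have h1 := (((d π1).add (HasFDerivAt.smul_of_eq_zero (d πt) (d (c.zOp.comp π1)) (map_zero _)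
    (map_zero _))).add (HasFDerivAt.mul_of_eq_zero
      (d ((ContinuousLinearMap.mul ℝ BddFun c.mFun).comp (c.yOp.comp (c.zOp.comp π1))))
      (d (c.zOp.comp π1)) (map_zero _) (map_zero _))).sub
      (c.bOp.hasFDerivAt.comp (0 : G) (HasFDerivAt.mul_of_eq_zero (c.uOp.hasFDerivAt.comp (0 : G) hs) hs
        (by simp only [Function.comp_apply, hs0, map_zero]) hs0))
  have h2 := ((d π2).add (HasFDerivAt.smul_of_eq_zero (d πt) (d (c.tOp.comp π2)) (map_zero _)
    (map_zero _))).add (HasFDerivAt.mul_of_eq_zero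
      (d ((ContinuousLinearMap.mul ℝ BddFun c.mFun).comp (c.yOp.comp (c.zOp.comp π1))))
      hs (map_zero _) hs0)
  have h3 : HasFDerivAt (fun ξ : G => ξ.2.2.2 + ξ.1.1 • (c.qFun + c.tOp ξ.2.2.2))
      (π3 + (πt.smulRight c.qFun + 0)) 0 := by
    have := (d π3).add ((d (πt.smulRight c.qFun)).add (HasFDerivAt.smul_of_eq_zero (d πt)
      (d (c.tOp.comp π3)) (map_zero _) (map_zero _)))
    refine this.congr_of_eventuallyEq (Eventually.of_forall fun ξ => ?_)
    simp only [smul_add]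
    rfl
  refine (h1.prodMk (h2.prodMk h3)).congr_fderiv ?_
  ext ξ <;> simp [chartDeriv, π1, π2, π3, πt]

/-- The partial derivative of `chartMap` in the unknowns is the identity, so the implicit function
theorem applies. The derivative in the swirl parameter alone is zero; this becomes `∂V/∂β = 0`. -/
theorem exists_implicit : ∃ φ : ℝ × ℝ → BddFun × BddFun × BddFun, ContDiffAt ℝ ω φ 0 ∧ φ 0 = 0 ∧
    (∃ L : ℝ × ℝ →L[ℝ] BddFun × BddFun × BddFun, HasFDerivAt φ L 0 ∧ L (0, 1) = 0) ∧
    (∀ᶠ p in 𝓝 0, c.chartMap (p, φ p) = 0) ∧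
    ∀ᶠ ξ : (ℝ × ℝ) × (BddFun × BddFun × BddFun) in 𝓝 0, c.chartMap ξ = 0 → φ ξ.1 = ξ.2 := by
  have cdf : ContDiffAt ℝ ω c.chartMap 0 := c.contDiff_chartMap.contDiffAt
  have hfd := c.hasFDerivAt_chartMap.fderiv
  have hinv : (fderiv ℝ c.chartMap 0 ∘L .inr ℝ (ℝ × ℝ) (BddFun × BddFun × BddFun)).IsInvertible := by
    refine ⟨ContinuousLinearEquiv.refl ℝ _, ?_⟩
    rw [hfd]
    ext ξ <;> simp [chartDeriv]
  have pn : (ω : WithTop ℕ∞) ≠ 0 := by simp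
  refine ⟨cdf.implicitFunction pn hinv, cdf.contDiffAt_implicitFunction pn hinv,
    cdf.implicitFunction_apply_self pn hinv,
    ⟨_, (cdf.hasStrictFDerivAt_implicitFunction pn hinv).hasFDerivAt, ?_⟩, ?_, ?_⟩
  · have : fderiv ℝ c.chartMap 0 ((0, 1), 0) = 0 := by
      rw [hfd]; simp [chartDeriv]
    simp [this]
  · have := cdf.eventually_apply_implicitFunction pn hinv
    rw [c.chartMap_zero] at this
    exact this
  · filter_upwards [cdf.eventually_apply_eq_iff_implicitFunction pn hinv] with ξ hξ h
    rw [c.chartMap_zero] at hξ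
    exact hξ.1 h

end Admissible

/-! ### Gluing local solution maps -/

/-- Local solution maps, unique near `0`, along a compact set of parameters are the germs of a
single map. -/
theorem exists_glued {P X : Type*} [TopologicalSpace P] [SeminormedAddCommGroup X] {K : Set P}
    (hK : IsCompact K) (Sol : P → X → Prop)
    (loc : ∀ k ∈ K, ∃ V : P → X, ∃ r > 0, ∀ᶠ p in 𝓝 k, ∀ v, ‖v‖ < r → Sol p v → v = V p) :
    ∃ r > 0, ∃ V : P → X, ∀ k ∈ K, (∀ᶠ p in 𝓝 k, ∀ v, ‖v‖ < r → Sol p v → v = V p) ∧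
      ∀ V' : P → X, ContinuousAt V' k → V' k = 0 → (∀ᶠ p in 𝓝 k, Sol p (V' p)) → V =ᶠ[𝓝 k] V' := by
  classical
  let U (r : ℝ) (p : P) : Prop := ∀ v v', ‖v‖ < r → ‖v'‖ < r → Sol p v → Sol p v' → v = v'
  obtain ⟨r, hr, hU⟩ : ∃ r > 0, ∀ k ∈ K, ∀ᶠ p in 𝓝 k, U r p := by
    -- A radius of uniqueness passes to subsets and, by taking the minimum, to unions, so
    -- compactness turns local radii into a common one.
    refine hK.induction_on (p := fun s => ∃ r > 0, ∀ k ∈ s, ∀ᶠ p in 𝓝 k, U r p)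
      ⟨1, one_pos, by simp⟩ (fun s t hst ⟨r, hr, h⟩ => ⟨r, hr, fun k hk => h k (hst hk)⟩) ?_ ?_
    · rintro s t ⟨r, hr, h⟩ ⟨r', hr', h'⟩
      refine ⟨min r r', lt_min hr hr', ?_⟩
      rintro k (hk | hk)
      · filter_upwards [h k hk] with p hp v v' hv hv'
        exact hp v v' (hv.trans_le (min_le_left _ _)) (hv'.trans_le (min_le_left _ _))
      · filter_upwards [h' k hk] with p hp v v' hv hv'
        exact hp v v' (hv.trans_le (min_le_right _ _)) (hv'.trans_le (min_le_right _ _))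
    · intro k hk
      obtain ⟨V, r, hr, h⟩ := loc k hk
      refine ⟨{p | ∀ᶠ q in 𝓝 p, U r q}, mem_nhdsWithin_of_mem_nhds ?_, r, hr, fun p hp => hp⟩
      refine eventually_eventually_nhds.2 ?_
      filter_upwards [h] with p hp v v' hv hv' hs hs'
      rw [hp v hv hs, hp v' hv' hs']
  -- The glued map takes the small solution where one exists; `0` is a dummy value. A local solution
  -- map vanishing at `k` is small near `k`, hence agrees with it there.
  refine ⟨r, hr, fun p => if h : ∃ v, ‖v‖ < r ∧ Sol p v then h.choose else 0, fun k hk => ?_⟩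
  have key : ∀ p, U r p → ∀ v, ‖v‖ < r → Sol p v →
      v = if h : ∃ v, ‖v‖ < r ∧ Sol p v then h.choose else 0 := fun p hp v hv hs => by
    have h : ∃ v, ‖v‖ < r ∧ Sol p v := ⟨v, hv, hs⟩
    rw [dif_pos h]
    exact hp v _ hv h.choose_spec.1 hs h.choose_spec.2
  refine ⟨(hU k hk).mono key, fun V' hc h0 hs => ?_⟩
  have hn : ∀ᶠ p in 𝓝 k, ‖V' p‖ < r := by
    refine hc.norm.eventually_lt_const ?_
    simpa [h0] using hr
  filter_upwards [hU k hk, hn, hs] with p h1 h2 h3 using (key p h1 _ h2 h3).symm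

/-! ### Existence and uniqueness near the family `U^μ` -/

/-- The pair `U^μ + β V² + v`, where `p = (ν, β)` and `μ = m ν`, solves the system. -/
def Solves {ε : ℝ} (m : ℝ → ℝ) (p : ℝ × ℝ) (v : X1 ε) : Prop :=
  ∃ κ, IsSolution (familyTheta (m p.1) v.1) (familyPhi (m p.1) p.2 v.1) κ

namespace Admissible

variable {ε a μ : ℝ} (c : Admissible ε a)

theorem eqOn_familyPhi (ha : √(1 + 2 * μ) = a) (β : ℝ) (V : X ε) :
    EqOn (familyPhi μ β V) (β • c.kerElt + V.snd : M2 ε) (Ioc (-1) 1) := fun x hx => by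
  have h : (β • c.kerElt + V.snd : M2 ε) x = β * c.kerElt x + V.snd x := rfl
  rw [h, c.kerElt_eq ha hx]
  rfl

theorem isSolution_iff (ha : √(1 + 2 * μ) = a) (β : ℝ) (V : X ε) (κ : ℝ) :
    IsSolution (familyTheta μ V) (familyPhi μ β V) κ ↔
      IsSolution (fun x => Ubar μ x + V.fst x) (β • c.kerElt + V.snd : M2 ε) κ :=
  have h := (c.eqOn_familyPhi ha β V).mono Ioo_subset_Ioc_self
  ⟨fun hs => hs.congr (fun _ _ => rfl) h.symm, fun hs => hs.congr (fun _ _ => rfl) h⟩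

theorem reduced_of_family (ha : √(1 + 2 * μ) = a) (hμ : a ^ 2 = 1 + 2 * μ) {β : ℝ} {V : X ε}
    {κ : ℝ} (h : IsSolution (familyTheta μ V) (familyPhi μ β V) κ) :
    c.Reduced V.fst (β • c.kerElt + V.snd) :=
  c.reduced_of_isSolution ha hμ ((c.isSolution_iff ha β V κ).1 h)

theorem family_of_reduced (ha : √(1 + 2 * μ) = a) (hμ : a ^ 2 = 1 + 2 * μ) {β : ℝ} {V : X ε}
    (h : c.Reduced V.fst (β • c.kerElt + V.snd)) :
    IntervalIntegrable (psiInner (familyPhi μ β V)) volume (-1) 1 ∧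
    IsSolution (familyTheta μ V) (familyPhi μ β V)
      (μ - 1 / 4 * psi (familyPhi μ β V) (-1)) := by
  have he := (c.eqOn_familyPhi ha β V).mono Ioo_subset_Ioc_self
  refine ⟨?_, (c.isSolution_iff ha β V _).2 ?_⟩
  · refine (c.intervalIntegrable_psiInner (β • c.kerElt + V.snd)).congr_ae ?_
    rw [uIoc_of_le (by norm_num)]
    exact ae_restrict_dom (fun x hx => (psiInner_congr he hx).symm) le_rfl le_rfl
  · rw [psi_congr he ⟨le_rfl, by norm_num⟩]
    exact c.isSolution_of_reduced ha hμ h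

/-- The map from the unknowns of `chartMap` to `X₁(ε)`. -/
noncomputable def chartOut : BddFun × BddFun × BddFun →L[ℝ] X1 ε :=
  LinearMap.mkContinuous
    { toFun := fun e => ⟨WithLp.toLp 1 (c.thetaOp e.1, c.phiOp e.2.1), by
        change c.phiOp e.2.1 0 = 0
        rw [← c.evOp_hHat, hHat_phiOp, evOp_tOp]⟩
      map_add' := fun e f => Subtype.ext (by simp [← WithLp.toLp_add])
      map_smul' := fun k e => Subtype.ext (by simp [← WithLp.toLp_smul]) }
    (‖c.thetaOp‖ + ‖c.phiOp‖) fun e => by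
      have h1 : ‖WithLp.toLp 1 (c.thetaOp e.1, c.phiOp e.2.1)‖ =
        ‖c.thetaOp e.1‖ + ‖c.phiOp e.2.1‖ := norm_X ε _
      have h2 : ‖e.1‖ ≤ ‖e‖ := norm_fst_le e
      have h3 : ‖e.2.1‖ ≤ ‖e‖ := (norm_fst_le e.2).trans (norm_snd_le e)
      change ‖WithLp.toLp 1 (c.thetaOp e.1, c.phiOp e.2.1)‖ ≤ _
      rw [h1, add_mul]
      gcongr
      · exact (c.thetaOp.le_opNorm _).trans (by gcongr)
      · exact (c.phiOp.le_opNorm _).trans (by gcongr)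

/-- The first component, as a continuous linear map. -/
noncomputable def fstX (ε : ℝ) : X1 ε →L[ℝ] M1 ε :=
  (WithLp.fstL 1 ℝ (M1 ε) (M2 ε)).comp (X1 ε).subtypeL

/-- The second component, as a continuous linear map. -/
noncomputable def sndX (ε : ℝ) : X1 ε →L[ℝ] M2 ε :=
  (WithLp.sndL 1 ℝ (M1 ε) (M2 ε)).comp (X1 ε).subtypeL

/-- The unknowns of `chartMap` in terms of the solution; `θ` are the parameters and `k` the third
unknown. -/
noncomputable def chartIn (θ : ℝ × ℝ) (k : BddFun) (v : X1 ε) : BddFun × BddFun × BddFun :=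
  (c.bOp (c.uOp (θ.2 • (c.qFun + c.tOp k) + hHat ε (sndX ε v)) *
      (θ.2 • (c.qFun + c.tOp k) + hHat ε (sndX ε v))) - θ.1 • c.zHat (fstX ε v) -
      c.mFun * c.yOp (c.zHat (fstX ε v)) * c.zHat (fstX ε v),
    -(θ.1 • hHat ε (sndX ε v)) - c.mFun * c.yOp (c.zHat (fstX ε v)) *
      (θ.2 • (c.qFun + c.tOp k) + hHat ε (sndX ε v)), k)

theorem continuous_chartIn :
    Continuous fun x : ((ℝ × ℝ) × BddFun) × X1 ε => c.chartIn x.1.1 x.1.2 x.2 := by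
  unfold chartIn
  fun_prop

theorem chartIn_zero : c.chartIn 0 0 0 = 0 := by
  simp [chartIn]

/-- This carries uniqueness from the chart to `X₁`: every solution comes from a zero of `chartMap`
that depends continuously on it. -/
theorem chartMap_chartIn {a' : ℝ} (c' : Admissible ε a') {b β : ℝ} {k : BddFun} {v : X1 ε}
    (hb : b * c.kerElt 0 = β * c'.kerElt 0)
    (h3 : k + (a' - a) • (c.qFun + c.tOp k) = 0)
    (h : c'.Reduced v.1.fst (β • c'.kerElt + v.1.snd)) :
    c.chartMap ((a' - a, b), c.chartIn (a' - a, b) k v) = 0 ∧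
      c.chartOut (c.chartIn (a' - a, b) k v) = v := by
  have hv : v.1.snd 0 = 0 := v.2
  obtain ⟨h1, h2, hz, ht⟩ := c.chart_of_reduced c' hv hb h3 h
    (ζ := (c.chartIn (a' - a, b) k v).1) (g := (c.chartIn (a' - a, b) k v).2.1) rfl rfl
  refine ⟨?_, Subtype.ext ?_⟩
  · refine Prod.ext ?_ (Prod.ext ?_ h3)
    · simp only [chartMap, swirlHat, hz, ht]
      simp only [chartIn, fstX, sndX, ContinuousLinearMap.comp_apply, Submodule.subtypeL_apply,
        WithLp.fstL_apply, WithLp.sndL_apply, Prod.fst_zero]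
      abel
    · simp only [chartMap, swirlHat, hz, ht]
      simp only [chartIn, fstX, sndX, ContinuousLinearMap.comp_apply, Submodule.subtypeL_apply,
        WithLp.fstL_apply, WithLp.sndL_apply, Prod.fst_zero, Prod.snd_zero]
      abel
  · change WithLp.toLp 1 (_, _) = _
    rw [← h1, ← h2]
    rfl

end Admissible

/-- Conditions on a parametrization `μ = m ν` near `ν₀`. -/
structure ParamAt (ε : ℝ) (m : ℝ → ℝ) (ν₀ : ℝ) : Prop where
  half : ε < 1 / 2
  lt : √(1 + 2 * m ν₀) < ε
  ge : ∀ᶠ ν in 𝓝 ν₀, -1 / 2 ≤ m ν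
  sqrt : ContDiffAt ℝ ω (fun ν => √(1 + 2 * m ν)) ν₀
  swirl : ContDiffAt ℝ ω (fun ν => V2phi (m ν) 0) ν₀

theorem ParamAt.admissible {ε : ℝ} {m : ℝ → ℝ} {ν₀ : ℝ} (h : ParamAt ε m ν₀) :
    ∀ᶠ ν in 𝓝 ν₀, Admissible ε √(1 + 2 * m ν) ∧ √(1 + 2 * m ν) ^ 2 = 1 + 2 * m ν := by
  filter_upwards [h.ge, h.sqrt.continuousAt.eventually_lt_const h.lt] with ν h1 h2
  exact ⟨⟨Real.sqrt_nonneg _, h2, h.half⟩, Real.sq_sqrt (by linarith)⟩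

theorem ParamAt.exists_local {ε : ℝ} {m : ℝ → ℝ} {ν₀ : ℝ} (h : ParamAt ε m ν₀) :
    ∃ V : ℝ × ℝ → X1 ε, ContDiffAt ℝ ω V (ν₀, 0) ∧ V (ν₀, 0) = 0 ∧
      HasDerivAt (fun β => V (ν₀, β)) 0 0 ∧ (∀ᶠ p in 𝓝 (ν₀, 0), Solves m p (V p)) ∧
      ∃ r > 0, ∀ᶠ p in 𝓝 (ν₀, 0), ∀ v : X1 ε, ‖v‖ < r → Solves m p v → v = V p := by
  obtain ⟨c, -⟩ := h.admissible.self_of_nhds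
  set a := √(1 + 2 * m ν₀) with ha
  have hk0 : c.kerElt 0 = V2phi (m ν₀) 0 := c.kerElt_eq ha.symm ⟨by norm_num, by norm_num⟩
  have hk0' : V2phi (m ν₀) 0 ≠ 0 := hk0 ▸ c.kerElt_zero_pos.ne'
  obtain ⟨φ, hφ, hφ0, ⟨L, hL, hL1⟩, hφs, hφu⟩ := c.exists_implicit
  -- The second coordinate makes `b` times the base kernel element agree at `0` with `β V²` for the
  -- current parameter, as the chart requires.
  let θ : ℝ × ℝ → ℝ × ℝ := fun p => (√(1 + 2 * m p.1) - a, p.2 * V2phi (m p.1) 0 / c.kerElt 0)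
  have hθ : ContDiffAt ℝ ω θ (ν₀, 0) := by
    have h1 : ContDiffAt ℝ ω (fun p : ℝ × ℝ => √(1 + 2 * m p.1)) (ν₀, 0) :=
      ContDiffAt.comp (g := fun ν => √(1 + 2 * m ν)) (f := Prod.fst) (ν₀, (0 : ℝ)) h.sqrt
        contDiffAt_fst
    have h2 : ContDiffAt ℝ ω (fun p : ℝ × ℝ => V2phi (m p.1) 0) (ν₀, 0) :=
      ContDiffAt.comp (g := fun ν => V2phi (m ν) 0) (f := Prod.fst) (ν₀, (0 : ℝ)) h.swirl
        contDiffAt_fst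
    exact (h1.sub contDiffAt_const).prodMk ((contDiffAt_snd.mul h2).div_const _)
  have hθ0 : θ (ν₀, 0) = 0 := by simp [θ, ha]
  have hφθ : ContDiffAt ℝ ω (fun p => φ (θ p)) (ν₀, 0) := by
    refine ContDiffAt.comp (ν₀, (0 : ℝ)) ?_ hθ
    rwa [hθ0]
  have htend : Tendsto θ (𝓝 (ν₀, 0)) (𝓝 0) := by
    have := hθ.continuousAt.tendsto
    rwa [hθ0] at this
  have hadm : ∀ᶠ p : ℝ × ℝ in 𝓝 (ν₀, 0), Admissible ε √(1 + 2 * m p.1) ∧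
      √(1 + 2 * m p.1) ^ 2 = 1 + 2 * m p.1 :=
    (continuousAt_fst : ContinuousAt Prod.fst (ν₀, (0 : ℝ))).eventually h.admissible
  have hbeta : ∀ (p : ℝ × ℝ) (c' : Admissible ε √(1 + 2 * m p.1)),
      (θ p).2 * c.kerElt 0 = p.2 * c'.kerElt 0 := fun p c' => by
    rw [c'.kerElt_eq rfl ⟨by norm_num, by norm_num⟩]
    simp only [θ]
    rw [div_mul_cancel₀ _ c.kerElt_zero_pos.ne']
  refine ⟨fun p => c.chartOut (φ (θ p)), c.chartOut.contDiff.contDiffAt.comp _ hφθ,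
    by simp only [hθ0, hφ0, map_zero], ?_, ?_, ?_⟩
  -- At the base parameter the change of coordinates is the identity in `β`, so the derivative is
  -- the image of `L (0, 1) = 0`.
  · have e : (fun β => c.chartOut (φ (θ (ν₀, β)))) = fun β => c.chartOut (φ (0, β)) := by
      funext β
      have : θ (ν₀, β) = (0, β) := by
        simp only [θ, hk0, mul_div_cancel_right₀ _ hk0', ha, sub_self]
      rw [this]
    have h1 : HasDerivAt (fun β : ℝ => ((0 : ℝ), β)) (0, 1) 0 :=
      (hasDerivAt_const _ _).prodMk (hasDerivAt_id _)
    have h2 := (c.chartOut.hasFDerivAt.comp_hasDerivAt (0 : ℝ)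
      (HasFDerivAt.comp_hasDerivAt (0 : ℝ) (show HasFDerivAt φ L ((0 : ℝ), (0 : ℝ)) from hL) h1))
    rw [e]
    rw [hL1, map_zero] at h2
    exact h2
  · filter_upwards [hadm, htend.eventually hφs] with p ⟨c', hm⟩ hs
    obtain ⟨h1, h2⟩ := Prod.ext_iff.1 hs
    obtain ⟨h2, h3⟩ := Prod.ext_iff.1 h2
    have hr := c.reduced_of_chart c' (hbeta p c') h1 h2 h3
    exact ⟨_, (c'.family_of_reduced rfl hm (V := (c.chartOut (φ (θ p))).1) hr).2⟩
  -- The unknown `k` is not determined by `v` and is taken from `φ`. A small solution then has small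
  -- chart coordinates, where uniqueness in the implicit function theorem applies.
  · have hin : Tendsto (fun x : (ℝ × ℝ) × X1 ε => (θ x.1, c.chartIn (θ x.1) (φ (θ x.1)).2.2 x.2))
        (𝓝 (ν₀, 0) ×ˢ 𝓝 0) (𝓝 0) := by
      have t1 : Tendsto (fun x : (ℝ × ℝ) × X1 ε => θ x.1) (𝓝 (ν₀, 0) ×ˢ 𝓝 0) (𝓝 0) :=
        htend.comp tendsto_fst
      have t2 : Tendsto (fun x : (ℝ × ℝ) × X1 ε => (φ (θ x.1)).2.2) (𝓝 (ν₀, 0) ×ˢ 𝓝 0) (𝓝 0) := by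
        have t3 := hφθ.continuousAt.tendsto
        simp only [hθ0, hφ0] at t3
        exact ((continuous_snd.comp continuous_snd).tendsto' (0 : BddFun × BddFun × BddFun)
          (0 : BddFun) rfl).comp (t3.comp tendsto_fst)
      have t4 : Tendsto (fun x : ((ℝ × ℝ) × BddFun) × X1 ε => c.chartIn x.1.1 x.1.2 x.2)
          (𝓝 ((0, 0), 0)) (𝓝 0) := c.continuous_chartIn.tendsto' _ _ c.chartIn_zero
      have t5 := t4.comp ((t1.prodMk_nhds t2).prodMk_nhds tendsto_snd)
      exact t1.prodMk_nhds t5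
    obtain ⟨P, hP, Q, hQ, hPQ⟩ := eventually_prod_iff.1 (hin.eventually hφu)
    obtain ⟨r, hr, hrQ⟩ := Metric.eventually_nhds_iff_ball.1 hQ
    refine ⟨r, hr, ?_⟩
    filter_upwards [hP, hadm, htend.eventually hφs] with p hp ⟨c', hm⟩ hs v hv ⟨κ, hκ⟩
    have h3 : (φ (θ p)).2.2 + (√(1 + 2 * m p.1) - a) • (c.qFun + c.tOp (φ (θ p)).2.2) = 0 :=
      congrArg (fun e => e.2.2) hs
    have hred := c'.reduced_of_family rfl hm hκ
    obtain ⟨h4, h5⟩ := c.chartMap_chartIn c' (hbeta p c') h3 hred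
    have h6 : φ (θ p) = c.chartIn (θ p) (φ (θ p)).2.2 v := hPQ hp (hrQ v (by simpa using hv)) h4
    exact h5.symm.trans (congrArg c.chartOut h6.symm)

/-! ### Uniform bounds -/

namespace Admissible

variable {ε a : ℝ} (c : Admissible ε a)

/-- The bound depends on `ε` only, as does the lower bound below; this makes the neighbourhood of
the uniqueness statement uniform in `μ`. -/
theorem norm_kerElt_le : ‖c.kerElt‖ ≤ 4 * ‖tailOp 0 ε c.pos‖ + 6 := by
  have hq : ‖c.qFun‖ ≤ 2 := by
    refine norm_le_of_ext zero_le_two fun x hx => ?_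
    have hle : 0 ≤ ε - a := by linarith [c.lt]
    rw [qFun, ext_neg, ext_powFun hle hx, abs_neg, abs_of_pos (rpow_dom_pos _ hx)]
    refine (rpow_dom_le hle hx).trans ?_
    calc (2 : ℝ) ^ (ε - a) ≤ 2 ^ (1 : ℝ) :=
          Real.rpow_le_rpow_of_exponent_le one_le_two (by linarith [c.half, c.nonneg])
      _ = 2 := Real.rpow_one 2
  have hu : ‖c.uOp c.qFun‖ ≤ ‖tailOp 0 ε c.pos‖ * 2 := by
    rw [uOp, neg_apply, norm_neg]
    exact (ContinuousLinearMap.le_opNorm _ _).trans (by gcongr)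
  have h := c.mem_M2Sub_qFun.2
  rw [norm_zero] at h
  change normM2 ε (uF ε (c.uOp c.qFun)) ≤ _
  linarith

theorem kerElt_zero_ge : 1 / 4 ≤ c.kerElt 0 := by
  rw [← c.evOp_hHat, hHat_kerElt, evOp_qFun_eq]
  have h1 : ∫ _ in (0 : ℝ)..1, (1 / 4 : ℝ) ≤ tailInt (fun s => (1 + s) ^ (-(1 + a))) 0 := by
    refine intervalIntegral.integral_mono_on zero_le_one (by simp)
      ((RegAtOne.of_continuousOn_Ioc (continuousOn_rpow_weight _)).int 0 zero_mem_Dom)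
      fun s hs => ?_
    calc (1 / 4 : ℝ) = 2 ^ (-2 : ℝ) := by
          rw [Real.rpow_neg zero_le_two, Real.rpow_two]; norm_num
      _ ≤ 2 ^ (-(1 + a)) :=
          Real.rpow_le_rpow_of_exponent_le one_le_two (by linarith [c.lt, c.half])
      _ ≤ (1 + s) ^ (-(1 + a)) :=
          Real.rpow_le_rpow_of_nonpos (by linarith [hs.1]) (by linarith [hs.2])
            (by linarith [c.nonneg])
  simpa using h1

end Admissible

theorem abs_apply_zero_le {ε : ℝ} (u : M2 ε) : |u 0| ≤ ‖u‖ := by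
  have h := le_wSup u.2.2.2.2.1 zero_mem_Dom
  have h1 : 0 ≤ wSup (Ioo (-1) 1) (fun x => (1 + x) ^ (1 + ε)) (deriv u.1) := wSup_nonneg
  have h2 : 0 ≤ wSup (Ioo (-1) 1) (fun x => (1 + x) ^ (2 + ε)) (deriv (deriv u.1)) := wSup_nonneg
  have e : ‖u‖ = normM2 ε u.1 := rfl
  rw [add_zero, Real.one_rpow, one_mul] at h
  rw [e, normM2]
  linarith

/-! ### Parametrizations -/

theorem paramAt_const {ε ν : ℝ} (h0 : 0 < ε) (h : ε < 1 / 2) : ParamAt ε (fun _ => -1 / 2) ν where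
  half := h
  lt := by norm_num; exact h0
  ge := by simp
  sqrt := contDiffAt_const
  swirl := contDiffAt_const

/-- The closed form makes the value at `0` visibly analytic in `μ` away from `-1/2`. -/
theorem V2phi_zero_eq {μ : ℝ} (h1 : -1 / 2 < μ) (h2 : √(1 + 2 * μ) < 1 / 2) :
    V2phi μ 0 = (1 - Real.exp (-√(1 + 2 * μ) * Real.log 2)) / √(1 + 2 * μ) := by
  have hpos : 0 < √(1 + 2 * μ) := Real.sqrt_pos.2 (by linarith)
  -- Any exponent strictly between `√(1+2μ)` and `1/2` serves here; the midpoint is taken.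
  have c : Admissible ((√(1 + 2 * μ) + 1 / 2) / 2) √(1 + 2 * μ) :=
    ⟨hpos.le, by linarith, by linarith⟩
  have h3 := integral_rpow_weight_tail hpos zero_mem_Dom
  rw [← c.kerElt_eq rfl ⟨by norm_num, by norm_num⟩, ← c.evOp_hHat, c.hHat_kerElt, c.evOp_qFun_eq]
  have e : -(1 + √(1 + 2 * μ)) = -1 - √(1 + 2 * μ) := by ring
  rw [tailInt, e, h3, add_zero, Real.one_rpow, Real.rpow_def_of_pos two_pos, mul_comm]

theorem paramAt_id {ε ν : ℝ} (h : ε < 1 / 2) (h1 : -1 / 2 < ν) (h2 : √(1 + 2 * ν) < ε) :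
    ParamAt ε (fun ν => ν) ν := by
  have hs : ContDiffAt ℝ ω (fun ν : ℝ => √(1 + 2 * ν)) ν :=
    ContDiffAt.sqrt (by fun_prop) (by linarith)
  have hpos : 0 < √(1 + 2 * ν) := Real.sqrt_pos.2 (by linarith)
  refine ⟨h, h2, ?_, hs, ?_⟩
  · filter_upwards [lt_mem_nhds h1] with x hx using le_of_lt hx
  · have h3 : ContDiffAt ℝ ω (fun μ : ℝ =>
        (1 - Real.exp (-√(1 + 2 * μ) * Real.log 2)) / √(1 + 2 * μ)) ν :=
      (contDiffAt_const.sub (Real.contDiff_exp.contDiffAt.comp ν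
        (hs.neg.mul contDiffAt_const))).div hs hpos.ne'
    refine h3.congr_of_eventuallyEq ?_
    filter_upwards [lt_mem_nhds h1, hs.continuousAt.eventually_lt_const (h2.trans h)] with μ h4 h5
    exact V2phi_zero_eq h4 h5

/-- A parametrization `m` of the set `K`, constant or the identity, that is admissible along `K`. -/
theorem exists_param {K : Set ℝ}
    (hK : (IsCompact K ∧ K ⊆ Ioo (-1 / 2) (-3 / 8)) ∨ K = {-1 / 2})
    {ε : ℝ} (hε0 : 0 < ε) (hεK : ∀ μ ∈ K, √(1 + 2 * μ) < ε) (hε : ε < 1 / 2) :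
    IsCompact K ∧ ∃ m : ℝ → ℝ, (∀ μ ∈ K, m μ = μ) ∧ ∀ μ ∈ K, ParamAt ε m μ := by
  rcases hK with ⟨hc, hsub⟩ | rfl
  · exact ⟨hc, fun ν => ν, fun _ _ => rfl, fun μ hμ => paramAt_id hε (hsub hμ).1 (hεK μ hμ)⟩
  · exact ⟨isCompact_singleton, fun _ => -1 / 2, fun μ hμ => hμ.symm,
      fun μ _ => paramAt_const hε0 hε⟩

theorem exists_solution_map {K : Set ℝ} (hK : IsCompact K) {ε : ℝ} {m : ℝ → ℝ}
    (hm : ∀ μ ∈ K, ParamAt ε m μ) :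
    ∃ δ > 0, ∃ r > 0, ∃ V : ℝ × ℝ → X1 ε,
      (∃ O : Set ℝ, IsOpen O ∧ K ⊆ O ∧ ContDiffOn ℝ ∞ V (O ×ˢ Metric.ball (0 : ℝ) δ)) ∧
      (∀ μ ∈ K, V (μ, 0) = 0) ∧ (∀ μ ∈ K, HasDerivAt (fun β : ℝ => V (μ, β)) 0 0) ∧
      ∀ μ ∈ K, ∀ β ∈ Metric.ball (0 : ℝ) δ, Solves m (μ, β) (V (μ, β)) ∧
        ∀ v : X1 ε, ‖v‖ < r → Solves m (μ, β) v → v = V (μ, β) := by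
  have hK' : IsCompact (K ×ˢ ({0} : Set ℝ)) := hK.prod isCompact_singleton
  obtain ⟨r, hr, V, hV⟩ := exists_glued (X := X1 ε) hK' (Solves m) (by
    rintro ⟨μ, β⟩ ⟨hμ, rfl⟩
    obtain ⟨W, -, -, -, -, r, hr, hu⟩ := (hm μ hμ).exists_local
    exact ⟨W, r, hr, hu⟩)
  have hloc : ∀ μ ∈ K, ContDiffAt ℝ ω V (μ, 0) ∧ V (μ, 0) = 0 ∧
      HasDerivAt (fun β => V (μ, β)) 0 0 ∧ ∀ᶠ p in 𝓝 (μ, 0), Solves m p (V p) := fun μ hμ => by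
    obtain ⟨W, hW, hW0, hWd, hWs, -⟩ := (hm μ hμ).exists_local
    have he := (hV (μ, 0) ⟨hμ, rfl⟩).2 W hW.continuousAt hW0 hWs
    refine ⟨hW.congr_of_eventuallyEq he, he.self_of_nhds.trans hW0,
      hWd.congr_of_eventuallyEq ?_, ?_⟩
    · have : ContinuousAt (fun β : ℝ => (μ, β)) 0 := by fun_prop
      exact this.eventually he
    · filter_upwards [he, hWs] with p h1 h2
      rwa [h1]
  have hgood : ∀ k ∈ K ×ˢ ({0} : Set ℝ), ∀ᶠ p in 𝓝 k, (ContDiffAt ℝ ω V p ∧ Solves m p (V p)) ∧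
      ∀ v : X1 ε, ‖v‖ < r → Solves m p v → v = V p := by
    rintro ⟨μ, β⟩ ⟨hμ, rfl⟩
    obtain ⟨h1, -, -, h2⟩ := hloc μ hμ
    exact ((h1.eventually (by simp)).and h2).and (hV (μ, 0) ⟨hμ, rfl⟩).1
  -- The good points form a neighbourhood of `K × {0}`. The tube lemma finds a product inside it,
  -- which gives one `δ` for all of `K`.
  obtain ⟨O, T, hO, hT, hKO, h0T, hsub⟩ := generalized_tube_lemma hK
    (isCompact_singleton (x := (0 : ℝ))) isOpen_interior fun k hk =>
      mem_interior_iff_mem_nhds.2 (hgood k hk)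
  obtain ⟨δ, hδ, hball⟩ := Metric.isOpen_iff.1 hT 0 (h0T rfl)
  have hG : ∀ p ∈ O ×ˢ Metric.ball (0 : ℝ) δ, (ContDiffAt ℝ ω V p ∧ Solves m p (V p)) ∧
      ∀ v : X1 ε, ‖v‖ < r → Solves m p v → v = V p := fun p hp => by
    have h := interior_subset (hsub ⟨hp.1, hball hp.2⟩)
    exact h
  refine ⟨δ, hδ, r, hr, V, ⟨O, hO, hKO, fun p hp =>
    ((hG p hp).1.1.of_le le_top).contDiffWithinAt⟩, fun μ hμ => (hloc μ hμ).2.1,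
    fun μ hμ => (hloc μ hμ).2.2.1, fun μ hμ β hβ => ?_⟩
  obtain ⟨⟨-, h1⟩, h2⟩ := hG (μ, β) ⟨hKO hμ, hβ⟩
  exact ⟨h1, h2⟩

/-- A solution near `U^μ` is `U^μ + β V²` plus a small element of `X₁(ε)`. -/
theorem Admissible.exists_decomposition {ε a μ : ℝ} (c : Admissible ε a) (ha : √(1 + 2 * μ) = a)
    (W : X ε) : ∃ (β : ℝ) (v : X1 ε), |β| ≤ 4 * ‖W‖ ∧
      ‖v‖ ≤ (1 + 4 * (4 * ‖tailOp 0 ε c.pos‖ + 6)) * ‖W‖ ∧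
      ∀ x ∈ Ioc (-1 : ℝ) 1, W.fst x = v.1.fst x ∧ W.snd x = β * V2phi μ x + v.1.snd x := by
  have hk := c.kerElt_zero_ge
  have hk0 : c.kerElt 0 ≠ 0 := by linarith
  have hW : ‖W‖ = ‖W.fst‖ + ‖W.snd‖ := norm_X ε W
  set β := W.snd 0 / c.kerElt 0 with hβ
  have hβle : |β| ≤ 4 * ‖W‖ := by
    rw [hβ, abs_div, abs_of_pos (by linarith : 0 < c.kerElt 0), div_le_iff₀ (by linarith)]
    have h1 := abs_apply_zero_le W.snd
    have h2 := norm_nonneg W.fst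
    have h3 := norm_nonneg W
    nlinarith
  refine ⟨β, ⟨WithLp.toLp 1 (W.fst, W.snd - β • c.kerElt), ?_⟩, hβle, ?_, fun x hx => ⟨rfl, ?_⟩⟩
  · change W.snd 0 - β * c.kerElt 0 = 0
    rw [hβ, div_mul_cancel₀ _ hk0, sub_self]
  · have h1 : ‖WithLp.toLp 1 (W.fst, W.snd - β • c.kerElt)‖ =
      ‖W.fst‖ + ‖W.snd - β • c.kerElt‖ := norm_X ε _
    change ‖WithLp.toLp 1 (W.fst, W.snd - β • c.kerElt)‖ ≤ _
    have h2 : ‖β • c.kerElt‖ ≤ 4 * ‖W‖ * (4 * ‖tailOp 0 ε c.pos‖ + 6) := by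
      rw [norm_smul]
      exact mul_le_mul hβle c.norm_kerElt_le (norm_nonneg _) (by positivity)
    have h3 := norm_sub_le W.snd (β • c.kerElt)
    rw [h1]
    linarith
  · have h1 : (W.snd - β • c.kerElt : M2 ε) x = W.snd x - β * c.kerElt x := rfl
    change W.snd x = β * V2phi μ x + (W.snd - β • c.kerElt : M2 ε) x
    rw [h1, c.kerElt_eq ha hx]
    ring

end ConicalNS

/-! ### The main theorem -/

theorem theorem4p3 (K : Set ℝ)
    (hK : (IsCompact K ∧ K ⊆ Ioo (-1 / 2) (-3 / 8)) ∨ K = {-1 / 2})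
    (ε : ℝ) (hε0 : 0 < ε) (hεK : ∀ μ ∈ K, √(1 + 2 * μ) < ε) (hε : ε < 1 / 2) :
    ∃ δ > 0, ∃ V : ℝ × ℝ → X1 ε,
      (∃ O : Set ℝ, IsOpen O ∧ K ⊆ O ∧ ContDiffOn ℝ ∞ V (O ×ˢ Metric.ball (0 : ℝ) δ)) ∧
      (∀ μ ∈ K, V (μ, 0) = 0) ∧
      (∀ μ ∈ K, HasDerivAt (fun β : ℝ => V (μ, β)) 0 0) ∧
      (∀ μ ∈ K, ∀ β ∈ Metric.ball (0 : ℝ) δ,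
        IntervalIntegrable (psiInner (familyPhi μ β (V (μ, β)).1)) volume (-1) 1 ∧
        IsSolution (familyTheta μ (V (μ, β)).1) (familyPhi μ β (V (μ, β)).1)
          (μ - 1 / 4 * psi (familyPhi μ β (V (μ, β)).1) (-1)) ∧
        (β ≠ 0 → ∃ x ∈ Ioo (-1 : ℝ) 1, familyPhi μ β (V (μ, β)).1 x ≠ 0)) ∧
      ∃ δ' > 0, ∀ μ ∈ K, ∀ Uθ Uφ : ℝ → ℝ, ∀ W : X ε,
        (∀ x ∈ Ioc (-1 : ℝ) 1, Uθ x - Ubar μ x = W.fst x ∧ Uφ x = W.snd x) → ‖W‖ < δ' →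
        (∃ κ : ℝ, IsSolution Uθ Uφ κ) →
        ∃ β : ℝ, |β| < δ ∧ ∀ x ∈ Ioc (-1 : ℝ) 1,
          Uθ x = familyTheta μ (V (μ, β)).1 x ∧ Uφ x = familyPhi μ β (V (μ, β)).1 x := by
  obtain ⟨hKc, m, hmK, hm⟩ := exists_param hK hε0 hεK hε
  obtain ⟨δ, hδ, r, hr, V, hO, hV0, hVd, hVs⟩ := exists_solution_map hKc hm
  have hadm : ∀ μ ∈ K, ∃ _ : Admissible ε √(1 + 2 * μ), √(1 + 2 * μ) ^ 2 = 1 + 2 * μ :=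
    fun μ hμ => by
      have h := (hm μ hμ).admissible.self_of_nhds
      rw [hmK μ hμ] at h
      exact ⟨h.1, h.2⟩
  refine ⟨δ, hδ, V, hO, hV0, hVd, fun μ hμ β hβ => ?_, ?_⟩
  · obtain ⟨c, hc⟩ := hadm μ hμ
    obtain ⟨κ, hκ⟩ := (hVs μ hμ β hβ).1
    simp only [hmK μ hμ] at hκ
    -- The construction yields some constant `κ`; passing to the reduced system and back replaces it
    -- by `μ - ψ(-1)/4`.
    obtain ⟨h1, h2⟩ := c.family_of_reduced rfl hc (c.reduced_of_family rfl hc hκ)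
    refine ⟨h1, h2, fun hβ0 => ⟨0, zero_mem_Dom, ?_⟩⟩
    -- At `x = 0` the correction vanishes, so the swirl there is `β V²_μ(0)`, and `V²_μ(0) > 0`.
    have h3 : (V (μ, β)).1.snd 0 = 0 := (V (μ, β)).2
    rw [familyPhi, h3, add_zero, ← c.kerElt_eq rfl ⟨by norm_num, by norm_num⟩]
    exact mul_ne_zero hβ0 c.kerElt_zero_pos.ne'
  · have hC : 0 < 1 + 4 * (4 * ‖tailOp 0 ε hε0‖ + 6) := by positivity
    -- The two entries come from the bounds on `|β|` and `‖v‖` in `exists_decomposition`: the first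
    -- forces `|β| < δ`, the second `‖v‖ < r`.
    refine ⟨min (δ / 4) (r / (1 + 4 * (4 * ‖tailOp 0 ε hε0‖ + 6))),
      lt_min (by positivity) (div_pos hr hC), fun μ hμ Uθ Uφ W hW hWn ⟨κ, hκ⟩ => ?_⟩
    obtain ⟨c, hc⟩ := hadm μ hμ
    obtain ⟨β, v, hβ, hv, hdec⟩ := c.exists_decomposition rfl W
    have hβδ : |β| < δ := by
      have := hWn.trans_le (min_le_left _ _)
      linarith
    have hvr : ‖v‖ < r := by
      have h1 := hWn.trans_le (min_le_right _ _)
      rw [lt_div_iff₀ hC] at h1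
      exact hv.trans_lt (by rwa [mul_comm])
    have hU : ∀ x ∈ Ioc (-1 : ℝ) 1, Uθ x = familyTheta μ v.1 x ∧ Uφ x = familyPhi μ β v.1 x :=
      fun x hx => by
        obtain ⟨h1, h2⟩ := hW x hx
        obtain ⟨h3, h4⟩ := hdec x hx
        rw [familyTheta, familyPhi, ← h3, ← h4]
        exact ⟨by linarith, h2⟩
    have hsol : Solves m (μ, β) v := by
      refine ⟨κ, ?_⟩
      simp only [hmK μ hμ]
      exact hκ.congr (fun x hx => (hU x (Ioo_subset_Ioc_self hx)).1.symm)
        fun x hx => (hU x (Ioo_subset_Ioc_self hx)).2.symm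
    have hball : β ∈ Metric.ball (0 : ℝ) δ := by simpa using hβδ
    rw [(hVs μ hμ β hball).2 v hvr hsol] at hU
    exact ⟨β, hβδ, hU⟩
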